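/- **Setting.** Let $\mathcal S$ be a compact surface of revolution with meridian length $L>0$, diffeomorphic to a sphere, a disk, or a cylinder, with geodesic coordinates $(s,\theta)\in(0,L)\times\mathbb R/2\pi\mathbb Z$ and metric $g=ds^2+R(s)^2d\theta^2$. The poles are $\mathcal P=\{0,L\}$ (sphere), $\{0\}$ (disk), $\emptyset$ (cylinder), $I_L=[0,L]\setminus\mathcal P$, and the boundary is $\{s\in\{0,L\}\setminus\mathcal P\}$. Here $R\in C^\infty([0,L])$, $R>0$ on $I_L$, all even-order derivatives of $R$ (including $R$ itself) vanish at the poles, and $R'=1$ at a pole $s=0$, $R'=-1$ at a pole $s=L$. Let $f=f(s)\in W^{2,\infty}(0,L)$ be real with $f'=0$ at the poles, let $q=q(s)\in L^\infty(0,L)$ be real, and for $\varepsilon>0$ let $$P_\varepsilon=-\varepsilon^2\Delta_g+\tfrac14|f'|^2+\tfrac{\varepsilon}{2}\Delta_g f-\varepsilon q .$$ Fix $c>0$, put $\varepsilon_k=c/k$ and $$V_c(s)=\frac{c^2}{R(s)^2}+\frac{|f'(s)|^2}{4},$$ and assume that $V_c$ attains its minimum over $I_L$ at exactly one point $s_{\min}\in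 I_L$. Put $$d_A^c(s)=\Big|\int_{s_{\min}}^s\sqrt{V_c(y)-V_c(s_{\min})}\,dy\Big|,\qquad d_A^c(J)=\inf_{s\in J}d_A^c(s)\quad(\emptyset\ne J\subset I_L).$$ For $J\subset I_L$, $\|\cdot\|_{L^2(\{s\in J\})}$ is the norm for the Riemannian volume $R\,ds\,d\theta$ on the rotationally invariant set $\{s\in J\}$. Let $\mu_k\in\mathbb R$ with $\mu_k\to V_c(s_{\min})$ as $k\to\infty$, $k\in\mathbb N$, and, for all large $k$, let $\psi_k\in H^2(\mathcal S)$ satisfy $$P_{\varepsilon_k}\psi_k=\mu_k\psi_k,\quad \psi_k|_{\partial\mathcal S}=0,\quad \|\psi_k\|_{L^2(\mathcal S)}=1,\quad \psi_k(s,\theta)=e^{ik\theta}\varphi_k(s).$$ **Statement.** 1. (Lower bound.) For all $\eta,\delta>0$ there are $k_0$ and $C>0$ such that for all $k\ge k_0$ and all $s\in I_L$ with $\operatorname{dist}(s,\mathcal P)>\eta$ (no condition if $\mathcal P=\emptyset$), $$\|\psi_k\|_{L^2(\{s'\in I_L:\,|s'-s|<\eta\})}\ \ge\ C\,e^{-\frac1{\varepsilon_k}(d_A^c(s)+\delta)}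 .$$ 2. (Matching Agmon upper bound.) For all $\delta\in(0,1)$ there are $k_0$ and $C>0$ such that for all $k\ge k_0$ and all nonempty measurable $J\subset I_L$, $$\|\psi_k\|_{L^2(\{s\in J\})}\ \le\ C\,e^{-\frac1{\varepsilon_k}((1-\delta)d_A^c(J)-\delta)} .$$ 3. (Optimal exponential constant.) Let $f=0$ and $q=0$, so that $-\Delta_g\psi_k=\lambda_k\psi_k$ with $\lambda_k=\mu_k/\varepsilon_k^2$, and let $d_A=d_A^1$ (defined with $f=0$, $c=1$). For every nonempty relatively open $J\subset I_L$, with $\omega=\{s\in J\}$, the infimum of the $K\in\mathbb R$ for which there are $C>0$ and $k_0$ such that $$\|\psi_k\|_{L^2(\mathcal S)}\le C\,e^{K\sqrt{\lambda_k}}\,\|\psi_k\|_{L^2(\omega)}\quad\text{for all }k\ge k_0$$ is equal to $R(s_{\min})\,d_A(J)$. -/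

import Mathlib

open Set Filter Topology MeasureTheory
open scoped ENNReal ContDiff

/-- The three topological types of compact surfaces of revolution: sphere (two poles), disk (one
pole, one boundary circle), cylinder (no pole, two boundary circles). -/
inductive RevKind
  | sphere
  | disk
  | cylinder

/-- The values of the arclength coordinate `s ∈ [0, L]` that correspond to poles. -/
def RevKind.poles : RevKind → ℝ → Set ℝ
  | RevKind.sphere, L => {0, L}
  | RevKind.disk, _ => {0}
  | RevKind.cylinder, _ => ∅

/-- A compact surface of revolution, described in geodesic coordinates `(s, θ)` by its metric
`ds² + R(s)² dθ²`. Here `s` is the distance to the north pole (or to the north boundary circle),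
`L` is the length of a meridian, and `R : [0, L] → [0, ∞)` is the profile (in the embedded case,
the distance to the axis). The conditions at the poles are exactly those under which the
metric extends smoothly through the pole. -/
structure RevSurface where
  kind : RevKind
  L : ℝ
  L_pos : 0 < L
  R : ℝ → ℝ
  R_smooth : ContDiffOn ℝ ∞ R (Icc 0 L)
  R_pos : ∀ s ∈ Icc 0 L \ kind.poles L, 0 < R s
  R_north : (0 : ℝ) ∈ kind.poles L →
    derivWithin R (Icc 0 L) 0 = 1 ∧ ∀ p : ℕ, iteratedDerivWithin (2 * p) R (Icc 0 L) 0 = 0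
  R_south : L ∈ kind.poles L →
    derivWithin R (Icc 0 L) L = -1 ∧ ∀ p : ℕ, iteratedDerivWithin (2 * p) R (Icc 0 L) L = 0

namespace RevSurface

noncomputable section

/-- The set of poles, in the coordinate `s`. -/
def poles (S : RevSurface) : Set ℝ := S.kind.poles S.L

/-- The interval `I_L = [0, L] \ poles`: it is `(0, L)` for the sphere, `(0, L]` for the disk and
`[0, L]` for the cylinder. -/
def IL (S : RevSurface) : Set ℝ := Icc 0 S.L \ S.poles

/-- The boundary circles, in the coordinate `s`. -/
def bdry (S : RevSurface) : Set ℝ := {0, S.L} \ S.poles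

/-- `d/ds` for functions on `[0, L]` (one-sided at the end points). -/
def ds (S : RevSurface) (h : ℝ → ℝ) : ℝ → ℝ := derivWithin h (Icc 0 S.L)

/-- The Riemannian volume `R(s) ds dθ` in the coordinates `(s, θ) ∈ (0, L) × (0, 2π]`.
Poles and boundary circles are null sets. -/
def vol (S : RevSurface) : Measure (ℝ × ℝ) :=
  (volume.restrict (Ioo 0 S.L ×ˢ Ioc 0 (2 * Real.pi))).withDensity
    fun p => ENNReal.ofReal (S.R p.1)

/-- The part `{s ∈ J}` of the surface, a union of rings. -/
def ring (J : Set ℝ) : Set (ℝ × ℝ) := J ×ˢ univ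

/-- The norm of `u` in `L²({s ∈ J})` for the Riemannian volume. -/
def normL2 (S : RevSurface) (J : Set ℝ) (u : ℝ × ℝ → ℂ) : ℝ :=
  (eLpNorm u 2 (S.vol.restrict (ring J))).toReal

/-- The interior of the surface without its poles, `(0, L) × ℝ`, as a covering of
`(0, L) × (ℝ / 2πℤ)`. -/
def cover (S : RevSurface) : Set (ℝ × ℝ) := Ioo 0 S.L ×ˢ univ

/-- `w` is the weak derivative of `u` in the direction `v` on the open set `Ω ⊆ ℝ²`. -/
def IsWeakDeriv (Ω : Set (ℝ × ℝ)) (v : ℝ × ℝ) (u w : ℝ × ℝ → ℂ) : Prop :=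
  LocallyIntegrableOn u Ω ∧ LocallyIntegrableOn w Ω ∧
    ∀ χ : ℝ × ℝ → ℝ, ContDiff ℝ ∞ χ → HasCompactSupport χ → tsupport χ ⊆ Ω →
      ∫ p in Ω, (fderiv ℝ χ p v) • u p = - ∫ p in Ω, χ p • w p

/-- `u` belongs to the Sobolev space `H²(S)`, with weak coordinate derivatives
`us, ut, uss, ust, utt`. A function on the surface is a function of `(s, θ)` that is `2π`-periodic
in `θ`. The function, the components of its differential and the components of its covariant
Hessian, in the orthonormal frame `∂_s, R⁻¹ ∂_θ`, are square integrable for the Riemannian volume.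
(Points are removable for first order weak derivatives in dimension two, so that it is
equivalent to ask for the weak derivatives on the surface or on the surface minus its poles.) -/
structure IsH2 (S : RevSurface) (u us ut uss ust utt : ℝ × ℝ → ℂ) : Prop where
  periodic : ∀ s θ : ℝ, u (s, θ + 2 * Real.pi) = u (s, θ)
  weak_s : IsWeakDeriv S.cover (1, 0) u us
  weak_t : IsWeakDeriv S.cover (0, 1) u ut
  weak_ss : IsWeakDeriv S.cover (1, 0) us uss
  weak_st : IsWeakDeriv S.cover (0, 1) us ust
  weak_tt : IsWeakDeriv S.cover (0, 1) ut utt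
  mem : MemLp u 2 S.vol
  mem_s : MemLp us 2 S.vol
  mem_t : MemLp (fun p => ut p / (S.R p.1 : ℂ)) 2 S.vol
  mem_ss : MemLp uss 2 S.vol
  mem_st : MemLp (fun p => ust p / (S.R p.1 : ℂ)
    - (S.ds S.R p.1 : ℂ) / (S.R p.1 : ℂ) ^ 2 * ut p) 2 S.vol
  mem_tt : MemLp (fun p => utt p / (S.R p.1 : ℂ) ^ 2
    + (S.ds S.R p.1 : ℂ) / (S.R p.1 : ℂ) * us p) 2 S.vol

/-- Dirichlet condition `u = 0` on the boundary of the surface (no condition for the sphere), for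
the continuous representative of `u`, which exists for `u` in `H²(S)`. -/
def ZeroOnBdry (S : RevSurface) (u : ℝ × ℝ → ℂ) : Prop :=
  ∃ v : ℝ × ℝ → ℂ, ContinuousOn v (S.IL ×ˢ univ) ∧ (∀ᵐ p ∂volume.restrict S.cover, v p = u p) ∧
    ∀ s ∈ S.bdry, ∀ θ : ℝ, v (s, θ) = 0

/-- The rotationally invariant function `f = f(s)` is in `W^{2,∞}` of the surface: `f` is
differentiable on `[0, L]`, its derivative is Lipschitz, and it vanishes at the poles. -/
def IsW2Inf (S : RevSurface) (f : ℝ → ℝ) : Prop :=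
  DifferentiableOn ℝ f (Icc 0 S.L) ∧ (∃ K, LipschitzOnWith K (S.ds f) (Icc 0 S.L)) ∧
    ∀ s ∈ S.poles, S.ds f s = 0

/-- The Laplace-Beltrami operator on a rotationally invariant function,
`R⁻¹ (R f')' = f'' + (R' / R) f'` (defined almost everywhere). -/
def lapRadial (S : RevSurface) (f : ℝ → ℝ) (s : ℝ) : ℝ :=
  deriv (S.ds f) s + S.ds S.R s / S.R s * S.ds f s

/-- The Laplace-Beltrami operator
`R⁻¹ ∂_s (R ∂_s u) + R⁻² ∂_θ² u = ∂_s² u + (R' / R) ∂_s u + R⁻² ∂_θ² u`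
in terms of the weak derivatives of `u`. -/
def lap (S : RevSurface) (us uss utt : ℝ × ℝ → ℂ) (p : ℝ × ℝ) : ℂ :=
  uss p + (S.ds S.R p.1 : ℂ) / (S.R p.1 : ℂ) * us p + utt p / (S.R p.1 : ℂ) ^ 2

/-- The zero order coefficient `|f'|² / 4 + ε (Δf / 2 - q)`. -/
def potential (S : RevSurface) (f q : ℝ → ℝ) (ε s : ℝ) : ℝ :=
  (S.ds f s) ^ 2 / 4 + ε * (S.lapRadial f s / 2 - q s)

/-- `u ∈ H²(S)` satisfies `P_ε u = μ u` on the surface and `u = 0` on its boundary, where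
`P_ε = - ε² Δ + |∇f|² / 4 + ε Δf / 2 - ε q`. -/
def SolvesEigen (S : RevSurface) (f q : ℝ → ℝ) (ε μ : ℝ) (u : ℝ × ℝ → ℂ) : Prop :=
  (∃ us ut uss ust utt : ℝ × ℝ → ℂ, S.IsH2 u us ut uss ust utt ∧
    ∀ᵐ p ∂S.vol, -(ε : ℂ) ^ 2 * S.lap us uss utt p + (S.potential f q ε p.1 : ℂ) * u p
      = (μ : ℂ) * u p) ∧
  S.ZeroOnBdry u

/-- The effective potential `V_c = c² / R² + |f'|² / 4`. -/
def V (S : RevSurface) (f : ℝ → ℝ) (c s : ℝ) : ℝ :=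
  c ^ 2 / (S.R s) ^ 2 + (S.ds f s) ^ 2 / 4

/-- The Agmon distance to `s₀` at the energy level `V_c(s₀)`. -/
def dA (S : RevSurface) (f : ℝ → ℝ) (c s₀ s : ℝ) : ℝ :=
  |∫ y in s₀..s, Real.sqrt (S.V f c y - S.V f c s₀)|

/-- The Agmon distance from `s₀` to the set `{s ∈ J}`, for `J` a nonempty subset of `I_L`. -/
def dASet (S : RevSurface) (f : ℝ → ℝ) (c s₀ : ℝ) (J : Set ℝ) : ℝ :=
  sInf (S.dA f c s₀ '' J)

end

end RevSurface

/-! ### Absolutely continuous functions -/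

/-! Separation of variables turns the problem into a singularly perturbed ODE on `(0, L)`. The
radial factor `v` solves `ε² (v'' + (R'/R) v') = Q v`, where `Q` is within `τ_k → 0` of `W = V_c -
V_c(smin) ≥ 0`: the two error sources are `μ_k - V_c(smin)` and the bounded lower order terms times
`ε`. Since `v` is complex and only weakly differentiable, everything is expressed through the real
quantities `y = |v|²`, `z = R Re(conj v v')`, `e = |v'|²`, which satisfy a closed first order linear
system almost everywhere (`RadialEnergy`).

Upper bound. Integrate `(χ z)'` with `χ = cosh(2 t D / ε)`, where `D` is the signed Agmon distance
and `t = 1 - δ`. Because `|sinh| ≤ cosh` and `D' = √W`, completing a square leaves `∫ χ R ((1 - t²)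
W - τ) y ≤ 0` (`RadialEnergy.agmon`). Away from `smin` the bracket is bounded below by a positive
constant, so the weighted mass is controlled by the mass near `smin`, where the weight is at most
`exp(2δ/ε)`. No boundary term survives: arbitrarily close to each end there are points where `z` has
the favourable sign, by the Dirichlet condition at a boundary circle and by integrability of `y / R`
at a pole.

Lower bound. The case `t = 0` of the same estimate shows that a fixed share of the mass lies near
`smin`, which gives a point with `R y` bounded below. The energy density `ε² e + A y`, with `A`
slightly above `W`, has logarithmic derivative at most `(2/ε)(√W + small)` in absolute value, so by
Gronwall it decays no faster than `exp(-2 (d_A + δ)/ε)`. A Caccioppoli inequality converts energy on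
a short interval back into mass. All constants live on one compact subinterval of `I_L`, whence the
uniformity in `s`.

Optimal constant. When `f = 0` the Agmon distance scales linearly in `c`, and `√λ_k = k √μ_k / c`
with `√μ_k / c → 1 / R(smin)`. The two bounds make the observed norm `exp(-k (d + o(1)))`, and
comparing exponents gives the infimum `R(smin) d`. -/

theorem AbsolutelyContinuousOnInterval.ftc {f f' : ℝ → ℝ} {a b : ℝ}
    (hf : AbsolutelyContinuousOnInterval f a b)
    (hd : ∀ᵐ x, x ∈ uIcc a b → HasDerivAt f (f' x) x) :
    IntervalIntegrable f' volume a b ∧ ∫ x in a..b, f' x = f b - f a := by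
  have h : ∀ᵐ x, x ∈ uIoc a b → deriv f x = f' x := by
    filter_upwards [hd] with x hx hxm using (hx (uIoc_subset_uIcc hxm)).deriv
  refine ⟨hf.intervalIntegrable_deriv.congr_ae ?_, ?_⟩
  · rw [EventuallyEq, ae_restrict_iff' measurableSet_uIoc]
    exact h
  · rw [← hf.integral_deriv_eq_sub]
    refine intervalIntegral.integral_congr_ae ?_
    filter_upwards [h] with x hx hxm using (hx hxm).symm

theorem AbsolutelyContinuousOnInterval.le_of_deriv_nonneg {f f' : ℝ → ℝ} {a b : ℝ} (hab : a ≤ b)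
    (hf : AbsolutelyContinuousOnInterval f a b)
    (hd : ∀ᵐ x, x ∈ Icc a b → HasDerivAt f (f' x) x)
    (h0 : ∀ᵐ x, x ∈ Icc a b → 0 ≤ f' x) : f a ≤ f b := by
  rw [← uIcc_of_le hab] at hd
  have h := (hf.ftc hd).2
  have : 0 ≤ ∫ x in a..b, f' x := by
    refine intervalIntegral.integral_nonneg_of_ae_restrict hab ?_
    rw [EventuallyLE, ae_restrict_iff' measurableSet_Icc]
    exact h0
  linarith

theorem absolutelyContinuousOnInterval_of_hasDerivAt {f f' : ℝ → ℝ} {a b : ℝ}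
    (hf : ∀ x ∈ uIcc a b, HasDerivAt f (f' x) x) (hc : ContinuousOn f' (uIcc a b)) :
    AbsolutelyContinuousOnInterval f a b := by
  obtain ⟨C, hC⟩ := isCompact_uIcc.exists_bound_of_continuousOn hc
  refine LipschitzOnWith.absolutelyContinuousOnInterval (K := C.toNNReal) ?_
  refine Convex.lipschitzOnWith_of_nnnorm_hasDerivWithin_le (convex_uIcc a b)
    (fun x hx => (hf x hx).hasDerivWithinAt) fun x hx => ?_
  rw [← NNReal.coe_le_coe]
  exact (hC x hx).trans (Real.le_coe_toNNReal C)

/-! ### One-dimensional weak derivatives -/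

/-- The midpoint is forced inside the interval because it is the base point of all primitives below.
-/
theorem IsCompact.exists_subset_Ioo {L : ℝ} (hL : 0 < L) {K : Set ℝ} (hK : IsCompact K)
    (hKL : K ⊆ Ioo 0 L) :
    ∃ α β, 0 < α ∧ α < L / 2 ∧ L / 2 < β ∧ β < L ∧ K ⊆ Ioo α β := by
  have hc : IsCompact (insert (L / 2) K) := hK.insert _
  have hne : (insert (L / 2) K).Nonempty := insert_nonempty _ _
  have hm : L / 2 ∈ insert (L / 2) K := mem_insert _ _
  have hsub : insert (L / 2) K ⊆ Ioo 0 L := by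
    rintro x (rfl | hx)
    · constructor <;> linarith
    · exact hKL hx
  obtain ⟨a, ha, ha'⟩ := hc.exists_isLeast hne
  obtain ⟨b, hb, hb'⟩ := hc.exists_isGreatest hne
  have h1 := hsub ha
  have h2 := hsub hb
  have h3 := ha' hm
  have h4 := hb' hm
  refine ⟨a / 2, (b + L) / 2, by linarith [h1.1], by linarith [h1.1], by linarith [h2.2],
    by linarith [h2.2], fun x hx => ?_⟩
  have h5 := ha' (mem_insert_of_mem _ hx)
  have h6 := hb' (mem_insert_of_mem _ hx)
  constructor <;> linarith [h1.1, h2.2]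

theorem MeasureTheory.LocallyIntegrableOn.intervalIntegrable_Ioo {L α β : ℝ} {h : ℝ → ℝ}
    (hh : LocallyIntegrableOn h (Ioo 0 L)) (hα : α ∈ Ioo 0 L) (hβ : β ∈ Ioo 0 L) :
    IntervalIntegrable h volume α β := by
  have hs : uIcc α β ⊆ Ioo 0 L := ordConnected_Ioo.uIcc_subset hα hβ
  exact (hh.integrableOn_compact_subset hs isCompact_uIcc).intervalIntegrable

theorem locallyIntegrableOn_primitive {L : ℝ} {h : ℝ → ℝ}
    (hh : LocallyIntegrableOn h (Ioo 0 L)) {x₀ : ℝ} (hx₀ : x₀ ∈ Ioo 0 L) :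
    ContinuousOn (fun x => ∫ t in x₀..x, h t) (Ioo 0 L) := by
  intro x hx
  obtain ⟨a, ha0, hax⟩ := exists_between (lt_min hx.1 hx₀.1)
  obtain ⟨b, hbx, hbL⟩ := exists_between (max_lt hx.2 hx₀.2)
  have ha : a ∈ Ioo 0 L := ⟨ha0, (hax.trans_le (min_le_left _ _)).trans hx.2⟩
  have hb : b ∈ Ioo 0 L := ⟨hx.1.trans ((le_max_left _ _).trans_lt hbx), hbL⟩
  have hab : a ≤ b := (hax.trans_le (min_le_left _ _)).le.trans ((le_max_left _ _).trans hbx.le)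
  have hac := (hh.intervalIntegrable_Ioo ha hb).absolutelyContinuousOnInterval_intervalIntegral
    (c := x₀) (by rw [uIcc_of_le hab]; exact ⟨(hax.trans_le (min_le_right _ _)).le,
      ((le_max_right _ _).trans_lt hbx).le⟩)
  have := hac.continuousOn
  rw [uIcc_of_le hab] at this
  exact (this.continuousAt (Icc_mem_nhds (hax.trans_le (min_le_left _ _))
    ((le_max_left _ _).trans_lt hbx))).continuousWithinAt

theorem integral_deriv_mul_primitive {L : ℝ} (hL : 0 < L) {h χ : ℝ → ℝ}
    (hh : LocallyIntegrableOn h (Ioo 0 L)) (hχ : ContDiff ℝ ∞ χ) (hc : HasCompactSupport χ)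
    (hs : tsupport χ ⊆ Ioo 0 L) :
    ∫ x, deriv χ x * ∫ t in (L / 2)..x, h t = -∫ x, χ x * h x := by
  obtain ⟨α, β, hα, hα2, hβ2, hβ, hK⟩ := IsCompact.exists_subset_Ioo hL hc hs
  have hab : α ≤ β := by linarith
  have hI : IntervalIntegrable h volume α β :=
    hh.intervalIntegrable_Ioo ⟨hα, by linarith⟩ ⟨by linarith, hβ⟩
  have hm : L / 2 ∈ uIcc α β := by rw [uIcc_of_le hab]; constructor <;> linarith
  have hac := hI.absolutelyContinuousOnInterval_intervalIntegral (c := L / 2) hm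
  have hχac : AbsolutelyContinuousOnInterval χ α β :=
    (hχ.of_le (by exact_mod_cast le_top)).contDiffOn.absolutelyContinuousOnInterval
  have key := hac.integral_mul_deriv_eq_deriv_mul hχac
  have hχ0 : ∀ x ∉ Ioo α β, χ x = 0 := fun x hx =>
    image_eq_zero_of_notMem_tsupport fun h => hx (hK h)
  rw [hχ0 β (by simp), hχ0 α (by simp)] at key
  have e1 : ∫ x, deriv χ x * ∫ t in (L / 2)..x, h t
      = ∫ x in α..β, (∫ t in (L / 2)..x, h t) * deriv χ x := by
    rw [← intervalIntegral.integral_eq_integral_of_support_subset (a := α) (b := β)]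
    · simp_rw [mul_comm]
    · refine (Function.support_mul_subset_left _ _).trans ?_
      exact ((subset_tsupport _).trans (tsupport_deriv_subset (𝕜 := ℝ))).trans
        (hK.trans Ioo_subset_Ioc_self)
  have e2 : ∫ x, χ x * h x = ∫ x in α..β, deriv (fun x => ∫ t in (L / 2)..x, h t) x * χ x := by
    rw [← intervalIntegral.integral_eq_integral_of_support_subset (a := α) (b := β)]
    · refine intervalIntegral.integral_congr_ae ?_
      filter_upwards [hI.ae_hasDerivAt_integral] with x hx hxm
      rw [(hx (uIoc_subset_uIcc hxm) _ hm).deriv, mul_comm]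
    · exact (Function.support_mul_subset_left _ _).trans
        ((subset_tsupport _).trans (hK.trans Ioo_subset_Ioc_self))
  rw [e1, e2, key]
  ring

theorem integrable_mul_of_locallyIntegrableOn {L : ℝ} {g χ : ℝ → ℝ}
    (hg : LocallyIntegrableOn g (Ioo 0 L)) (hχ : Continuous χ) (hc : HasCompactSupport χ)
    (hs : tsupport χ ⊆ Ioo 0 L) : Integrable fun x => χ x * g x := by
  have h1 : IntegrableOn (fun x => χ x * g x) (tsupport χ) :=
    (hg.integrableOn_compact_subset hs hc).continuousOn_mul hχ.continuousOn hc
  rwa [integrableOn_iff_integrable_of_support_subset] at h1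
  exact (Function.support_mul_subset_left _ _).trans (subset_tsupport _)

/-- The du Bois-Reymond lemma. Subtracting from a test function its integral times a fixed bump of
mass one leaves a function of integral zero, whose primitive is again an admissible test function;
so `g` minus its average against the bump is orthogonal to every test function. -/
theorem ae_eq_const_of_integral_deriv_mul_eq_zero {L : ℝ} (hL : 0 < L) {g : ℝ → ℝ}
    (hg : LocallyIntegrableOn g (Ioo 0 L))
    (H : ∀ χ : ℝ → ℝ, ContDiff ℝ ∞ χ → HasCompactSupport χ → tsupport χ ⊆ Ioo 0 L →
      ∫ x, deriv χ x * g x = 0) :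
    ∃ C, ∀ᵐ x, x ∈ Ioo 0 L → g x = C := by
  let w : ContDiffBump (L / 2) := ⟨L / 8, L / 4, by linarith, by linarith⟩
  let χ₀ : ℝ → ℝ := w.normed volume
  have hχ₀ : ContDiff ℝ ∞ χ₀ := w.contDiff_normed
  have hc₀ : HasCompactSupport χ₀ := w.hasCompactSupport_normed
  have hs₀ : tsupport χ₀ ⊆ Ioo 0 L := by
    rw [w.tsupport_normed_eq, Real.closedBall_eq_Icc]
    intro x hx
    change L / 2 - L / 4 ≤ x ∧ x ≤ L / 2 + L / 4 at hx
    constructor <;> linarith [hx.1, hx.2]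
  have hi₀ : ∫ x, χ₀ x = 1 := w.integral_normed
  refine ⟨∫ x, χ₀ x * g x, ?_⟩
  set C := ∫ x, χ₀ x * g x
  have hconst : LocallyIntegrableOn (fun _ : ℝ => C) (Ioo 0 L) :=
    (locallyIntegrable_const C).locallyIntegrableOn _
  have := isOpen_Ioo.ae_eq_zero_of_integral_contDiff_smul_eq_zero
    (hg.sub hconst) (μ := volume) ?_
  · filter_upwards [this] with x hx hxm using sub_eq_zero.1 (hx hxm)
  intro χ hχ hc hs
  simp only [smul_eq_mul, Pi.sub_apply, mul_sub]
  rw [integral_sub (integrable_mul_of_locallyIntegrableOn hg hχ.continuous hc hs)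
    (integrable_mul_of_locallyIntegrableOn hconst hχ.continuous hc hs), integral_mul_const]
  set m := ∫ x, χ x
  let u : ℝ → ℝ := fun x => χ x - m * χ₀ x
  have hu : ContDiff ℝ ∞ u := hχ.sub (contDiff_const.mul hχ₀)
  have hK : IsCompact (tsupport χ ∪ tsupport χ₀) := hc.union hc₀
  obtain ⟨α, β, hα, hα2, hβ2, hβ, hsub⟩ := IsCompact.exists_subset_Ioo hL hK (union_subset hs hs₀)
  have hu0 : ∀ x ∉ Ioo α β, u x = 0 := by
    intro x hx
    have h1 : χ x = 0 := image_eq_zero_of_notMem_tsupport fun h => hx (hsub (Or.inl h))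
    have h2 : χ₀ x = 0 := image_eq_zero_of_notMem_tsupport fun h => hx (hsub (Or.inr h))
    simp [u, h1, h2]
  have hui : Integrable u :=
    (hχ.continuous.integrable_of_hasCompactSupport hc).sub
      ((hχ₀.continuous.integrable_of_hasCompactSupport hc₀).const_mul m)
  have huint : ∫ x, u x = 0 := by
    rw [integral_sub (hχ.continuous.integrable_of_hasCompactSupport hc)
      ((hχ₀.continuous.integrable_of_hasCompactSupport hc₀).const_mul m), integral_const_mul, hi₀]
    simp [m]
  let a : ℝ → ℝ := fun x => ∫ t in α..x, u t
  have had : ∀ x, HasDerivAt a (u x) x := fun x =>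
    intervalIntegral.integral_hasDerivAt_right (hui.intervalIntegrable)
      hu.continuous.stronglyMeasurable.stronglyMeasurableAtFilter hu.continuous.continuousAt
  have hderiv : deriv a = u := funext fun x => (had x).deriv
  have ha : ContDiff ℝ ∞ a := by
    refine contDiff_infty_iff_deriv.2 ⟨fun x => (had x).differentiableAt, ?_⟩
    rw [hderiv]; exact hu
  -- To the right of the support the primitive equals the total integral of `u`, which vanishes by
  -- construction.
  have ha0 : ∀ x ∉ Icc α β, a x = 0 := by
    intro x hx
    rcases lt_or_ge x α with hxα | hxα
    · refine (intervalIntegral.integral_congr (g := fun _ => 0) fun t ht => ?_).trans (by simp)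
      rw [uIcc_of_ge hxα.le] at ht
      exact hu0 t fun h => by linarith [h.1, ht.2]
    · have hβx : β < x := by
        by_contra h
        exact hx ⟨hxα, not_lt.1 h⟩
      rw [← huint]
      refine intervalIntegral.integral_eq_integral_of_support_subset fun t ht => ?_
      by_contra h
      refine ht (hu0 t fun h' => h ⟨h'.1, h'.2.le.trans hβx.le⟩)
  have hts : tsupport a ⊆ Icc α β :=
    closure_minimal (fun x hx => by by_contra h; exact hx (ha0 x h)) isClosed_Icc
  have hac : HasCompactSupport a := isCompact_Icc.of_isClosed_subset (isClosed_tsupport a) hts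
  have hfin := H a ha hac (hts.trans fun x hx => ⟨hα.trans_le hx.1, hx.2.trans_lt hβ⟩)
  rw [hderiv] at hfin
  simp only [u, sub_mul, mul_assoc] at hfin
  rw [integral_sub (integrable_mul_of_locallyIntegrableOn hg hχ.continuous hc hs)
    ((integrable_mul_of_locallyIntegrableOn hg hχ₀.continuous hc₀ hs₀).const_mul m),
    integral_const_mul] at hfin
  exact hfin

theorem exists_ae_eq_primitive {L : ℝ} (hL : 0 < L) {g h : ℝ → ℝ}
    (hg : LocallyIntegrableOn g (Ioo 0 L)) (hh : LocallyIntegrableOn h (Ioo 0 L))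
    (H : ∀ χ : ℝ → ℝ, ContDiff ℝ ∞ χ → HasCompactSupport χ → tsupport χ ⊆ Ioo 0 L →
      ∫ x, deriv χ x * g x = -∫ x, χ x * h x) :
    ∃ C, ∀ᵐ x, x ∈ Ioo 0 L → g x = C + ∫ t in (L / 2)..x, h t := by
  have hP : LocallyIntegrableOn (fun x => ∫ t in (L / 2)..x, h t) (Ioo 0 L) :=
    (locallyIntegrableOn_primitive hh ⟨by linarith, by linarith⟩).locallyIntegrableOn
      measurableSet_Ioo
  have key : ∀ χ : ℝ → ℝ, ContDiff ℝ ∞ χ → HasCompactSupport χ → tsupport χ ⊆ Ioo 0 L →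
      ∫ x, deriv χ x * (g x - ∫ t in (L / 2)..x, h t) = 0 := by
    intro χ hχ hc hs
    have hd : Continuous (deriv χ) := hχ.continuous_deriv (by exact_mod_cast le_top)
    have hdc : HasCompactSupport (deriv χ) := hc.deriv
    have hds : tsupport (deriv χ) ⊆ Ioo 0 L := (tsupport_deriv_subset (𝕜 := ℝ)).trans hs
    simp only [mul_sub]
    rw [integral_sub (integrable_mul_of_locallyIntegrableOn hg hd hdc hds)
      (integrable_mul_of_locallyIntegrableOn hP hd hdc hds), H χ hχ hc hs,
      integral_deriv_mul_primitive hL hh hχ hc hs]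
    ring
  obtain ⟨C, hC⟩ := ae_eq_const_of_integral_deriv_mul_eq_zero hL (hg.sub hP) key
  exact ⟨C, by filter_upwards [hC] with x hx hxm using sub_eq_iff_eq_add.1 (hx hxm)⟩

namespace RevSurface

/-! ### Elementary properties of the profile -/

theorem poles_subset (S : RevSurface) : S.poles ⊆ {0, S.L} := by
  unfold poles RevKind.poles
  cases S.kind <;> simp

theorem Ioo_subset_IL (S : RevSurface) : Ioo 0 S.L ⊆ S.IL := by
  intro s hs
  refine ⟨Ioo_subset_Icc_self hs, fun h => ?_⟩
  rcases S.poles_subset h with h | h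
  · exact hs.1.ne' h
  · exact hs.2.ne h

theorem R_pos_of_mem (S : RevSurface) {s : ℝ} (hs : s ∈ Ioo 0 S.L) : 0 < S.R s :=
  S.R_pos s (S.Ioo_subset_IL hs)

theorem continuousOn_R (S : RevSurface) : ContinuousOn S.R (Icc 0 S.L) := S.R_smooth.continuousOn

theorem continuousOn_ds_R (S : RevSurface) : ContinuousOn (S.ds S.R) (Icc 0 S.L) :=
  S.R_smooth.continuousOn_derivWithin (uniqueDiffOn_Icc S.L_pos) (by exact_mod_cast le_top)

theorem hasDerivAt_ds (S : RevSurface) {h : ℝ → ℝ} (hh : DifferentiableOn ℝ h (Icc 0 S.L)) {s : ℝ}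
    (hs : s ∈ Ioo 0 S.L) : HasDerivAt h (S.ds h s) s :=
  (hh s (Ioo_subset_Icc_self hs)).hasDerivWithinAt.hasDerivAt (Icc_mem_nhds hs.1 hs.2)

theorem hasDerivAt_R (S : RevSurface) {s : ℝ} (hs : s ∈ Ioo 0 S.L) :
    HasDerivAt S.R (S.ds S.R s) s :=
  S.hasDerivAt_ds (S.R_smooth.differentiableOn (by simp)) hs

theorem R_eq_zero_of_mem_poles (S : RevSurface) {s : ℝ} (hs : s ∈ S.poles) : S.R s = 0 := by
  rcases S.poles_subset hs with h | h
  · subst h; simpa using (S.R_north hs).2 0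
  · obtain rfl : s = S.L := h
    simpa using (S.R_south hs).2 0

/-! ### The energy system of a rotationally equivariant solution -/

/-- The quantities `y = |v|²`, `z = R Re (conj v v')`, `e = |v'|²` for a solution `v` of
`ε² (v'' + (R' / R) v') = Q v`. -/
structure RadialEnergy (S : RevSurface) (ε : ℝ) (Q y z e : ℝ → ℝ) : Prop where
  y_nonneg : ∀ s ∈ Ioo 0 S.L, 0 ≤ y s
  e_nonneg : ∀ s ∈ Ioo 0 S.L, 0 ≤ e s
  z_sq : ∀ s ∈ Ioo 0 S.L, z s ^ 2 ≤ S.R s ^ 2 * (y s * e s)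
  y_deriv : ∀ s ∈ Ioo 0 S.L, HasDerivAt y (2 * z s / S.R s) s
  z_ac : ∀ α ∈ Ioo 0 S.L, ∀ β ∈ Ioo 0 S.L, AbsolutelyContinuousOnInterval z α β
  z_deriv : ∀ᵐ s, s ∈ Ioo 0 S.L →
    HasDerivAt z (S.R s * e s + S.R s * Q s / ε ^ 2 * y s) s
  e_ac : ∀ α ∈ Ioo 0 S.L, ∀ β ∈ Ioo 0 S.L, AbsolutelyContinuousOnInterval e α β
  e_deriv : ∀ᵐ s, s ∈ Ioo 0 S.L →
    HasDerivAt e (-2 * (S.ds S.R s / S.R s) * e s + 2 * Q s / ε ^ 2 * (z s / S.R s)) s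

/-! ### Regular representatives of weak solutions and their energy identities -/

theorem ae_Ioo_of_forall_subinterval {L : ℝ} (hL : 0 < L) {P : ℝ → Prop}
    (h : ∀ α β, 0 < α → α < L / 2 → L / 2 < β → β < L → ∀ᵐ x, x ∈ Ioo α β → P x) :
    ∀ᵐ x, x ∈ Ioo 0 L → P x := by
  have hlt : ∀ n : ℕ, L / (n + 3) < L / 2 := fun n =>
    div_lt_div_of_pos_left hL (by norm_num) (by linarith [n.cast_nonneg (α := ℝ)])
  have hpos : ∀ n : ℕ, 0 < L / (n + 3) := fun n => by positivity
  have h' : ∀ n : ℕ, ∀ᵐ x, x ∈ Ioo (L / (n + 3)) (L - L / (n + 3)) → P x := fun n =>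
    h _ _ (hpos n) (hlt n) (by linarith [hlt n]) (by linarith [hpos n])
  filter_upwards [ae_all_iff.2 h'] with x hx hxm
  obtain ⟨n, hn⟩ := exists_nat_gt (L / min x (L - x))
  have hmin : 0 < min x (L - x) := lt_min hxm.1 (by linarith [hxm.2])
  have h3 : L / (n + 3) < min x (L - x) := by
    rw [div_lt_iff₀ hmin] at hn
    rw [div_lt_iff₀ (by positivity)]
    nlinarith
  exact hx n ⟨h3.trans_le (min_le_left _ _), by linarith [min_le_right x (L - x)]⟩

/-- Integrating twice: `U` is a primitive of a locally integrable function, hence continuous and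
locally absolutely continuous, and `v`, being a primitive of the continuous `U`, is differentiable
everywhere and not just almost everywhere. -/
theorem exists_regular_representative {L : ℝ} (hL : 0 < L) {g g₁ g₂ : ℝ → ℝ}
    (hg : LocallyIntegrableOn g (Ioo 0 L)) (hg₁ : LocallyIntegrableOn g₁ (Ioo 0 L))
    (hg₂ : LocallyIntegrableOn g₂ (Ioo 0 L))
    (H : ∀ χ : ℝ → ℝ, ContDiff ℝ ∞ χ → HasCompactSupport χ → tsupport χ ⊆ Ioo 0 L →
      ∫ x, deriv χ x * g x = -∫ x, χ x * g₁ x)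
    (H₁ : ∀ χ : ℝ → ℝ, ContDiff ℝ ∞ χ → HasCompactSupport χ → tsupport χ ⊆ Ioo 0 L →
      ∫ x, deriv χ x * g₁ x = -∫ x, χ x * g₂ x) :
    ∃ v U : ℝ → ℝ, (∀ᵐ x, x ∈ Ioo 0 L → g x = v x) ∧ (∀ᵐ x, x ∈ Ioo 0 L → g₁ x = U x) ∧
      (∀ x ∈ Ioo 0 L, HasDerivAt v (U x) x) ∧ ContinuousOn U (Ioo 0 L) ∧
      (∀ α ∈ Ioo 0 L, ∀ β ∈ Ioo 0 L, AbsolutelyContinuousOnInterval U α β) ∧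
      ∀ᵐ x, x ∈ Ioo 0 L → HasDerivAt U (g₂ x) x := by
  obtain ⟨C₀, h₀⟩ := exists_ae_eq_primitive hL hg hg₁ H
  obtain ⟨C₁, h₁⟩ := exists_ae_eq_primitive hL hg₁ hg₂ H₁
  have hm : L / 2 ∈ Ioo 0 L := ⟨by linarith, by linarith⟩
  set U : ℝ → ℝ := fun x => C₁ + ∫ t in (L / 2)..x, g₂ t with hU
  have hUc : ContinuousOn U (Ioo 0 L) := continuousOn_const.add (locallyIntegrableOn_primitive hg₂ hm)
  have hUi : LocallyIntegrableOn U (Ioo 0 L) := hUc.locallyIntegrableOn measurableSet_Ioo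
  refine ⟨fun x => C₀ + ∫ t in (L / 2)..x, U t, U, ?_, h₁, ?_, hUc, ?_, ?_⟩
  · filter_upwards [h₀] with x hx hxm
    rw [hx hxm]
    congr 1
    refine intervalIntegral.integral_congr_ae ?_
    filter_upwards [h₁] with t ht htm
    exact ht (ordConnected_Ioo.uIcc_subset hm hxm (uIoc_subset_uIcc htm))
  · intro x hx
    refine HasDerivAt.const_add C₀ ?_
    have hcx : ContinuousAt U x := hUc.continuousAt (Ioo_mem_nhds hx.1 hx.2)
    exact intervalIntegral.integral_hasDerivAt_right (hUi.intervalIntegrable_Ioo hm hx)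
      (ContinuousOn.stronglyMeasurableAtFilter isOpen_Ioo hUc x hx) hcx
  · intro α hα β hβ
    have ha : min (min α β) (L / 2) ∈ Ioo 0 L :=
      ⟨lt_min (lt_min hα.1 hβ.1) hm.1, (min_le_right _ _).trans_lt hm.2⟩
    have hb : max (max α β) (L / 2) ∈ Ioo 0 L :=
      ⟨lt_max_of_lt_right hm.1, max_lt (max_lt hα.2 hβ.2) hm.2⟩
    have hab : min (min α β) (L / 2) ≤ max (max α β) (L / 2) :=
      (min_le_right _ _).trans (le_max_right _ _)
    have h2 := (hg₂.intervalIntegrable_Ioo ha hb).absolutelyContinuousOnInterval_intervalIntegral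
      (c := L / 2) (by rw [uIcc_of_le hab]; exact ⟨min_le_right _ _, le_max_right _ _⟩)
    have h3 : AbsolutelyContinuousOnInterval (fun _ : ℝ => C₁) (min (min α β) (L / 2))
      (max (max α β) (L / 2)) := contDiffOn_const.absolutelyContinuousOnInterval
    refine (h3.add h2).mono ?_
    rw [uIcc_of_le hab]
    exact Icc_subset_Icc (min_le_left _ _) (le_max_left _ _)
  · refine ae_Ioo_of_forall_subinterval hL fun α β hα hα2 hβ2 hβ => ?_
    have hαβ : α ≤ β := by linarith
    have h2 := (hg₂.intervalIntegrable_Ioo (α := α) (β := β) ⟨hα, by linarith⟩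
      ⟨by linarith, hβ⟩).ae_hasDerivAt_integral
    filter_upwards [h2] with x hx hxm
    rw [uIcc_of_le hαβ] at hx
    exact (hx (Ioo_subset_Icc_self hxm) (L / 2) ⟨hα2.le, hβ2.le⟩).const_add C₁

/-- The coefficients are real, so real and imaginary parts solve the same equation and can be
regularized separately. In `z` the factor `R` absorbs the first order term: `(R v')' = R Q v / ε²`.
-/
theorem exists_radialEnergy (S : RevSurface) {ε : ℝ} {Q : ℝ → ℝ} {g g₁ g₂ : ℝ → ℂ}
    (hg : LocallyIntegrableOn g (Ioo 0 S.L)) (hg₁ : LocallyIntegrableOn g₁ (Ioo 0 S.L))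
    (hg₂ : LocallyIntegrableOn g₂ (Ioo 0 S.L))
    (H : ∀ χ : ℝ → ℝ, ContDiff ℝ ∞ χ → HasCompactSupport χ → tsupport χ ⊆ Ioo 0 S.L →
      ∫ x, deriv χ x • g x = -∫ x, χ x • g₁ x)
    (H₁ : ∀ χ : ℝ → ℝ, ContDiff ℝ ∞ χ → HasCompactSupport χ → tsupport χ ⊆ Ioo 0 S.L →
      ∫ x, deriv χ x • g₁ x = -∫ x, χ x • g₂ x)
    (hode : ∀ᵐ s, s ∈ Ioo 0 S.L →
      g₂ s = -(S.ds S.R s / S.R s : ℝ) * g₁ s + (Q s / ε ^ 2 : ℝ) * g s) :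
    ∃ y z e : ℝ → ℝ, S.RadialEnergy ε Q y z e ∧ ∀ᵐ s, s ∈ Ioo 0 S.L → y s = ‖g s‖ ^ 2 := by
  have hint : ∀ {w : ℝ → ℂ}, LocallyIntegrableOn w (Ioo 0 S.L) → ∀ χ : ℝ → ℝ, ContDiff ℝ ∞ χ →
      HasCompactSupport χ → tsupport χ ⊆ Ioo 0 S.L → Integrable fun x => χ x • w x := by
    intro w hw χ hχ hc hs
    have h1 : IntegrableOn (fun x => χ x • w x) (tsupport χ) :=
      (hw.integrableOn_compact_subset hs hc).continuousOn_smul hχ.continuous.continuousOn hc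
    rwa [integrableOn_iff_integrable_of_support_subset] at h1
    exact (Function.support_smul_subset_left χ w).trans (subset_tsupport χ)
  have hproj : ∀ (P : ℂ →L[ℝ] ℝ) {w w' : ℝ → ℂ}, LocallyIntegrableOn w (Ioo 0 S.L) →
      LocallyIntegrableOn w' (Ioo 0 S.L) →
      (∀ χ : ℝ → ℝ, ContDiff ℝ ∞ χ → HasCompactSupport χ → tsupport χ ⊆ Ioo 0 S.L →
        ∫ x, deriv χ x • w x = -∫ x, χ x • w' x) →
      ∀ χ : ℝ → ℝ, ContDiff ℝ ∞ χ → HasCompactSupport χ → tsupport χ ⊆ Ioo 0 S.L →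
        ∫ x, deriv χ x * P (w x) = -∫ x, χ x * P (w' x) := by
    intro P w w' hw hw' h χ hχ hc hs
    have h1 := congrArg P (h χ hχ hc hs)
    rw [map_neg, ← P.integral_comp_comm (hint hw' χ hχ hc hs),
      ← P.integral_comp_comm (hint hw (deriv χ) (contDiff_infty_iff_deriv.1 hχ).2 hc.deriv
        ((tsupport_deriv_subset (𝕜 := ℝ)).trans hs))] at h1
    simpa only [map_smul, smul_eq_mul] using h1
  have hloc : ∀ (P : ℂ →L[ℝ] ℝ) {w : ℝ → ℂ}, LocallyIntegrableOn w (Ioo 0 S.L) →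
      LocallyIntegrableOn (fun x => P (w x)) (Ioo 0 S.L) := by
    intro P w hw x hx
    obtain ⟨t, ht, hi⟩ := hw x hx
    exact ⟨t, ht, P.integrable_comp hi⟩
  obtain ⟨v, U, hv, hU, hvd, hUc, hUac, hUd⟩ := exists_regular_representative S.L_pos
    (hloc Complex.reCLM hg) (hloc Complex.reCLM hg₁) (hloc Complex.reCLM hg₂)
    (hproj _ hg hg₁ H) (hproj _ hg₁ hg₂ H₁)
  obtain ⟨v', U', hv', hU', hvd', hUc', hUac', hUd'⟩ := exists_regular_representative S.L_pos
    (hloc Complex.imCLM hg) (hloc Complex.imCLM hg₁) (hloc Complex.imCLM hg₂)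
    (hproj _ hg hg₁ H) (hproj _ hg₁ hg₂ H₁)
  simp only [Complex.reCLM_apply] at hv hU hUd
  simp only [Complex.imCLM_apply] at hv' hU' hUd'
  have hac : ∀ {w w' : ℝ → ℝ}, (∀ x ∈ Ioo 0 S.L, HasDerivAt w (w' x) x) →
      ContinuousOn w' (Ioo 0 S.L) → ∀ α ∈ Ioo 0 S.L, ∀ β ∈ Ioo 0 S.L,
      AbsolutelyContinuousOnInterval w α β := fun hw hw' α hα β hβ =>
    absolutelyContinuousOnInterval_of_hasDerivAt
      (fun x hx => hw x (ordConnected_Ioo.uIcc_subset hα hβ hx))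
      (hw'.mono (ordConnected_Ioo.uIcc_subset hα hβ))
  have hRac := hac (w := S.R) (fun x hx => S.hasDerivAt_R hx)
    (S.continuousOn_ds_R.mono Ioo_subset_Icc_self)
  have hode' : ∀ᵐ s, s ∈ Ioo 0 S.L → HasDerivAt U
      (-(S.ds S.R s / S.R s) * U s + (Q s / ε ^ 2) * v s) s ∧ HasDerivAt U'
      (-(S.ds S.R s / S.R s) * U' s + (Q s / ε ^ 2) * v' s) s := by
    filter_upwards [hode, hv, hU, hUd, hv', hU', hUd'] with s h1 h2 h3 h4 h5 h6 h7 hs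
    have h8 := congrArg Complex.re (h1 hs)
    have h9 := congrArg Complex.im (h1 hs)
    rw [← Complex.ofReal_neg] at h8 h9
    rw [Complex.add_re, Complex.re_ofReal_mul, Complex.re_ofReal_mul, h2 hs, h3 hs] at h8
    rw [Complex.add_im, Complex.im_ofReal_mul, Complex.im_ofReal_mul, h5 hs, h6 hs] at h9
    exact ⟨h8 ▸ h4 hs, h9 ▸ h7 hs⟩
  refine ⟨fun s => v s ^ 2 + v' s ^ 2, fun s => S.R s * (v s * U s + v' s * U' s),
    fun s => U s * U s + U' s * U' s, ⟨fun s _ => by positivity,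
    fun s _ => add_nonneg (mul_self_nonneg _) (mul_self_nonneg _), ?_, ?_, ?_, ?_, ?_, ?_⟩, ?_⟩
  · intro s _
    rw [mul_pow]
    refine mul_le_mul_of_nonneg_left ?_ (sq_nonneg _)
    -- Cauchy-Schwarz in the plane through Lagrange's identity; here primes mark imaginary parts.
    nlinarith [sq_nonneg (v s * U' s - v' s * U s)]
  · intro s hs
    have hR := (S.R_pos_of_mem hs).ne'
    refine (((hvd s hs).pow 2).add ((hvd' s hs).pow 2)).congr_deriv ?_
    field_simp
    push_cast
    ring
  · intro α hα β hβ
    exact (hRac α hα β hβ).fun_mul (((hac hvd hUc α hα β hβ).mul (hUac α hα β hβ)).add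
      ((hac hvd' hUc' α hα β hβ).mul (hUac' α hα β hβ)))
  · filter_upwards [hode'] with s h hs
    obtain ⟨h1, h2⟩ := h hs
    have hR := (S.R_pos_of_mem hs).ne'
    refine ((S.hasDerivAt_R hs).mul (((hvd s hs).mul h1).add ((hvd' s hs).mul h2))).congr_deriv ?_
    simp only [Pi.add_apply, Pi.mul_apply]
    field_simp
    ring
  · intro α hα β hβ
    exact ((hUac α hα β hβ).mul (hUac α hα β hβ)).add ((hUac' α hα β hβ).mul (hUac' α hα β hβ))
  · filter_upwards [hode'] with s h hs
    obtain ⟨h1, h2⟩ := h hs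
    have hR := (S.R_pos_of_mem hs).ne'
    refine ((h1.mul h1).add (h2.mul h2)).congr_deriv ?_
    field_simp
    ring
  · filter_upwards [hv, hv'] with s h1 h2 hs
    rw [← h1 hs, ← h2 hs, Complex.sq_norm, Complex.normSq_apply]
    ring

/-! ### Reduction of equivariant eigenfunctions to the radial variable -/

theorem restrict_cover (S : RevSurface) :
    (volume : Measure (ℝ × ℝ)).restrict S.cover = (volume.restrict (Ioo 0 S.L)).prod volume := by
  rw [cover, Measure.volume_eq_prod, ← Measure.prod_restrict, Measure.restrict_univ]

/-- The measure `R(s) ds` on `(0, L)`. -/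
noncomputable def radialMeasure (S : RevSurface) : Measure ℝ :=
  (volume.restrict (Ioo 0 S.L)).withDensity fun s => ENNReal.ofReal (S.R s)

theorem aemeasurable_R (S : RevSurface) : AEMeasurable S.R (volume.restrict (Ioo 0 S.L)) :=
  (S.continuousOn_R.mono Ioo_subset_Icc_self).aemeasurable measurableSet_Ioo

theorem vol_eq_prod (S : RevSurface) :
    S.vol = S.radialMeasure.prod (volume.restrict (Ioc 0 (2 * Real.pi))) := by
  rw [radialMeasure, prod_withDensity_left₀ S.aemeasurable_R.ennreal_ofReal, Measure.prod_restrict,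
    vol, Measure.volume_eq_prod]

theorem ae_radialMeasure_iff (S : RevSurface) {P : ℝ → Prop} :
    (∀ᵐ s ∂S.radialMeasure, P s) ↔ ∀ᵐ s, s ∈ Ioo 0 S.L → P s := by
  rw [radialMeasure, ae_withDensity_iff' S.aemeasurable_R.ennreal_ofReal,
    ae_restrict_iff' measurableSet_Ioo]
  refine eventually_congr (Eventually.of_forall fun s => ?_)
  refine forall_congr' fun hs => ?_
  simp [S.R_pos_of_mem hs]

theorem isOpen_cover (S : RevSurface) : IsOpen S.cover := isOpen_Ioo.prod isOpen_univ

theorem integrable_smul_of_tsupport_subset {Ω : Set (ℝ × ℝ)} {w : ℝ × ℝ → ℂ} {χ : ℝ × ℝ → ℝ}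
    (hw : LocallyIntegrableOn w Ω) (hχ : Continuous χ) (hc : HasCompactSupport χ)
    (hs : tsupport χ ⊆ Ω) : Integrable fun p => χ p • w p := by
  have h1 : IntegrableOn (fun x => χ x • w x) (tsupport χ) :=
    (hw.integrableOn_compact_subset hs hc).continuousOn_smul hχ.continuousOn hc
  rwa [integrableOn_iff_integrable_of_support_subset] at h1
  exact (Function.support_smul_subset_left χ w).trans (subset_tsupport χ)

/-- For fixed `s` the function is a multiple of a smooth exponential, so integration by parts along
each line `s = const` identifies the weak derivative, whatever the regularity of `φ`. The factor `κ`
allows a second application to the derivative itself. -/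
theorem ae_eq_of_isWeakDeriv_theta (S : RevSurface) {κ : ℂ} {k : ℕ} {φ : ℝ → ℂ}
    {u w : ℝ × ℝ → ℂ} (h : IsWeakDeriv S.cover (0, 1) u w)
    (hu : ∀ᵐ p ∂volume.restrict S.cover, u p = κ * (Complex.exp (Complex.I * k * p.2) * φ p.1)) :
    ∀ᵐ p ∂volume.restrict S.cover,
      w p = κ * (Complex.I * k) * (Complex.exp (Complex.I * k * p.2) * φ p.1) := by
  obtain ⟨hul, hwl, hd⟩ := h
  have hul' : LocallyIntegrableOn (fun p => (Complex.I * k) • u p) S.cover := fun p hp => by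
    obtain ⟨t, ht, hi⟩ := hul p hp
    exact ⟨t, ht, hi.smul (Complex.I * k : ℂ)⟩
  have hmeas : MeasurableSet S.cover := S.isOpen_cover.measurableSet
  have key := S.isOpen_cover.ae_eq_zero_of_integral_contDiff_smul_eq_zero
    (hwl.sub hul') (μ := volume) (by
      intro χ hχ hc hs
      have hdc : Continuous fun p => fderiv ℝ χ p (0, 1) :=
        (hχ.continuous_fderiv (by simp)).clm_apply continuous_const
      have hdcs : HasCompactSupport fun p => fderiv ℝ χ p ((0, 1) : ℝ × ℝ) :=
        hc.fderiv_apply ℝ _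
      have hdts : (tsupport fun p => fderiv ℝ χ p ((0, 1) : ℝ × ℝ)) ⊆ S.cover :=
        (tsupport_fderiv_apply_subset ℝ _).trans hs
      have i1 := integrable_smul_of_tsupport_subset hul hdc hdcs hdts
      have i2 := integrable_smul_of_tsupport_subset hul' hχ.continuous hc hs
      have i3 := integrable_smul_of_tsupport_subset hwl hχ.continuous hc hs
      rw [← setIntegral_eq_integral_of_forall_compl_eq_zero (s := S.cover) fun p hp => by
        rw [image_eq_zero_of_notMem_tsupport fun h => hp (hs h), zero_smul]]
      simp only [Pi.sub_apply, smul_sub]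
      rw [integral_sub i3.integrableOn i2.integrableOn, ← neg_eq_iff_eq_neg.2 (hd χ hχ hc hs),
        ← neg_add', ← integral_add i1.integrableOn i2.integrableOn, neg_eq_zero]
      let F : ℝ × ℝ → ℂ := fun p => κ * (Complex.exp (Complex.I * k * p.2) * φ p.1)
      let G : ℝ × ℝ → ℂ := fun p => (fderiv ℝ χ p (0, 1)) • F p + χ p • ((Complex.I * k) • F p)
      have hG : ∀ᵐ p ∂volume.restrict S.cover,
          (fderiv ℝ χ p (0, 1)) • u p + χ p • ((Complex.I * k : ℂ) • u p) = G p := by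
        filter_upwards [hu] with p hp
        simp only [G, F, hp]
      have hGi : Integrable G (volume.restrict S.cover) :=
        (i1.add i2).integrableOn.congr hG
      rw [integral_congr_ae hG]
      rw [S.restrict_cover] at hGi ⊢
      rw [integral_prod _ hGi]
      refine integral_eq_zero_of_ae (Eventually.of_forall fun s => ?_)
      have hline : ∀ θ : ℝ, HasDerivAt (fun θ => (s, θ)) ((0, 1) : ℝ × ℝ) θ := fun θ =>
        (hasDerivAt_const θ s).prodMk (hasDerivAt_id θ)
      have hemb : IsClosedEmbedding fun θ : ℝ => (s, θ) :=
        Topology.IsClosedEmbedding.of_continuous_injective_isClosedMap (by fun_prop)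
          (fun a b hab => (Prod.mk.inj hab).2) (isClosedMap_prodMk_left s)
      have hF : Continuous fun θ : ℝ => F (s, θ) := by
        simp only [F]
        fun_prop
      have hFd : ∀ θ : ℝ, HasDerivAt (fun θ : ℝ => F (s, θ)) ((Complex.I * k) • F (s, θ)) θ := by
        intro θ
        have h1 : HasDerivAt (fun θ : ℝ => Complex.I * k * (θ : ℂ)) (Complex.I * k) θ := by
          simpa using (Complex.ofRealCLM.hasDerivAt (x := θ)).const_mul (Complex.I * k)
        refine ((h1.cexp.mul_const (φ s)).const_mul κ).congr_deriv ?_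
        simp only [F, smul_eq_mul]
        ring
      have c1 : HasCompactSupport fun θ : ℝ => χ (s, θ) := hc.comp_isClosedEmbedding hemb
      have c2 : HasCompactSupport fun θ : ℝ => fderiv ℝ χ (s, θ) (0, 1) :=
        hdcs.comp_isClosedEmbedding hemb
      have d1 : Continuous fun θ : ℝ => χ (s, θ) := hχ.continuous.comp hemb.continuous
      have d2 : Continuous fun θ : ℝ => fderiv ℝ χ (s, θ) (0, 1) := hdc.comp hemb.continuous
      have j1 : Integrable fun θ : ℝ => fderiv ℝ χ (s, θ) (0, 1) • F (s, θ) :=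
        (d2.smul hF).integrable_of_hasCompactSupport (c2.smul_right (f' := fun θ => F (s, θ)))
      have j2 : Integrable fun θ : ℝ => χ (s, θ) • ((Complex.I * k) • F (s, θ)) :=
        (d1.smul (hF.const_smul (Complex.I * k : ℂ))).integrable_of_hasCompactSupport
          (c1.smul_right (f' := fun θ => (Complex.I * k) • F (s, θ)))
      have j3 : Integrable fun θ : ℝ => χ (s, θ) • F (s, θ) :=
        (d1.smul hF).integrable_of_hasCompactSupport (c1.smul_right (f' := fun θ => F (s, θ)))
      refine integral_eq_zero_of_hasDerivAt_of_integrable (fun θ => ?_) (j1.add j2) j3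
      have h1 : HasDerivAt (fun θ => χ (s, θ)) (fderiv ℝ χ (s, θ) (0, 1)) θ :=
        ((hχ.differentiable (by simp) (s, θ)).hasFDerivAt).comp_hasDerivAt θ (hline θ)
      exact (h1.smul (hFd θ)).congr_deriv (add_comm _ _))
  rw [ae_restrict_iff' hmeas] at hu ⊢
  filter_upwards [key, hu] with p h1 h2 hp
  have h3 := h1 hp
  rw [Pi.sub_apply, sub_eq_zero] at h3
  rw [h3, h2 hp, smul_eq_mul]
  ring

theorem locallyIntegrableOn_average (S : RevSurface) {b : ℝ → ℝ} (hb : Continuous b)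
    (hc : HasCompactSupport b) {w : ℝ × ℝ → ℂ} (hw : LocallyIntegrableOn w S.cover) :
    LocallyIntegrableOn (fun s => ∫ θ, b θ • w (s, θ)) (Ioo 0 S.L) := by
  rw [locallyIntegrableOn_iff isOpen_Ioo.isLocallyClosed]
  intro K hK hKc
  have h1 : IntegrableOn (fun p : ℝ × ℝ => b p.2 • w p) (K ×ˢ tsupport b) :=
    (hw.integrableOn_compact_subset (prod_mono hK (subset_univ _)) (hKc.prod hc)).continuousOn_smul
      (hb.comp continuous_snd).continuousOn (hKc.prod hc)
  have h2 : IntegrableOn (fun p : ℝ × ℝ => b p.2 • w p) (K ×ˢ univ) := by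
    refine h1.of_forall_sdiff_eq_zero (hKc.measurableSet.prod MeasurableSet.univ) fun p hp => ?_
    have : p.2 ∉ tsupport b := fun h => hp.2 ⟨hp.1.1, h⟩
    rw [image_eq_zero_of_notMem_tsupport this, zero_smul]
  rw [IntegrableOn, Measure.volume_eq_prod, ← Measure.prod_restrict, Measure.restrict_univ] at h2
  exact h2.integral_prod_left

/-- Testing the two-dimensional identity with a product `χ(s) b(θ)` and applying Fubini. -/
theorem integral_deriv_smul_average (S : RevSurface) {b : ℝ → ℝ} (hb : ContDiff ℝ ∞ b)
    (hc : HasCompactSupport b) {u w : ℝ × ℝ → ℂ} (h : IsWeakDeriv S.cover (1, 0) u w)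
    (χ : ℝ → ℝ) (hχ : ContDiff ℝ ∞ χ) (hχc : HasCompactSupport χ) (hs : tsupport χ ⊆ Ioo 0 S.L) :
    ∫ s, deriv χ s • ∫ θ, b θ • u (s, θ) = -∫ s, χ s • ∫ θ, b θ • w (s, θ) := by
  obtain ⟨hul, hwl, hd⟩ := h
  have main : ∀ {a : ℝ → ℝ} {v : ℝ × ℝ → ℂ}, Continuous a → HasCompactSupport a →
      tsupport a ⊆ Ioo 0 S.L → LocallyIntegrableOn v S.cover →
      ∫ p in S.cover, (a p.1 * b p.2) • v p = ∫ s, a s • ∫ θ, b θ • v (s, θ) := by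
    intro a v ha hac has hv
    have h1 : IntegrableOn (fun p : ℝ × ℝ => (a p.1 * b p.2) • v p) (tsupport a ×ˢ tsupport b) :=
      (hv.integrableOn_compact_subset (prod_mono has (subset_univ _))
        (hac.prod hc)).continuousOn_smul ((ha.comp continuous_fst).mul
          (hb.continuous.comp continuous_snd)).continuousOn (hac.prod hc)
    have h2 : IntegrableOn (fun p : ℝ × ℝ => (a p.1 * b p.2) • v p) S.cover := by
      refine h1.of_forall_sdiff_eq_zero S.isOpen_cover.measurableSet fun p hp => ?_
      by_cases h1 : p.1 ∈ tsupport a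
      · rw [image_eq_zero_of_notMem_tsupport (f := b) fun h => hp.2 ⟨h1, h⟩, mul_zero, zero_smul]
      · rw [image_eq_zero_of_notMem_tsupport h1, zero_mul, zero_smul]
    rw [IntegrableOn, S.restrict_cover] at h2
    rw [S.restrict_cover, integral_prod _ h2]
    simp only [mul_smul, integral_smul]
    refine setIntegral_eq_integral_of_forall_compl_eq_zero fun s hsm => ?_
    rw [image_eq_zero_of_notMem_tsupport fun h => hsm (has h), zero_smul]
  have hX : ContDiff ℝ ∞ fun p : ℝ × ℝ => χ p.1 * b p.2 :=
    (hχ.comp contDiff_fst).mul (hb.comp contDiff_snd)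
  have hsub : (tsupport fun p : ℝ × ℝ => χ p.1 * b p.2) ⊆ tsupport χ ×ˢ tsupport b := by
    refine closure_minimal (fun p hp => ?_) ((isClosed_tsupport _).prod (isClosed_tsupport _))
    exact ⟨subset_tsupport _ (left_ne_zero_of_mul hp), subset_tsupport _ (right_ne_zero_of_mul hp)⟩
  have hXc : HasCompactSupport fun p : ℝ × ℝ => χ p.1 * b p.2 :=
    (hχc.prod hc).of_isClosed_subset (isClosed_tsupport _) hsub
  have h1 := hd _ hX hXc (hsub.trans (prod_mono hs (subset_univ _)))
  have h2 : ∀ p : ℝ × ℝ, fderiv ℝ (fun p : ℝ × ℝ => χ p.1 * b p.2) p (1, 0)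
      = deriv χ p.1 * b p.2 := by
    intro p
    have hline : HasDerivAt (fun t : ℝ => (t, p.2)) ((1, 0) : ℝ × ℝ) p.1 :=
      (hasDerivAt_id p.1).prodMk (hasDerivAt_const p.1 p.2)
    have e1 := ((hX.differentiable (by simp) p).hasFDerivAt).comp_hasDerivAt p.1 hline
    have e2 : HasDerivAt (fun t : ℝ => χ t * b p.2) (deriv χ p.1 * b p.2) p.1 :=
      ((hχ.differentiable (by simp) p.1).hasDerivAt).mul_const _
    exact e1.unique e2
  simp only [h2] at h1
  rwa [main (hχ.continuous_deriv (by simp)) hχc.deriv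
    ((tsupport_deriv_subset (𝕜 := ℝ)).trans hs) hul, main hχ.continuous hχc hs hwl] at h1

/-- Otherwise the exponential, which never vanishes, would be zero almost everywhere on `(0, 2π)`.
-/
theorem exists_bump_integral_exp_ne_zero (k : ℕ) :
    ∃ b : ℝ → ℝ, ContDiff ℝ ∞ b ∧ HasCompactSupport b ∧ tsupport b ⊆ Ioo 0 (2 * Real.pi) ∧
      ∫ θ, b θ • Complex.exp (Complex.I * k * θ) ≠ 0 := by
  by_contra! hcon
  have hcont : Continuous fun θ : ℝ => Complex.exp (Complex.I * k * θ) := by fun_prop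
  have h := isOpen_Ioo.ae_eq_zero_of_integral_contDiff_smul_eq_zero (μ := volume)
    (U := Ioo 0 (2 * Real.pi)) (hcont.locallyIntegrable.locallyIntegrableOn _) hcon
  have h0 : volume (Ioo 0 (2 * Real.pi)) = 0 := by
    refine measure_mono_null (fun θ hθ => ?_) (ae_iff.1 h)
    exact fun hc => Complex.exp_ne_zero _ (hc hθ)
  rw [Real.volume_Ioo, ENNReal.ofReal_eq_zero] at h0
  linarith [Real.pi_pos]

theorem ae_integrable_average (S : RevSurface) {b : ℝ → ℝ} (hb : Continuous b)
    (hc : HasCompactSupport b) {w : ℝ × ℝ → ℂ} (hw : LocallyIntegrableOn w S.cover) :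
    ∀ᵐ s, s ∈ Ioo 0 S.L → Integrable fun θ => b θ • w (s, θ) := by
  refine ae_Ioo_of_forall_subinterval S.L_pos fun α β hα _ _ hβ => ?_
  have hK : Icc α β ⊆ Ioo 0 S.L := Icc_subset_Ioo hα hβ
  have h1 : IntegrableOn (fun p : ℝ × ℝ => b p.2 • w p) (Icc α β ×ˢ tsupport b) :=
    (hw.integrableOn_compact_subset (prod_mono hK (subset_univ _))
      (isCompact_Icc.prod hc)).continuousOn_smul
      (hb.comp continuous_snd).continuousOn (isCompact_Icc.prod hc)
  have h2 : IntegrableOn (fun p : ℝ × ℝ => b p.2 • w p) (Icc α β ×ˢ univ) := by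
    refine h1.of_forall_sdiff_eq_zero (measurableSet_Icc.prod MeasurableSet.univ) fun p hp => ?_
    have : p.2 ∉ tsupport b := fun h => hp.2 ⟨hp.1.1, h⟩
    rw [image_eq_zero_of_notMem_tsupport this, zero_smul]
  rw [IntegrableOn, Measure.volume_eq_prod, ← Measure.prod_restrict, Measure.restrict_univ] at h2
  have h3 := h2.prod_right_ae
  rw [ae_restrict_iff' measurableSet_Icc] at h3
  filter_upwards [h3] with s hs hsm using hs (Ioo_subset_Icc_self hsm)

theorem ae_vol_of_ae_cover (S : RevSurface) {P : ℝ × ℝ → Prop}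
    (h : ∀ᵐ p ∂volume.restrict S.cover, P p) : ∀ᵐ p ∂S.vol, P p := by
  refine (withDensity_absolutelyContinuous _ _).ae_le ?_
  exact ae_restrict_of_ae_restrict_of_subset (prod_mono le_rfl (subset_univ _)) h

theorem ae_ae_of_ae_vol (S : RevSurface) {P : ℝ × ℝ → Prop} (h : ∀ᵐ p ∂S.vol, P p) :
    ∀ᵐ s, s ∈ Ioo 0 S.L → ∀ᵐ θ, θ ∈ Ioc 0 (2 * Real.pi) → P (s, θ) := by
  rw [S.vol_eq_prod] at h
  have h1 := S.ae_radialMeasure_iff.1 (Measure.ae_ae_of_ae_prod h)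
  filter_upwards [h1] with s hs hsm
  exact (ae_restrict_iff' measurableSet_Ioc).1 (hs hsm)

theorem sfinite_radialMeasure (S : RevSurface) : SFinite S.radialMeasure := by
  unfold radialMeasure; infer_instance

theorem integrableOn_of_integrable_vol (S : RevSurface) {F : ℝ → ℝ}
    (h : Integrable (fun p : ℝ × ℝ => F p.1) S.vol) :
    IntegrableOn (fun s => S.R s * F s) (Ioo 0 S.L) := by
  have := S.sfinite_radialMeasure
  rw [S.vol_eq_prod] at h
  have h1 := h.prod_left_ae
  have hne : (ae (volume.restrict (Ioc 0 (2 * Real.pi)))).NeBot := by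
    rw [ae_neBot, Ne, Measure.restrict_eq_zero, Real.volume_Ioc, ENNReal.ofReal_eq_zero]
    linarith [Real.pi_pos]
  obtain ⟨_, h2⟩ := h1.exists
  rw [radialMeasure, integrable_withDensity_iff_integrable_smul₀' S.aemeasurable_R.ennreal_ofReal
    (Eventually.of_forall fun _ => ENNReal.ofReal_lt_top)] at h2
  refine h2.congr ?_
  rw [EventuallyEq, ae_restrict_iff' measurableSet_Ioo]
  refine Eventually.of_forall fun s hs => ?_
  simp [ENNReal.toReal_ofReal (S.R_pos_of_mem hs).le]

theorem norm_exp_I_mul (k : ℕ) (θ : ℝ) : ‖Complex.exp (Complex.I * k * θ)‖ = 1 := by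
  rw [show Complex.I * k * θ = ((k * θ : ℝ) : ℂ) * Complex.I by push_cast; ring]
  exact Complex.norm_exp_ofReal_mul_I _

/-- The coefficient of the radial equation. -/
noncomputable def radialPotential (S : RevSurface) (f q : ℝ → ℝ) (c ε μ s : ℝ) : ℝ :=
  S.V f c s + ε * (S.lapRadial f s / 2 - q s) - μ

theorem exists_radialEnergy_of_solvesEigen (S : RevSurface) {f q : ℝ → ℝ} {c ε μ : ℝ} {k : ℕ}
    (hk : k ≠ 0) (hε : ε ≠ 0) (hc : ε * k = c) {φ : ℝ → ℂ} {ψ : ℝ × ℝ → ℂ}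
    (hψ : ∀ s θ : ℝ, ψ (s, θ) = Complex.exp (Complex.I * k * θ) * φ s)
    (h : S.SolvesEigen f q ε μ ψ) :
    ∃ y z e : ℝ → ℝ, S.RadialEnergy ε (S.radialPotential f q c ε μ) y z e ∧
      (∀ᵐ s, s ∈ Ioo 0 S.L → y s = ‖φ s‖ ^ 2) ∧
      IntegrableOn (fun s => S.R s * y s) (Ioo 0 S.L) ∧
      IntegrableOn (fun s => y s / S.R s) (Ioo 0 S.L) ∧
      ∀ s₀ ∈ S.bdry, Tendsto y (𝓝[Ioo 0 S.L] s₀) (𝓝 0) := by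
  obtain ⟨⟨us, ut, uss, ust, utt, hH, heq⟩, w, hwc, hwae, hw0⟩ := h
  -- Averaging `ψ` against `b` returns `β φ`, so dividing averages by `β` transfers weak derivatives
  -- from the surface to `φ`. The support lies in `(0, 2π)`, where the equation is known almost
  -- everywhere.
  obtain ⟨b, hb, hbc, hbs, hβ⟩ := exists_bump_integral_exp_ne_zero k
  set β := ∫ θ, b θ • Complex.exp (Complex.I * k * θ) with hβdef
  have hψ' : ∀ p : ℝ × ℝ, ψ p = Complex.exp (Complex.I * k * p.2) * φ p.1 := fun p => hψ p.1 p.2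
  have hut := S.ae_eq_of_isWeakDeriv_theta (κ := 1) (φ := φ) (k := k) hH.weak_t
    (Eventually.of_forall fun p => by rw [one_mul]; exact hψ' p)
  have hutt := S.ae_eq_of_isWeakDeriv_theta hH.weak_tt hut
  have hg : ∀ s, ∫ θ, b θ • ψ (s, θ) = β * φ s := by
    intro s
    simp only [hψ, ← smul_mul_assoc]
    rw [integral_mul_const]
  have hmul : ∀ {a : ℝ → ℂ}, LocallyIntegrableOn a (Ioo 0 S.L) →
      LocallyIntegrableOn (fun s => β⁻¹ * a s) (Ioo 0 S.L) := by
    intro a ha s hs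
    obtain ⟨t, ht, hi⟩ := ha s hs
    exact ⟨t, ht, hi.const_mul _⟩
  have hav : ∀ {u : ℝ × ℝ → ℂ}, LocallyIntegrableOn u S.cover →
      LocallyIntegrableOn (fun s => β⁻¹ * ∫ θ, b θ • u (s, θ)) (Ioo 0 S.L) := by
    intro u hu
    exact hmul (S.locallyIntegrableOn_average hb.continuous hbc hu)
  have hweak : ∀ {u v : ℝ × ℝ → ℂ}, IsWeakDeriv S.cover (1, 0) u v → ∀ χ : ℝ → ℝ,
      ContDiff ℝ ∞ χ → HasCompactSupport χ → tsupport χ ⊆ Ioo 0 S.L →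
      ∫ s, deriv χ s • (β⁻¹ * ∫ θ, b θ • u (s, θ))
        = -∫ s, χ s • (β⁻¹ * ∫ θ, b θ • v (s, θ)) := by
    intro u v huv χ hχ hχc hs
    have := congrArg (fun x => β⁻¹ * x) (S.integral_deriv_smul_average hb hbc huv χ hχ hχc hs)
    simp only [mul_neg, ← integral_const_mul] at this
    simpa only [mul_smul_comm] using this
  have hode : ∀ᵐ s, s ∈ Ioo 0 S.L → β⁻¹ * ∫ θ, b θ • uss (s, θ)
      = -(S.ds S.R s / S.R s : ℝ) * (β⁻¹ * ∫ θ, b θ • us (s, θ))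
        + (S.radialPotential f q c ε μ s / ε ^ 2 : ℝ) * (β⁻¹ * ∫ θ, b θ • ψ (s, θ)) := by
    filter_upwards [S.ae_ae_of_ae_vol heq, S.ae_ae_of_ae_vol (S.ae_vol_of_ae_cover hutt),
      S.ae_integrable_average hb.continuous hbc hH.weak_s.2.1,
      S.ae_integrable_average hb.continuous hbc hH.weak_s.1] with s h1 h2 h3 h4 hs
    have hR := (S.R_pos_of_mem hs).ne'
    have hRc : (S.R s : ℂ) ≠ 0 := by exact_mod_cast hR
    have hεc : (ε : ℂ) ≠ 0 := by exact_mod_cast hε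
    have h5 : ∀ᵐ θ, b θ • uss (s, θ) = -(S.ds S.R s / S.R s : ℝ) * (b θ • us (s, θ))
        + (S.radialPotential f q c ε μ s / ε ^ 2 : ℝ) * (b θ • ψ (s, θ)) := by
      filter_upwards [h1 hs, h2 hs] with θ h6 h7
      by_cases hθ : θ ∈ tsupport b
      · have hm := Ioo_subset_Ioc_self (hbs hθ)
        have h8 := h6 hm
        have h9 := h7 hm
        rw [← hψ' (s, θ)] at h9
        have h10 : uss (s, θ) = -(S.ds S.R s / S.R s : ℝ) * us (s, θ)
          + (S.radialPotential f q c ε μ s / ε ^ 2 : ℝ) * ψ (s, θ) := by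
          simp only [lap] at h8
          rw [h9] at h8
          have hI : (1 * (Complex.I * k) * (Complex.I * k) : ℂ) = -(k : ℂ) ^ 2 := by
            linear_combination (k : ℂ) ^ 2 * Complex.I_sq
          rw [hI] at h8
          -- Since `c = ε k`, the centrifugal term `ε² k² / R²` is the `c² / R²` of the effective
          -- potential.
          simp only [radialPotential, V, potential, ← hc] at h8 ⊢
          push_cast at h8 ⊢
          field_simp at h8 ⊢
          linear_combination -h8
        rw [h10]
        simp only [Complex.real_smul]
        ring
      · simp [image_eq_zero_of_notMem_tsupport hθ]
    rw [integral_congr_ae h5, integral_add (h3 hs |>.const_mul _) (h4 hs |>.const_mul _),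
      integral_const_mul, integral_const_mul]
    ring
  obtain ⟨y, z, e, hE, hy⟩ := S.exists_radialEnergy (hav hH.weak_s.1) (hav hH.weak_s.2.1)
    (hav hH.weak_ss.2.1) (hweak hH.weak_s) (hweak hH.weak_ss) hode
  have hy' : ∀ᵐ s, s ∈ Ioo 0 S.L → y s = ‖φ s‖ ^ 2 := by
    filter_upwards [hy] with s h1 hs
    rw [h1 hs, hg, inv_mul_cancel_left₀ hβ]
  have hnorm : ∀ p : ℝ × ℝ, ‖ψ p‖ = ‖φ p.1‖ := fun p => by
    rw [hψ' p, norm_mul, norm_exp_I_mul, one_mul]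
  refine ⟨y, z, e, hE, hy', ?_, ?_, ?_⟩
  · have h1 := (memLp_two_iff_integrable_sq_norm hH.mem.1).1 hH.mem
    simp only [hnorm] at h1
    refine (S.integrableOn_of_integrable_vol (F := fun s => ‖φ s‖ ^ 2) h1).congr ?_
    rw [EventuallyEq, ae_restrict_iff' measurableSet_Ioo]
    filter_upwards [hy'] with s h2 hs
    rw [h2 hs]
  -- The angular part of the gradient has squared size `k² |φ|² / R²`; against the volume density
  -- `R` this is `k² y / R`, and `k ≠ 0` permits division.
  · have h1 := (memLp_two_iff_integrable_sq_norm hH.mem_t.1).1 hH.mem_t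
    have h2 : Integrable (fun p : ℝ × ℝ => (k * ‖φ p.1‖ / S.R p.1) ^ 2) S.vol := by
      refine h1.congr ?_
      filter_upwards [S.ae_vol_of_ae_cover hut] with p hp
      rw [hp, ← hψ' p]
      simp only [norm_div, norm_mul, hnorm, Complex.norm_I, Complex.norm_natCast,
        Complex.norm_real, one_mul, div_pow, Real.norm_eq_abs, sq_abs]
    have h3 := (S.integrableOn_of_integrable_vol
      (F := fun s => (k * ‖φ s‖ / S.R s) ^ 2) h2).const_mul ((k : ℝ) ^ 2)⁻¹
    refine h3.congr ?_
    rw [EventuallyEq, ae_restrict_iff' measurableSet_Ioo]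
    filter_upwards [hy'] with s h2 hs
    have hR := (S.R_pos_of_mem hs).ne'
    have hk' : (k : ℝ) ≠ 0 := by exact_mod_cast hk
    rw [h2 hs]
    field_simp
  · intro s₀ hs₀
    have hyc : ContinuousOn y (Ioo 0 S.L) := fun s hs =>
      (hE.y_deriv s hs).continuousAt.continuousWithinAt
    have hsub : S.cover ⊆ S.IL ×ˢ univ := prod_mono S.Ioo_subset_IL le_rfl
    -- Two continuous functions equal almost everywhere on an open set are equal there; this carries
    -- the Dirichlet condition from the continuous representative `w` to `y`.
    have hEq : EqOn (fun p : ℝ × ℝ => ‖w p‖ ^ 2) (fun p => y p.1) S.cover := by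
      refine Measure.eqOn_open_of_ae_eq (μ := volume) ?_ S.isOpen_cover
        ((hwc.mono hsub).norm.pow 2) (hyc.comp continuousOn_fst fun p hp => hp.1)
      have h1 : ∀ᵐ p ∂volume.restrict S.cover, y p.1 = ‖φ p.1‖ ^ 2 := by
        rw [S.restrict_cover]
        exact Measure.quasiMeasurePreserving_fst.ae
          ((ae_restrict_iff' measurableSet_Ioo).2 hy')
      filter_upwards [hwae, h1] with p h2 h3
      rw [h2, h3, hnorm]
    have hs₀' : s₀ ∈ S.IL := by
      refine ⟨?_, hs₀.2⟩
      rcases hs₀.1 with h | h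
      · rw [h]; exact ⟨le_rfl, S.L_pos.le⟩
      · obtain rfl : s₀ = S.L := h
        exact ⟨S.L_pos.le, le_rfl⟩
    have h1 : Tendsto (fun s => ‖w (s, 0)‖ ^ 2) (𝓝[Ioo 0 S.L] s₀) (𝓝 (‖w (s₀, 0)‖ ^ 2)) := by
      have h2 : ContinuousOn (fun s : ℝ => w (s, (0 : ℝ))) S.IL :=
        hwc.comp (by fun_prop) fun s hs => ⟨hs, mem_univ _⟩
      exact ((h2 s₀ hs₀').mono S.Ioo_subset_IL).norm.pow 2
    rw [hw0 s₀ hs₀ 0, norm_zero, zero_pow two_ne_zero] at h1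
    refine h1.congr' ?_
    filter_upwards [self_mem_nhdsWithin] with s hs
    exact hEq ⟨hs, mem_univ _⟩

/-! ### Weighted energy estimates -/

/-- If `z < 0` near the end, then `y` is strictly decreasing, hence bounded below by a positive
constant close to the end. That contradicts `y → 0`; at a pole it makes `y / R` at least a multiple
of `1 / s`, which is not integrable. -/
theorem not_forall_neg_near_zero {σ : ℝ} (hσ : 0 < σ) {y z R : ℝ → ℝ}
    (hy : ∀ s ∈ Ioo 0 σ, HasDerivAt y (2 * z s / R s) s) (hR : ∀ s ∈ Ioo 0 σ, 0 < R s)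
    (hy0 : ∀ s ∈ Ioo 0 σ, 0 ≤ y s) (hz : ∀ s ∈ Ioo 0 σ, z s < 0)
    (h : (∃ C, (∀ s ∈ Ioo 0 σ, R s ≤ C * s) ∧ IntegrableOn (fun s => y s / R s) (Ioo 0 σ)) ∨
      Tendsto y (𝓝[>] 0) (𝓝 0)) : False := by
  have hanti : StrictAntiOn y (Ioo 0 σ) := by
    refine strictAntiOn_of_deriv_neg (convex_Ioo 0 σ)
      (fun s hs => (hy s hs).continuousAt.continuousWithinAt) fun s hs => ?_
    rw [interior_Ioo] at hs
    rw [(hy s hs).deriv]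
    exact div_neg_of_neg_of_pos (by linarith [hz s hs]) (hR s hs)
  have h2 : σ / 2 ∈ Ioo 0 σ := ⟨by linarith, by linarith⟩
  have h3 : 3 * σ / 4 ∈ Ioo 0 σ := ⟨by linarith, by linarith⟩
  have hm : 0 < y (σ / 2) := (hy0 _ h3).trans_lt (hanti h2 h3 (by linarith))
  have hge : ∀ s ∈ Ioo 0 (σ / 2), y (σ / 2) ≤ y s := fun s hs =>
    (hanti ⟨hs.1, by linarith [hs.2]⟩ h2 hs.2).le
  rcases h with ⟨C, hC, hint⟩ | h
  · have hCpos : 0 < C := by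
      have := (hR _ h2).trans_le (hC _ h2)
      exact pos_of_mul_pos_left this h2.1.le
    have hi : IntegrableOn (fun s => y s / R s) (Ioo 0 (σ / 2)) :=
      hint.mono_set (Ioo_subset_Ioo le_rfl h2.2.le)
    have hinv : IntegrableOn (fun s : ℝ => (C / y (σ / 2))⁻¹ * s⁻¹) (Ioo 0 (σ / 2)) := by
      refine hi.mono' (by fun_prop) ?_
      rw [ae_restrict_iff' measurableSet_Ioo]
      refine Eventually.of_forall fun s hs => ?_
      have hs' : s ∈ Ioo 0 σ := ⟨hs.1, by linarith [hs.2]⟩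
      have hCs : 0 < C * s := mul_pos hCpos hs.1
      rw [Real.norm_of_nonneg (by have := hs.1; positivity), inv_div, ← div_eq_mul_inv, div_div]
      exact div_le_div₀ (hy0 s hs') (hge s hs) (hR s hs') (hC s hs')
    have h4 : IntegrableOn (fun s : ℝ => s⁻¹) (Ioo 0 (σ / 2)) := by
      refine (hinv.const_mul (C / y (σ / 2))).congr (Eventually.of_forall fun s => ?_)
      have : C / y (σ / 2) ≠ 0 := by positivity
      exact mul_inv_cancel_left₀ this _
    have h5 : IntervalIntegrable (fun s : ℝ => s⁻¹) volume 0 (σ / 2) :=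
      (intervalIntegrable_iff_integrableOn_Ioo_of_le h2.1.le).2 h4
    rw [intervalIntegrable_inv_iff] at h5
    rcases h5 with h5 | h5
    · linarith
    · exact h5 left_mem_uIcc
  · have : y (σ / 2) ≤ 0 := ge_of_tendsto h (by
      filter_upwards [Ioo_mem_nhdsGT h2.1] with s hs using hge s hs)
    linarith

theorem exists_R_le (S : RevSurface) :
    ∃ C, 0 < C ∧ ∀ s ∈ Icc 0 S.L, ∀ p ∈ S.poles, S.R s ≤ C * |s - p| := by
  obtain ⟨C, hC⟩ := isCompact_Icc.exists_bound_of_continuousOn S.continuousOn_ds_R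
  refine ⟨max C 1, by positivity, fun s hs p hp => ?_⟩
  have hpI : p ∈ Icc 0 S.L := by
    rcases S.poles_subset hp with h | h
    · rw [h]; exact ⟨le_rfl, S.L_pos.le⟩
    · obtain rfl : p = S.L := h
      exact ⟨S.L_pos.le, le_rfl⟩
  have h := (convex_Icc 0 S.L).norm_image_sub_le_of_norm_derivWithin_le
    (S.R_smooth.differentiableOn (by simp)) hC hpI hs
  rw [S.R_eq_zero_of_mem_poles hp, sub_zero, Real.norm_eq_abs, Real.norm_eq_abs] at h
  exact (le_abs_self _).trans (h.trans (by gcongr; exact le_max_left _ _))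

theorem mem_bdry_zero (S : RevSurface) (h : (0 : ℝ) ∉ S.poles) : (0 : ℝ) ∈ S.bdry :=
  ⟨Or.inl rfl, h⟩

theorem mem_bdry_L (S : RevSurface) (h : S.L ∉ S.poles) : S.L ∈ S.bdry := ⟨Or.inr rfl, h⟩

/-- This supplies cut points at which the boundary term of an integration by parts can be dropped;
its mirror image follows. -/
theorem RadialEnergy.exists_nonneg_left {S : RevSurface} {ε : ℝ} {Q y z e : ℝ → ℝ}
    (hE : S.RadialEnergy ε Q y z e) (hyR : IntegrableOn (fun s => y s / S.R s) (Ioo 0 S.L))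
    (hbd : ∀ s₀ ∈ S.bdry, Tendsto y (𝓝[Ioo 0 S.L] s₀) (𝓝 0)) {σ : ℝ} (hσ : 0 < σ) :
    ∃ α ∈ Ioo 0 S.L, α < σ ∧ 0 ≤ z α := by
  by_contra! hcon
  have hL := S.L_pos
  have hsub : Ioo 0 (min σ S.L) ⊆ Ioo 0 S.L := Ioo_subset_Ioo le_rfl (min_le_right _ _)
  refine not_forall_neg_near_zero (lt_min hσ hL) (fun s hs => hE.y_deriv s (hsub hs))
    (fun s hs => S.R_pos_of_mem (hsub hs)) (fun s hs => hE.y_nonneg s (hsub hs))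
    (fun s hs => hcon s (hsub hs) (hs.2.trans_le (min_le_left _ _))) ?_
  by_cases hp : (0 : ℝ) ∈ S.poles
  · obtain ⟨C, _, hC⟩ := S.exists_R_le
    refine Or.inl ⟨C, fun s hs => ?_, hyR.mono_set hsub⟩
    have := hC s (Ioo_subset_Icc_self (hsub hs)) 0 hp
    rwa [sub_zero, abs_of_pos hs.1] at this
  · refine Or.inr ((hbd 0 (S.mem_bdry_zero hp)).mono_left ?_)
    rw [nhdsWithin_Ioo_eq_nhdsGT hL]

theorem RadialEnergy.exists_nonpos_right {S : RevSurface} {ε : ℝ} {Q y z e : ℝ → ℝ}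
    (hE : S.RadialEnergy ε Q y z e) (hyR : IntegrableOn (fun s => y s / S.R s) (Ioo 0 S.L))
    (hbd : ∀ s₀ ∈ S.bdry, Tendsto y (𝓝[Ioo 0 S.L] s₀) (𝓝 0)) {σ : ℝ} (hσ : σ < S.L) :
    ∃ β ∈ Ioo 0 S.L, σ < β ∧ z β ≤ 0 := by
  by_contra! hcon
  have hL := S.L_pos
  have hsub : ∀ s ∈ Ioo 0 (min (S.L - σ) S.L), S.L - s ∈ Ioo 0 S.L ∧ σ < S.L - s := by
    intro s hs
    have h1 := hs.2.trans_le (min_le_left _ _)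
    have h2 := hs.2.trans_le (min_le_right _ _)
    exact ⟨⟨by linarith, by linarith [hs.1]⟩, by linarith⟩
  -- The reflection `s ↦ L - s` reverses the sign of `z`.
  refine not_forall_neg_near_zero (σ := min (S.L - σ) S.L) (lt_min (by linarith) hL)
    (y := fun s => y (S.L - s)) (z := fun s => - z (S.L - s)) (R := fun s => S.R (S.L - s))
    (fun s hs => ?_) (fun s hs => S.R_pos_of_mem (hsub s hs).1)
    (fun s hs => hE.y_nonneg _ (hsub s hs).1)
    (fun s hs => neg_neg_of_pos (hcon _ (hsub s hs).1 (hsub s hs).2)) ?_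
  · have h1 : HasDerivAt (fun s => S.L - s) (-1) s := by
      simpa using (hasDerivAt_id s).const_sub S.L
    refine ((hE.y_deriv _ (hsub s hs).1).comp s h1).congr_deriv ?_
    ring
  by_cases hp : S.L ∈ S.poles
  · obtain ⟨C, _, hC⟩ := S.exists_R_le
    refine Or.inl ⟨C, fun s hs => ?_, ?_⟩
    · have := hC _ (Ioo_subset_Icc_self (hsub s hs).1) S.L hp
      rwa [show S.L - s - S.L = -s by ring, abs_neg, abs_of_pos hs.1] at this
    · have h1 : IntervalIntegrable (fun s => y s / S.R s) volume 0 S.L :=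
        (intervalIntegrable_iff_integrableOn_Ioo_of_le hL.le).2 hyR
      have h2 := h1.comp_sub_left S.L
      rw [sub_zero, sub_self] at h2
      have h3 := (intervalIntegrable_iff_integrableOn_Ioo_of_le hL.le).1 h2.symm
      exact h3.mono_set (Ioo_subset_Ioo le_rfl (min_le_right _ _))
  · refine Or.inr ((hbd _ (S.mem_bdry_L hp)).comp ?_)
    refine tendsto_nhdsWithin_iff.2 ⟨?_, ?_⟩
    · have : Tendsto (fun s : ℝ => S.L - s) (𝓝 0) (𝓝 (S.L - 0)) :=
        (continuous_const.sub continuous_id).tendsto 0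
      rw [sub_zero] at this
      exact this.mono_left nhdsWithin_le_nhds
    · filter_upwards [Ioo_mem_nhdsGT hL] with s hs
      exact ⟨by linarith [hs.2], by linarith [hs.1]⟩

theorem RadialEnergy.continuousOn_y {S : RevSurface} {ε : ℝ} {Q y z e : ℝ → ℝ}
    (hE : S.RadialEnergy ε Q y z e) : ContinuousOn y (Ioo 0 S.L) := fun s hs =>
  (hE.y_deriv s hs).continuousAt.continuousWithinAt

theorem RadialEnergy.abs_z_le {S : RevSurface} {ε : ℝ} {Q y z e : ℝ → ℝ}
    (hE : S.RadialEnergy ε Q y z e) {s : ℝ} (hs : s ∈ Ioo 0 S.L) :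
    |z s| ≤ S.R s * (√(y s) * √(e s)) := by
  have hR := (S.R_pos_of_mem hs).le
  refine abs_le_of_sq_le_sq ?_ (by positivity)
  rw [mul_pow, mul_pow, Real.sq_sqrt (hE.y_nonneg s hs), Real.sq_sqrt (hE.e_nonneg s hs)]
  exact hE.z_sq s hs

theorem abs_sinh_le_cosh (x : ℝ) : |Real.sinh x| ≤ Real.cosh x := by
  refine abs_le.2 ⟨?_, (Real.sinh_lt_cosh x).le⟩
  have := Real.sinh_lt_cosh (-x)
  rw [Real.sinh_neg, Real.cosh_neg] at this
  linarith

/-- The weight `cosh(2 t D / ε)` behaves like `exp(2 t |D| / ε)` but is smooth in the signed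
distance, so there is no kink at the well. The identity `∫ (χ z)' = χ z |_α^β ≤ 0` does the rest. -/
theorem RadialEnergy.agmon {S : RevSurface} {ε : ℝ} {Q y z e : ℝ → ℝ}
    (hE : S.RadialEnergy ε Q y z e) (hε : 0 < ε) {W D : ℝ → ℝ} (hW : ∀ s ∈ Ioo 0 S.L, 0 ≤ W s)
    (hWc : ContinuousOn W (Ioo 0 S.L)) (hD : ∀ s ∈ Ioo 0 S.L, HasDerivAt D √(W s) s)
    {t τ : ℝ} (ht : 0 ≤ t) (hτ : ∀ᵐ s, s ∈ Ioo 0 S.L → |Q s - W s| ≤ τ) {α β : ℝ}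
    (hα : α ∈ Ioo 0 S.L) (hβ : β ∈ Ioo 0 S.L) (hαβ : α ≤ β) (hzα : 0 ≤ z α) (hzβ : z β ≤ 0) :
    ∫ s in α..β, Real.cosh (2 * t / ε * D s) * (S.R s * ((1 - t ^ 2) * W s - τ) * y s) ≤ 0 := by
  have hsub : Icc α β ⊆ Ioo 0 S.L := Icc_subset_Ioo hα.1 hβ.2
  have hu : uIcc α β = Icc α β := uIcc_of_le hαβ
  have hDc : ContinuousOn D (Icc α β) := fun s hs =>
    (hD s (hsub hs)).continuousAt.continuousWithinAt
  have hWc' := hWc.mono hsub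
  set χ : ℝ → ℝ := fun s => Real.cosh (2 * t / ε * D s) with hχ
  set χ' : ℝ → ℝ := fun s => Real.sinh (2 * t / ε * D s) * (2 * t / ε * √(W s)) with hχ'
  have hχd : ∀ s ∈ Ioo 0 S.L, HasDerivAt χ (χ' s) s := fun s hs =>
    ((hD s hs).const_mul (2 * t / ε)).cosh
  have hχ'c : ContinuousOn χ' (Icc α β) :=
    (Real.continuous_sinh.comp_continuousOn (continuousOn_const.mul hDc)).mul
      (continuousOn_const.mul hWc'.sqrt)
  have hχc : ContinuousOn χ (Icc α β) :=
    Real.continuous_cosh.comp_continuousOn (continuousOn_const.mul hDc)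
  have hχac : AbsolutelyContinuousOnInterval χ α β :=
    absolutelyContinuousOnInterval_of_hasDerivAt (fun s hs => hχd s (hsub (hu ▸ hs)))
      (hu ▸ hχ'c)
  have hF := (hχac.fun_mul (hE.z_ac α hα β hβ)).ftc
    (f' := fun s => χ' s * z s + χ s * (S.R s * e s + S.R s * Q s / ε ^ 2 * y s)) (by
      filter_upwards [hE.z_deriv] with s h hs
      rw [hu] at hs
      exact (hχd s (hsub hs)).mul (h (hsub hs)))
  have h0 : χ β * z β - χ α * z α ≤ 0 := by
    have h1 : 0 < χ β := Real.cosh_pos _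
    have h2 : 0 < χ α := Real.cosh_pos _
    nlinarith [mul_nonneg h2.le hzα, mul_nonneg h1.le (neg_nonneg.2 hzβ)]
  have hI : IntervalIntegrable (fun s => χ s * (S.R s * ((1 - t ^ 2) * W s - τ) * y s))
      volume α β := by
    refine ContinuousOn.intervalIntegrable ?_
    rw [hu]
    exact hχc.mul (((S.continuousOn_R.mono (hsub.trans Ioo_subset_Icc_self)).mul
      ((continuousOn_const.mul hWc').sub continuousOn_const)).mul (hE.continuousOn_y.mono hsub))
  have hmono := intervalIntegral.integral_mono_ae_restrict hαβ hI (hF.1.const_mul (ε ^ 2)) (by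
    rw [EventuallyLE, ae_restrict_iff' measurableSet_Icc]
    filter_upwards [hτ] with s h1 hs
    have hs' := hsub hs
    have hQ := (abs_le.1 (h1 hs')).1
    have hR := S.R_pos_of_mem hs'
    have hz := hE.abs_z_le hs'
    set a := √(y s)
    set b := √(e s)
    set w := √(W s)
    have ha : y s = a ^ 2 := (Real.sq_sqrt (hE.y_nonneg s hs')).symm
    have hb : e s = b ^ 2 := (Real.sq_sqrt (hE.e_nonneg s hs')).symm
    have hw : W s = w ^ 2 := (Real.sq_sqrt (hW s hs')).symm
    have hcp : 0 < χ s := Real.cosh_pos _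
    have hw0 : 0 ≤ w := Real.sqrt_nonneg _
    have h2 : -(χ s * (S.R s * (a * b))) ≤ Real.sinh (2 * t / ε * D s) * z s := by
      refine (abs_le.1 ?_).1
      rw [abs_mul]
      exact mul_le_mul (abs_sinh_le_cosh _) hz (abs_nonneg _) hcp.le
    -- The cross term `-2 t ε w a b` coming from `χ' z` is completed to a square, at the cost of `t²
    -- W y`.
    have h3 : 0 ≤ χ s * S.R s * (ε * b - t * w * a) ^ 2 := by positivity
    have h4 : 0 ≤ χ s * S.R s * ((Q s - W s + τ) * y s) := by
      have h5 : 0 ≤ Q s - W s + τ := by linarith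
      have := hE.y_nonneg s hs'
      positivity
    have h6 : ε ^ 2 * (χ' s * z s + χ s * (S.R s * e s + S.R s * Q s / ε ^ 2 * y s))
        = 2 * t * ε * w * (Real.sinh (2 * t / ε * D s) * z s)
          + χ s * S.R s * (ε ^ 2 * e s + Q s * y s) := by
      simp only [hχ']
      field_simp
      ring
    have h7 := mul_le_mul_of_nonneg_left h2 (show 0 ≤ 2 * t * ε * w by positivity)
    change χ s * (S.R s * ((1 - t ^ 2) * W s - τ) * y s)
      ≤ ε ^ 2 * (χ' s * z s + χ s * (S.R s * e s + S.R s * Q s / ε ^ 2 * y s))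
    rw [h6]
    rw [hb]
    rw [ha, hw] at h4 ⊢
    nlinarith [h3, h4, h7])
  rw [intervalIntegral.integral_const_mul, hF.2] at hmono
  exact hmono.trans (mul_nonpos_of_nonneg_of_nonpos (sq_nonneg _) h0)

/-- In the Agmon inequality the factor `(1 - t²) W - τ` is at least `κ` off `B` and at least `-κ` on
`B`. So the weighted mass off `B` is at most that on `B`, where the weight is at most `M`. -/
theorem RadialEnergy.weighted_mass_le {S : RevSurface} {ε : ℝ} {Q y z e : ℝ → ℝ}
    (hE : S.RadialEnergy ε Q y z e) (hε : 0 < ε)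
    (hRy : IntegrableOn (fun s => S.R s * y s) (Ioo 0 S.L))
    (hyR : IntegrableOn (fun s => y s / S.R s) (Ioo 0 S.L))
    (hbd : ∀ s₀ ∈ S.bdry, Tendsto y (𝓝[Ioo 0 S.L] s₀) (𝓝 0))
    {W D : ℝ → ℝ} (hW : ∀ s ∈ Ioo 0 S.L, 0 ≤ W s)
    (hWc : ContinuousOn W (Ioo 0 S.L)) (hD : ∀ s ∈ Ioo 0 S.L, HasDerivAt D √(W s) s)
    {t τ κ M : ℝ} (ht : 0 ≤ t) (ht1 : t ≤ 1) (hτ : ∀ᵐ s, s ∈ Ioo 0 S.L → |Q s - W s| ≤ τ)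
    (hκ : 0 < κ) (hτκ : τ ≤ κ) {B : Set ℝ} (hB : MeasurableSet B)
    (hWB : ∀ s ∈ Ioo 0 S.L, s ∉ B → 2 * κ ≤ (1 - t ^ 2) * W s)
    (hM : ∀ s ∈ Ioo 0 S.L, s ∈ B → Real.cosh (2 * t / ε * D s) ≤ M) {α β : ℝ}
    (hα : α ∈ Ioo 0 S.L) (hβ : β ∈ Ioo 0 S.L) :
    ∫ s in Icc α β, Real.cosh (2 * t / ε * D s) * (S.R s * y s)
      ≤ 2 * M * ∫ s in Ioo 0 S.L ∩ B, S.R s * y s := by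
  obtain ⟨a, ha, haα, hza⟩ := hE.exists_nonneg_left hyR hbd hα.1
  obtain ⟨b, hb, hbβ, hzb⟩ := hE.exists_nonpos_right hyR hbd (max_lt hα.2 hβ.2)
  have hab : a ≤ b := haα.le.trans ((le_max_left _ _).trans hbβ.le)
  have hsub : Icc a b ⊆ Ioo 0 S.L := Icc_subset_Ioo ha.1 hb.2
  have hDc : ContinuousOn D (Icc a b) := fun s hs =>
    (hD s (hsub hs)).continuousAt.continuousWithinAt
  have hRyc : ContinuousOn (fun s => S.R s * y s) (Icc a b) :=
    (S.continuousOn_R.mono (hsub.trans Ioo_subset_Icc_self)).mul (hE.continuousOn_y.mono hsub)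
  set h : ℝ → ℝ := fun s => Real.cosh (2 * t / ε * D s) * (S.R s * y s) with hh
  have hhc : ContinuousOn h (Icc a b) :=
    (Real.continuous_cosh.comp_continuousOn (continuousOn_const.mul hDc)).mul hRyc
  have hhi : IntegrableOn h (Icc a b) := hhc.integrableOn_Icc
  have hRy0 : ∀ s ∈ Ioo 0 S.L, 0 ≤ S.R s * y s := fun s hs =>
    mul_nonneg (S.R_pos_of_mem hs).le (hE.y_nonneg s hs)
  have hh0 : ∀ s ∈ Ioo 0 S.L, 0 ≤ h s := fun s hs =>
    mul_nonneg (Real.cosh_pos _).le (hRy0 s hs)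
  have key := hE.agmon hε hW hWc hD ht hτ ha hb hab hza hzb
  rw [intervalIntegral.integral_of_le hab, ← integral_Icc_eq_integral_Ioc] at key
  have hBi : IntegrableOn (B.indicator h) (Icc a b) := hhi.indicator hB
  have hlow : ∫ s in Icc a b, κ * (h s - 2 * B.indicator h s) ≤ 0 := by
    refine le_trans (setIntegral_mono_on ((hhi.sub (hBi.const_mul 2)).const_mul κ) ?_
      measurableSet_Icc fun s hs => ?_) key
    · refine ContinuousOn.integrableOn_Icc ?_
      exact (Real.continuous_cosh.comp_continuousOn (continuousOn_const.mul hDc)).mul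
        (((S.continuousOn_R.mono (hsub.trans Ioo_subset_Icc_self)).mul
        ((continuousOn_const.mul (hWc.mono hsub)).sub continuousOn_const)).mul
        (hE.continuousOn_y.mono hsub))
    · have hs' := hsub hs
      have h1 : Real.cosh (2 * t / ε * D s) * (S.R s * ((1 - t ^ 2) * W s - τ) * y s)
          = ((1 - t ^ 2) * W s - τ) * h s := by simp only [hh]; ring
      rw [h1]
      have h2 := hh0 s hs'
      by_cases hsB : s ∈ B
      · rw [indicator_of_mem hsB]
        have h3 : 0 ≤ (1 - t ^ 2) * W s := mul_nonneg (by nlinarith) (hW s hs')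
        nlinarith
      · rw [indicator_of_notMem hsB]
        have h3 := hWB s hs' hsB
        nlinarith
  rw [integral_const_mul, integral_sub hhi (hBi.const_mul 2), integral_const_mul] at hlow
  have h1 : ∫ s in Icc a b, h s ≤ 2 * ∫ s in Icc a b, B.indicator h s := by
    by_contra hcon
    exact absurd hlow (not_le.2 (mul_pos hκ (by linarith)))
  have h2 : ∫ s in Icc a b, B.indicator h s ≤ M * ∫ s in Ioo 0 S.L ∩ B, S.R s * y s := by
    rw [setIntegral_indicator hB, ← integral_const_mul]
    have hi : IntegrableOn (fun s => M * (S.R s * y s)) (Ioo 0 S.L ∩ B) :=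
      (hRy.mono_set inter_subset_left).const_mul M
    have hsub2 : Icc a b ∩ B ⊆ Ioo 0 S.L ∩ B := inter_subset_inter_left _ hsub
    refine (setIntegral_mono_on (hhi.mono_set inter_subset_left) (hi.mono_set hsub2)
      (measurableSet_Icc.inter hB) fun s hs => ?_).trans
      (setIntegral_mono_set hi ?_ hsub2.eventuallyLE)
    · exact mul_le_mul_of_nonneg_right (hM s (hsub hs.1) hs.2) (hRy0 s (hsub hs.1))
    · rw [EventuallyLE, ae_restrict_iff' (measurableSet_Ioo.inter hB)]
      refine Eventually.of_forall fun s hs => ?_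
      exact mul_nonneg ((Real.cosh_pos _).le.trans (hM s hs.1 hs.2)) (hRy0 s hs.1)
  have h3 : ∫ s in Icc α β, h s ≤ ∫ s in Icc a b, h s := by
    refine setIntegral_mono_set hhi ?_ (Icc_subset_Icc haα.le
      ((le_max_right _ _).trans hbβ.le)).eventuallyLE
    rw [EventuallyLE, ae_restrict_iff' measurableSet_Icc]
    exact Eventually.of_forall fun s hs => hh0 s (hsub hs)
  linarith

/-! ### Propagation of lower bounds -/

/-- The semiclassical energy density. -/
def energyDensity (ε : ℝ) (A y e : ℝ → ℝ) (s : ℝ) : ℝ := ε ^ 2 * e s + A s * y s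

/-- With `g = √A`, the main part `2 (Q + A) z / R` of the derivative is handled by `2 (ε b)(g a) ≤
ε² b² + g² a²`, giving the rate `2 √A / ε` up to `O(√τ / ε)`. The terms with `R'` and `A'` lack the
factor `1 / ε` and are absorbed through `hsmall`. -/
theorem RadialEnergy.energyDensity_deriv_bound {ε ρ₀ a₁ τ R ρ y e z A A' Q W : ℝ} (hε : 0 < ε)
    (hR : 0 < R) (hy : 0 ≤ y) (he : 0 ≤ e) (hz : |z| ≤ R * (√y * √e)) (hτ : 0 < τ) (hA : τ ≤ A)
    (hAW : A ≤ W + 2 * τ) (hW : 0 ≤ W) (hQ : |Q - A| ≤ 3 * τ) (hρ : |ρ / R| ≤ ρ₀)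
    (hA' : |A'| ≤ a₁) (hsmall : ε * (2 * ρ₀ + a₁ / τ) ≤ √τ) :
    |ε ^ 2 * (-2 * (ρ / R) * e + 2 * Q / ε ^ 2 * (z / R)) + (A' * y + A * (2 * z / R))|
      ≤ 2 / ε * (√W + 4 * √τ) * (ε ^ 2 * e + A * y) := by
  set a := √y
  set b := √e
  set w := √W
  set m := √τ
  set g := √A
  have hA0 : 0 < A := hτ.trans_le hA
  have ha : y = a ^ 2 := (Real.sq_sqrt hy).symm
  have hb : e = b ^ 2 := (Real.sq_sqrt he).symm
  have hw : W = w ^ 2 := (Real.sq_sqrt hW).symm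
  have hm : τ = m ^ 2 := (Real.sq_sqrt hτ.le).symm
  have hg : A = g ^ 2 := (Real.sq_sqrt hA0.le).symm
  have hm0 : 0 < m := Real.sqrt_pos.2 hτ
  have hg0 : 0 < g := Real.sqrt_pos.2 hA0
  have hw0 : 0 ≤ w := Real.sqrt_nonneg _
  have ha0 : 0 ≤ a := Real.sqrt_nonneg _
  have hb0 : 0 ≤ b := Real.sqrt_nonneg _
  have hmg : m ≤ g := Real.sqrt_le_sqrt hA
  -- From `g² ≤ w² + 2 m²`, since `(3/2)² ≥ 2`.
  have hgw : g ≤ w + 3 / 2 * m := by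
    by_contra hcon
    nlinarith [mul_nonneg hw0 hm0.le]
  set N := ε ^ 2 * e + A * y
  have hN : N = (ε * b) ^ 2 + (g * a) ^ 2 := by simp only [N, hb, ha, hg]; ring
  have hN0 : 0 ≤ N := by rw [hN]; positivity
  have hzR : |z / R| ≤ a * b := by
    rw [abs_div, abs_of_pos hR, div_le_iff₀ hR]; linarith
  have hQA : |Q + A| ≤ 2 * A + 3 * τ := by
    rw [abs_le] at hQ ⊢
    constructor <;> linarith [hQ.1, hQ.2]
  have h1 : ε ^ 2 * (-2 * (ρ / R) * e + 2 * Q / ε ^ 2 * (z / R)) + (A' * y + A * (2 * z / R))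
      = 2 * (Q + A) * (z / R) + (-2 * (ρ / R) * (ε ^ 2 * e) + A' * y) := by
    field_simp
    ring
  have h2 : |2 * (Q + A) * (z / R)| ≤ (2 * g + 3 * m) / ε * N := by
    rw [abs_mul, abs_mul, abs_two]
    have h3 : 2 * |Q + A| * |z / R| ≤ 2 * (2 * A + 3 * τ) * (a * b) := by gcongr
    have h4 : 2 * (2 * A + 3 * τ) * (a * b) ≤ (2 * g + 3 * m) * g * (2 * (a * b)) := by
      have : 2 * A + 3 * τ ≤ (2 * g + 3 * m) * g := by rw [hg, hm]; nlinarith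
      have := mul_le_mul_of_nonneg_right this (show 0 ≤ 2 * (a * b) by positivity)
      linarith
    refine (h3.trans h4).trans ?_
    rw [div_mul_eq_mul_div, le_div_iff₀ hε, hN, mul_assoc, mul_assoc]
    refine mul_le_mul_of_nonneg_left ?_ (by positivity)
    nlinarith [sq_nonneg (ε * b - g * a)]
  have h5 : |(-2 * (ρ / R) * (ε ^ 2 * e) + A' * y)| ≤ (2 * ρ₀ + a₁ / τ) * N := by
    have h6 : |(-2 * (ρ / R) * (ε ^ 2 * e))| ≤ 2 * ρ₀ * (ε ^ 2 * e) := by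
      rw [abs_mul, abs_mul, abs_neg, abs_two, abs_of_nonneg (show 0 ≤ ε ^ 2 * e by positivity)]
      gcongr
    have ha1 : 0 ≤ a₁ := (abs_nonneg _).trans hA'
    have h7 : |A' * y| ≤ a₁ / τ * (A * y) := by
      rw [abs_mul, abs_of_nonneg hy, div_mul_eq_mul_div, le_div_iff₀ hτ]
      calc |A'| * y * τ ≤ a₁ * y * A := by gcongr
        _ = a₁ * (A * y) := by ring
    have hρ0 : 0 ≤ ρ₀ := (abs_nonneg _).trans hρ
    have h8 : 0 ≤ 2 * ρ₀ * (A * y) := by positivity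
    have h9 : 0 ≤ a₁ / τ * (ε ^ 2 * e) := by positivity
    have h10 : (2 * ρ₀ + a₁ / τ) * N = 2 * ρ₀ * (ε ^ 2 * e) + a₁ / τ * (A * y)
        + (2 * ρ₀ * (A * y) + a₁ / τ * (ε ^ 2 * e)) := by simp only [N]; ring
    rw [h10]
    refine (abs_add_le _ _).trans ?_
    linarith
  rw [h1]
  refine (abs_add_le _ _).trans ((add_le_add h2 h5).trans ?_)
  rw [← add_mul]
  refine mul_le_mul_of_nonneg_right ?_ hN0
  have h10 : 2 * ρ₀ + a₁ / τ ≤ m / ε := by rw [le_div_iff₀ hε]; linarith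
  -- The constant `4` in the rate: `2 g + 4 m ≤ 2 w + 7 m ≤ 2 (w + 4 m)`.
  calc (2 * g + 3 * m) / ε + (2 * ρ₀ + a₁ / τ) ≤ (2 * g + 3 * m) / ε + m / ε := by linarith
    _ = (2 * g + 4 * m) / ε := by ring
    _ ≤ (2 * (w + 4 * m)) / ε := by gcongr; linarith
    _ = 2 / ε * (w + 4 * m) := by ring

/-- Gronwall in both directions: with `G = D + 4 √τ s`, the product of the density with `exp(2 G /
ε)` is nondecreasing and the product with `exp(-2 G / ε)` is nonincreasing. -/
theorem RadialEnergy.energyDensity_propagation {S : RevSurface} {ε : ℝ} {Q y z e : ℝ → ℝ}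
    (hE : S.RadialEnergy ε Q y z e) (hε : 0 < ε) {W D A A' : ℝ → ℝ} {a b ρ₀ a₁ τ : ℝ}
    (hab : Ioo a b ⊆ Ioo 0 S.L)
    (hW : ∀ s ∈ Ioo a b, 0 ≤ W s) (hWc : ContinuousOn W (Ioo a b))
    (hD : ∀ s ∈ Ioo a b, HasDerivAt D √(W s) s)
    (hAd : ∀ s ∈ Ioo a b, HasDerivAt A (A' s) s) (hAc : ContinuousOn A' (Ioo a b)) (hτ : 0 < τ)
    (hA : ∀ s ∈ Ioo a b, τ ≤ A s) (hAW : ∀ s ∈ Ioo a b, A s ≤ W s + 2 * τ)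
    (hQ : ∀ᵐ s, s ∈ Ioo a b → |Q s - A s| ≤ 3 * τ)
    (hρ : ∀ s ∈ Ioo a b, |S.ds S.R s / S.R s| ≤ ρ₀) (hA' : ∀ s ∈ Ioo a b, |A' s| ≤ a₁)
    (hsmall : ε * (2 * ρ₀ + a₁ / τ) ≤ √τ) {x x' : ℝ} (hx : x ∈ Ioo a b) (hx' : x' ∈ Ioo a b) :
    energyDensity ε A y e x * Real.exp (-(2 / ε * (|D x' - D x| + 4 * √τ * |x' - x|)))
      ≤ energyDensity ε A y e x' := by
  set G : ℝ → ℝ := fun s => D s + 4 * √τ * s with hG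
  have hGd : ∀ s ∈ Ioo a b, HasDerivAt G (√(W s) + 4 * √τ) s := fun s hs =>
    ((hD s hs).add ((hasDerivAt_id s).const_mul (4 * √τ))).congr_deriv (by rw [mul_one])
  set N := energyDensity ε A y e with hNdef
  have hN0 : ∀ s ∈ Ioo a b, 0 ≤ N s := fun s hs => by
    have h1 := hE.y_nonneg s (hab hs)
    have h2 := hE.e_nonneg s (hab hs)
    have h3 := hτ.le.trans (hA s hs)
    simp only [hNdef, energyDensity]
    positivity
  have hyac : ∀ α ∈ Ioo a b, ∀ β ∈ Ioo a b, AbsolutelyContinuousOnInterval y α β := by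
    intro α hα β hβ
    have hs := (ordConnected_Ioo.uIcc_subset hα hβ).trans hab
    refine absolutelyContinuousOnInterval_of_hasDerivAt (fun s h => hE.y_deriv s (hs h)) ?_
    have hzc : ContinuousOn z (uIcc α β) := (hE.z_ac α (hab hα) β (hab hβ)).continuousOn
    exact (continuousOn_const.mul hzc).div
      (S.continuousOn_R.mono (hs.trans Ioo_subset_Icc_self))
      fun s h => (S.R_pos_of_mem (hs h)).ne'
  have hNac : ∀ α ∈ Ioo a b, ∀ β ∈ Ioo a b, AbsolutelyContinuousOnInterval N α β := by
    intro α hα β hβ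
    have hs := ordConnected_Ioo.uIcc_subset hα hβ
    exact ((hE.e_ac α (hab hα) β (hab hβ)).const_mul (ε ^ 2)).add
      ((absolutelyContinuousOnInterval_of_hasDerivAt (fun s h => hAd s (hs h))
        (hAc.mono hs)).mul (hyac α hα β hβ))
  have hNd : ∀ᵐ s, s ∈ Ioo a b → ∃ N', HasDerivAt N N' s ∧
      |N'| ≤ 2 / ε * (√(W s) + 4 * √τ) * N s := by
    filter_upwards [hE.e_deriv, hQ] with s h1 h2 hs
    have hs' := hab hs
    refine ⟨_, ((h1 hs').const_mul (ε ^ 2)).add ((hAd s hs).mul (hE.y_deriv s hs')), ?_⟩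
    exact energyDensity_deriv_bound hε (S.R_pos_of_mem hs') (hE.y_nonneg s hs')
      (hE.e_nonneg s hs') (hE.abs_z_le hs') hτ (hA s hs) (hAW s hs) (hW s hs) (h2 hs) (hρ s hs)
      (hA' s hs) hsmall
  have hEac : ∀ σ : ℝ, ∀ α ∈ Ioo a b, ∀ β ∈ Ioo a b,
      AbsolutelyContinuousOnInterval (fun s => Real.exp (σ * (2 / ε * G s))) α β := by
    intro σ α hα β hβ
    have hs := ordConnected_Ioo.uIcc_subset hα hβ
    have hGc : ContinuousOn G (uIcc α β) := fun s h =>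
      (hGd s (hs h)).continuousAt.continuousWithinAt
    refine absolutelyContinuousOnInterval_of_hasDerivAt (fun s h =>
      (((hGd s (hs h)).const_mul (2 / ε)).const_mul σ).exp) ?_
    exact (Real.continuous_exp.comp_continuousOn (continuousOn_const.mul
      (continuousOn_const.mul hGc))).mul (continuousOn_const.mul (continuousOn_const.mul
      ((hWc.mono hs).sqrt.add continuousOn_const)))
  have hDmono : ∀ {α β : ℝ}, α ∈ Ioo a b → β ∈ Ioo a b → α ≤ β →
      G β - G α ≤ |D β - D α| + 4 * √τ * |β - α| := by
    intro α β _ _ hαβ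
    have h1 := le_abs_self (D β - D α)
    rw [abs_of_nonneg (show 0 ≤ β - α by linarith)]
    simp only [hG]
    linarith
  have hexp : ∀ {u v r n n' : ℝ}, 0 ≤ n → v - u ≤ r → n * Real.exp u ≤ n' * Real.exp v →
      n * Real.exp (-r) ≤ n' := by
    intro u v r n n' hn hr h
    refine (mul_le_mul_of_nonneg_left (Real.exp_le_exp.2 (show -r ≤ u - v by linarith)) hn).trans ?_
    rw [Real.exp_sub, ← mul_div_assoc, div_le_iff₀ (Real.exp_pos _)]
    exact h
  have h2ε : 0 ≤ 2 / ε := by positivity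
  rcases le_total x x' with hxx | hxx
  · refine hexp (u := 1 * (2 / ε * G x)) (v := 1 * (2 / ε * G x')) (hN0 x hx) ?_ ?_
    · have := mul_le_mul_of_nonneg_left (hDmono hx hx' hxx) h2ε
      linarith
    have hs : Icc x x' ⊆ Ioo a b := Icc_subset_Ioo hx.1 hx'.2
    have hac := (hNac x hx x' hx').fun_mul (hEac 1 x hx x' hx')
    have hd : ∀ᵐ s, s ∈ Icc x x' → ∃ d, HasDerivAt
        (fun s => N s * Real.exp (1 * (2 / ε * G s))) d s ∧ 0 ≤ d := by
      filter_upwards [hNd] with s h1 h2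
      obtain ⟨N', h3, h4⟩ := h1 (hs h2)
      refine ⟨_, h3.mul (((hGd s (hs h2)).const_mul (2 / ε)).const_mul 1).exp, ?_⟩
      have h5 := (abs_le.1 h4).1
      have h6 : N' * Real.exp (1 * (2 / ε * G s)) + N s * (Real.exp (1 * (2 / ε * G s)) *
          (1 * (2 / ε * (√(W s) + 4 * √τ)))) = Real.exp (1 * (2 / ε * G s)) *
          (N' + 2 / ε * (√(W s) + 4 * √τ) * N s) := by ring
      rw [h6]
      exact mul_nonneg (Real.exp_pos _).le (by linarith)
    have := hac.le_of_deriv_nonneg (f' := deriv fun s => N s * Real.exp (1 * (2 / ε * G s))) hxx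
      (by filter_upwards [hd] with s h1 h2
          obtain ⟨d, h3, _⟩ := h1 h2
          exact h3.differentiableAt.hasDerivAt)
      (by filter_upwards [hd] with s h1 h2
          obtain ⟨d, h3, h4⟩ := h1 h2
          rwa [h3.deriv])
    exact this
  · have hr : G x - G x' ≤ |D x' - D x| + 4 * √τ * |x' - x| := by
      rw [abs_sub_comm (D x'), abs_sub_comm x']
      exact hDmono hx' hx hxx
    have hs : Icc x' x ⊆ Ioo a b := Icc_subset_Ioo hx'.1 hx.2
    have hac := ((hNac x' hx' x hx).fun_mul (hEac (-1) x' hx' x hx)).neg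
    have hd : ∀ᵐ s, s ∈ Icc x' x → ∃ d, HasDerivAt
        (-fun s => N s * Real.exp (-1 * (2 / ε * G s))) d s ∧ 0 ≤ d := by
      filter_upwards [hNd] with s h1 h2
      obtain ⟨N', h3, h4⟩ := h1 (hs h2)
      refine ⟨_, (h3.mul (((hGd s (hs h2)).const_mul (2 / ε)).const_mul (-1)).exp).neg, ?_⟩
      have h5 := (abs_le.1 h4).2
      have h6 : -(N' * Real.exp (-1 * (2 / ε * G s)) + N s * (Real.exp (-1 * (2 / ε * G s)) *
          (-1 * (2 / ε * (√(W s) + 4 * √τ))))) = Real.exp (-1 * (2 / ε * G s)) *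
          (2 / ε * (√(W s) + 4 * √τ) * N s - N') := by ring
      rw [h6]
      exact mul_nonneg (Real.exp_pos _).le (by linarith)
    have := hac.le_of_deriv_nonneg (f' := deriv (-fun s => N s * Real.exp (-1 * (2 / ε * G s)))) hxx
      (by filter_upwards [hd] with s h1 h2
          obtain ⟨d, h3, _⟩ := h1 h2
          exact h3.differentiableAt.hasDerivAt)
      (by filter_upwards [hd] with s h1 h2
          obtain ⟨d, h3, h4⟩ := h1 h2
          rwa [h3.deriv])
    refine hexp (u := -1 * (2 / ε * G x)) (v := -1 * (2 / ε * G x')) (hN0 x hx) ?_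
      (neg_le_neg_iff.1 this)
    have := mul_le_mul_of_nonneg_left hr h2ε
    linarith

theorem integral_bump_pos {l : ℝ} (hl : 0 < l) : 0 < ∫ x in 0..l, (x * (l - x)) ^ 2 :=
  intervalIntegral.intervalIntegral_pos_of_pos_on
    (Continuous.intervalIntegrable (by fun_prop) _ _)
    (fun x hx => pow_pos (mul_pos hx.1 (by linarith [hx.2])) 2) hl

/-- A Caccioppoli inequality: a lower bound for the energy density on an interval gives a lower
bound for the mass of the solution itself. -/
theorem RadialEnergy.mass_ge_of_energyDensity_ge {S : RevSurface} {ε : ℝ} {Q y z e : ℝ → ℝ}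
    (hE : S.RadialEnergy ε Q y z e) (hε : 0 < ε) (hε1 : ε ≤ 1) {A : ℝ → ℝ}
    {i l r₀ R₁ ρ₁ q₁ A₁ m : ℝ} (hl : 0 < l) (hl1 : l ≤ 1) (hi : i ∈ Ioo 0 S.L)
    (hil : i + l ∈ Ioo 0 S.L) (hR : ∀ s ∈ Icc i (i + l), r₀ ≤ S.R s ∧ S.R s ≤ R₁)
    (hr₀ : 0 ≤ r₀) (hρ : ∀ s ∈ Icc i (i + l), |S.ds S.R s| ≤ ρ₁)
    (hQ : ∀ᵐ s, s ∈ Icc i (i + l) → |Q s| ≤ q₁) (hA : ∀ s ∈ Icc i (i + l), A s ≤ A₁)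
    (hA₁ : 0 ≤ A₁) (hm : 0 ≤ m) (hN : ∀ s ∈ Icc i (i + l), m ≤ energyDensity ε A y e s) :
    m * r₀ * ∫ x in 0..l, (x * (l - x)) ^ 2
      ≤ (R₁ * q₁ + 3 * R₁ + ρ₁ + R₁ * A₁) * ∫ s in i..(i + l), y s := by
  have hle : i ≤ i + l := by linarith
  have hu : uIcc i (i + l) = Icc i (i + l) := uIcc_of_le hle
  have hsub : Icc i (i + l) ⊆ Ioo 0 S.L := Icc_subset_Ioo hi.1 hil.2
  -- The square makes both the cutoff and its derivative vanish at the two ends.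
  set χ : ℝ → ℝ := fun s => ((s - i) * (l - (s - i))) ^ 2 with hχ
  set χ' : ℝ → ℝ := fun s => 2 * ((s - i) * (l - (s - i))) * (l - 2 * (s - i)) with hχ'
  set χ'' : ℝ → ℝ := fun s => 2 * (l - 2 * (s - i)) ^ 2 - 4 * ((s - i) * (l - (s - i))) with hχ''
  have hd0 : ∀ s, HasDerivAt (fun s => (s - i) * (l - (s - i))) (l - 2 * (s - i)) s := fun s => by
    have h1 : HasDerivAt (fun s : ℝ => s - i) 1 s := (hasDerivAt_id s).sub_const i
    refine (h1.mul (h1.const_sub l)).congr_deriv ?_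
    ring
  have hd1 : ∀ s, HasDerivAt χ (χ' s) s := fun s => by
    refine ((hd0 s).pow 2).congr_deriv ?_
    simp only [hχ']
    push_cast
    ring
  have hd2 : ∀ s, HasDerivAt χ' (χ'' s) s := fun s => by
    have h1 : HasDerivAt (fun s : ℝ => l - 2 * (s - i)) (-2) s := by
      refine ((((hasDerivAt_id s).sub_const i).const_mul 2).const_sub l).congr_deriv ?_
      ring
    refine (((hd0 s).const_mul 2).mul h1).congr_deriv ?_
    simp only [hχ'']
    ring
  have hyc : ContinuousOn y (Icc i (i + l)) := hE.continuousOn_y.mono hsub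
  have hRc : ContinuousOn S.R (Icc i (i + l)) :=
    S.continuousOn_R.mono (hsub.trans Ioo_subset_Icc_self)
  have hdRc : ContinuousOn (S.ds S.R) (Icc i (i + l)) :=
    S.continuousOn_ds_R.mono (hsub.trans Ioo_subset_Icc_self)
  have hzc : ContinuousOn z (Icc i (i + l)) := hu ▸ (hE.z_ac i hi _ hil).continuousOn
  have hac1 : AbsolutelyContinuousOnInterval (fun s => χ s * z s) i (i + l) :=
    (absolutelyContinuousOnInterval_of_hasDerivAt (fun s _ => hd1 s)
      (by simp only [hχ']; fun_prop)).fun_mul (hE.z_ac i hi _ hil)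
  have hR0 : ∀ s ∈ Icc i (i + l), S.R s ≠ 0 := fun s hs => (S.R_pos_of_mem (hsub hs)).ne'
  have hd3 : ∀ s ∈ Icc i (i + l), HasDerivAt (fun s => χ' s * S.R s * y s)
      ((χ'' s * S.R s + χ' s * S.ds S.R s) * y s + 2 * χ' s * z s) s := fun s hs => by
    refine (((hd2 s).mul (S.hasDerivAt_R (hsub hs))).mul
      (hE.y_deriv s (hsub hs))).congr_deriv ?_
    have := hR0 s hs
    simp only [Pi.mul_apply]
    field_simp
  have hac2 : AbsolutelyContinuousOnInterval (fun s => χ' s * S.R s * y s) i (i + l) := by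
    refine absolutelyContinuousOnInterval_of_hasDerivAt (fun s hs => hd3 s (hu ▸ hs)) ?_
    rw [hu]
    have c1 : Continuous χ' := by simp only [hχ']; fun_prop
    have c2 : Continuous χ'' := by simp only [hχ'']; fun_prop
    exact (((c2.continuousOn.mul hRc).add (c1.continuousOn.mul hdRc)).mul hyc).add
      ((continuousOn_const.mul c1.continuousOn).mul hzc)
  -- Subtracting `χ' R y / 2` from `χ z` cancels the term `χ' z`, so the resulting identity involves
  -- only `y` and `e`.
  have hF := (hac1.sub (hac2.const_mul (1 / 2))).ftc
    (f' := fun s => χ s * (S.R s * e s + S.R s * Q s / ε ^ 2 * y s)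
      - 1 / 2 * (χ'' s * S.R s + χ' s * S.ds S.R s) * y s) (by
      filter_upwards [hE.z_deriv] with s h1 hs
      rw [hu] at hs
      refine (((hd1 s).mul (h1 (hsub hs))).sub ((hd3 s hs).const_mul (1 / 2))).congr_deriv ?_
      ring)
  have hzero : ((fun s => χ s * z s) - fun s => 1 / 2 * (χ' s * S.R s * y s)) (i + l)
      - ((fun s => χ s * z s) - fun s => 1 / 2 * (χ' s * S.R s * y s)) i = 0 := by
    simp [hχ, hχ']
  rw [hzero] at hF
  set C := R₁ * q₁ + 3 * R₁ + ρ₁ + R₁ * A₁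
  have hyi : IntervalIntegrable y volume i (i + l) := (hu ▸ hyc).intervalIntegrable
  have hmono := intervalIntegral.integral_mono_ae_restrict hle
    (f := fun s => m * r₀ * χ s) (Continuous.intervalIntegrable (by simp only [hχ]; fun_prop) _ _)
    ((hF.1.const_mul (ε ^ 2)).add (hyi.const_mul C)) (by
    rw [EventuallyLE, ae_restrict_iff' measurableSet_Icc]
    filter_upwards [hQ] with s h1 hs
    have hy := hE.y_nonneg s (hsub hs)
    have hRs := hR s hs
    have hRpos := S.R_pos_of_mem (hsub hs)
    have hu0 : 0 ≤ s - i := by linarith [hs.1]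
    have hu1 : s - i ≤ l := by linarith [hs.2]
    have hp0 : 0 ≤ (s - i) * (l - (s - i)) := mul_nonneg hu0 (by linarith)
    have hp1 : (s - i) * (l - (s - i)) ≤ 1 := by
      have h2 : (s - i) * (l - (s - i)) ≤ 1 * 1 :=
        mul_le_mul (by linarith) (by linarith) (by linarith) zero_le_one
      linarith
    have hp' : |l - 2 * (s - i)| ≤ 1 := abs_le.2 ⟨by linarith, by linarith⟩
    have b0 : 0 ≤ χ s := sq_nonneg _
    have b1 : χ s ≤ 1 := pow_le_one₀ hp0 hp1
    have b2 : |χ' s| ≤ 2 := by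
      simp only [hχ']
      rw [abs_mul, abs_mul, abs_two, abs_of_nonneg hp0]
      linarith [mul_le_mul hp1 hp' (abs_nonneg _) zero_le_one]
    have b3 : |χ'' s| ≤ 6 := by
      have h3 : (l - 2 * (s - i)) ^ 2 ≤ 1 := by
        rw [← sq_abs]; exact pow_le_one₀ (abs_nonneg _) hp'
      simp only [hχ'']
      refine abs_le.2 ⟨?_, ?_⟩ <;> linarith [sq_nonneg (l - 2 * (s - i))]
    have hE1 : 0 ≤ q₁ := (abs_nonneg _).trans (h1 hs)
    have hR1 : 0 ≤ R₁ := hRpos.le.trans hRs.2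
    have t1 : -(χ s * S.R s * Q s) ≤ R₁ * q₁ := by
      refine (neg_le_abs _).trans ?_
      rw [abs_mul, abs_mul, abs_of_nonneg b0, abs_of_pos hRpos]
      exact mul_le_mul ((mul_le_of_le_one_left hRpos.le b1).trans hRs.2) (h1 hs) (abs_nonneg _) hR1
    have t2 : ε ^ 2 * (1 / 2 * (χ'' s * S.R s + χ' s * S.ds S.R s)) ≤ 3 * R₁ + ρ₁ := by
      have h4 : |χ'' s * S.R s + χ' s * S.ds S.R s| ≤ 6 * R₁ + 2 * ρ₁ := by
        refine (abs_add_le _ _).trans (add_le_add ?_ ?_)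
        · rw [abs_mul, abs_of_pos hRpos]
          exact mul_le_mul b3 hRs.2 hRpos.le (by norm_num)
        · rw [abs_mul]
          exact mul_le_mul b2 (hρ s hs) (abs_nonneg _) (by norm_num)
      have h5 : ε ^ 2 ≤ 1 := pow_le_one₀ hε.le hε1
      refine (le_abs_self _).trans ?_
      rw [abs_mul, abs_mul, abs_of_nonneg (sq_nonneg ε), abs_of_nonneg (by norm_num : (0 : ℝ) ≤ 1 / 2)]
      have h6 : 1 / 2 * |χ'' s * S.R s + χ' s * S.ds S.R s| ≤ 3 * R₁ + ρ₁ := by linarith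
      have h7 : 0 ≤ 1 / 2 * |χ'' s * S.R s + χ' s * S.ds S.R s| := by positivity
      exact (mul_le_of_le_one_left h7 h5).trans h6
    have t3 : χ s * S.R s * A s ≤ R₁ * A₁ := by
      have h8 : χ s * S.R s ≤ R₁ := (mul_le_of_le_one_left hRpos.le b1).trans hRs.2
      have h9 : 0 ≤ χ s * S.R s := mul_nonneg b0 hRpos.le
      exact (mul_le_mul_of_nonneg_left (hA s hs) h9).trans (mul_le_mul_of_nonneg_right h8 hA₁)
    have t4 : m * r₀ * χ s ≤ χ s * S.R s * (ε ^ 2 * e s + A s * y s) := by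
      have h10 : m * r₀ ≤ (ε ^ 2 * e s + A s * y s) * S.R s :=
        mul_le_mul (hN s hs) hRs.1 hr₀ (hm.trans (hN s hs))
      linarith [mul_le_mul_of_nonneg_right h10 b0]
    have t5 : ε ^ 2 * (χ s * (S.R s * e s + S.R s * Q s / ε ^ 2 * y s)
        - 1 / 2 * (χ'' s * S.R s + χ' s * S.ds S.R s) * y s)
        = χ s * S.R s * (ε ^ 2 * e s + A s * y s) + (χ s * S.R s * Q s
          - ε ^ 2 * (1 / 2 * (χ'' s * S.R s + χ' s * S.ds S.R s)) - χ s * S.R s * A s) * y s := by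
      field_simp
      ring
    change m * r₀ * χ s ≤ ε ^ 2 * (χ s * (S.R s * e s + S.R s * Q s / ε ^ 2 * y s)
        - 1 / 2 * (χ'' s * S.R s + χ' s * S.ds S.R s) * y s) + C * y s
    rw [t5, add_assoc, ← add_mul]
    have t6 : 0 ≤ χ s * S.R s * Q s
        - ε ^ 2 * (1 / 2 * (χ'' s * S.R s + χ' s * S.ds S.R s)) - χ s * S.R s * A s + C := by
      simp only [C]
      linarith
    have := mul_nonneg t6 hy
    linarith)
  rw [intervalIntegral.integral_add (hF.1.const_mul _) (hyi.const_mul _),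
    intervalIntegral.integral_const_mul, intervalIntegral.integral_const_mul,
    intervalIntegral.integral_const_mul, hF.2, mul_zero, zero_add] at hmono
  have hshift : ∫ s in i..(i + l), χ s = ∫ x in 0..l, (x * (l - x)) ^ 2 := by
    have := intervalIntegral.integral_comp_sub_right (a := i) (b := i + l)
      (fun x => (x * (l - x)) ^ 2) i
    simpa using this
  rwa [hshift] at hmono

/-! ### The effective potential and the Agmon distance -/

theorem ordConnected_IL (S : RevSurface) : S.IL.OrdConnected := by
  refine ⟨fun x hx y hy s hs => ⟨⟨hx.1.1.trans hs.1, hs.2.trans hy.1.2⟩, fun hp => ?_⟩⟩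
  rcases S.poles_subset hp with h | h
  · have : x = s := le_antisymm hs.1 (h.le.trans hx.1.1)
    exact hx.2 (this ▸ hp)
  · obtain rfl : s = S.L := h
    have : y = S.L := le_antisymm hy.1.2 hs.2
    exact hy.2 (this ▸ hp)

theorem measurableSet_IL (S : RevSurface) : MeasurableSet S.IL :=
  S.ordConnected_IL.measurableSet

theorem finite_poles (S : RevSurface) : S.poles.Finite := (Set.toFinite {0, S.L}).subset S.poles_subset

theorem IsW2Inf.continuousOn_ds {S : RevSurface} {f : ℝ → ℝ} (hf : S.IsW2Inf f) :
    ContinuousOn (S.ds f) (Icc 0 S.L) := by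
  obtain ⟨_, ⟨K, hK⟩, _⟩ := hf
  exact hK.continuousOn

theorem continuousOn_V {S : RevSurface} {f : ℝ → ℝ} (hf : S.IsW2Inf f) (c : ℝ) :
    ContinuousOn (S.V f c) S.IL := by
  have h1 : ContinuousOn S.R S.IL := S.continuousOn_R.mono sdiff_subset
  have h2 : ContinuousOn (S.ds f) S.IL := hf.continuousOn_ds.mono sdiff_subset
  exact (continuousOn_const.div (h1.pow 2) fun s hs => (pow_pos (S.R_pos s hs) 2).ne').add
    ((h2.pow 2).div_const 4)

/-- `V_c` is infinite at the poles, so compactness is applied to `R² (V_c - V_c(s₀))`, which extends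
continuously to `[0, L]` with the value `c² > 0` at a pole. -/
theorem exists_le_V_sub {S : RevSurface} {f : ℝ → ℝ} (hf : S.IsW2Inf f) {c : ℝ} (hc : 0 < c)
    {s₀ : ℝ} (huniq : ∀ s ∈ S.IL, s ≠ s₀ → S.V f c s₀ < S.V f c s) {r : ℝ} (hr : 0 < r) :
    ∃ κ, 0 < κ ∧ ∀ s ∈ S.IL, r ≤ |s - s₀| → κ ≤ S.V f c s - S.V f c s₀ := by
  set g : ℝ → ℝ := fun s => c ^ 2 + S.R s ^ 2 * (S.ds f s ^ 2 / 4 - S.V f c s₀) with hg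
  have hgc : ContinuousOn g (Icc 0 S.L) := continuousOn_const.add
    ((S.continuousOn_R.pow 2).mul (((hf.continuousOn_ds.pow 2).div_const 4).sub continuousOn_const))
  have hgW : ∀ s ∈ S.IL, g s = S.R s ^ 2 * (S.V f c s - S.V f c s₀) := by
    intro s hs
    have := (S.R_pos s hs).ne'
    simp only [hg, V]
    field_simp
    ring
  have hK : IsCompact (Icc 0 S.L ∩ {s | r ≤ |s - s₀|}) :=
    isCompact_Icc.inter_right (isClosed_le continuous_const (by fun_prop))
  have hpos : ∀ s ∈ Icc 0 S.L ∩ {s | r ≤ |s - s₀|}, 0 < g s := by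
    intro s hs
    by_cases hp : s ∈ S.poles
    · have : g s = c ^ 2 := by simp [hg, S.R_eq_zero_of_mem_poles hp]
      rw [this]
      exact pow_pos hc 2
    · rw [hgW s ⟨hs.1, hp⟩]
      have hne : s ≠ s₀ := by
        rintro rfl
        have := hs.2
        simp only [mem_ofPred_eq, sub_self, abs_zero] at this
        linarith
      exact mul_pos (pow_pos (S.R_pos s ⟨hs.1, hp⟩) 2) (sub_pos.2 (huniq s ⟨hs.1, hp⟩ hne))
  obtain ⟨C, hC⟩ := isCompact_Icc.exists_bound_of_continuousOn S.continuousOn_R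
  have hC1 : 0 < max C 1 := by positivity
  rcases (Icc 0 S.L ∩ {s | r ≤ |s - s₀|}).eq_empty_or_nonempty with he | hne
  · refine ⟨1, one_pos, fun s hs hrs => ?_⟩
    have : s ∈ Icc 0 S.L ∩ {s | r ≤ |s - s₀|} := ⟨hs.1, hrs⟩
    rw [he] at this
    exact this.elim
  · obtain ⟨x, hx, hmin⟩ := hK.exists_isMinOn hne (hgc.mono inter_subset_left)
    refine ⟨g x / max C 1 ^ 2, div_pos (hpos x hx) (by positivity), fun s hs hrs => ?_⟩
    have h1 : g x ≤ g s := hmin ⟨hs.1, hrs⟩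
    have hR := S.R_pos s hs
    have hRC : S.R s ≤ max C 1 := (le_abs_self _).trans ((hC s hs.1).trans (le_max_left _ _))
    have h2 : 0 < g s := hpos s ⟨hs.1, hrs⟩
    rw [hgW s hs] at h1 h2
    have h3 : 0 < S.V f c s - S.V f c s₀ := pos_of_mul_pos_right h2 (sq_nonneg _)
    rw [div_le_iff₀ (by positivity), mul_comm]
    refine h1.trans (mul_le_mul_of_nonneg_right ?_ h3.le)
    exact pow_le_pow_left₀ hR.le hRC 2

/-- The signed Agmon distance. -/
noncomputable def signedDist (S : RevSurface) (f : ℝ → ℝ) (c s₀ s : ℝ) : ℝ :=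
  ∫ y in s₀..s, √(S.V f c y - S.V f c s₀)

theorem continuousOn_sqrt_V_sub {S : RevSurface} {f : ℝ → ℝ} (hf : S.IsW2Inf f) (c s₀ : ℝ) :
    ContinuousOn (fun y => √(S.V f c y - S.V f c s₀)) S.IL :=
  ((continuousOn_V hf c).sub continuousOn_const).sqrt

theorem hasDerivAt_signedDist {S : RevSurface} {f : ℝ → ℝ} (hf : S.IsW2Inf f) {c s₀ s : ℝ}
    (hs₀ : s₀ ∈ S.IL) (hs : s ∈ Ioo 0 S.L) :
    HasDerivAt (S.signedDist f c s₀) √(S.V f c s - S.V f c s₀) s := by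
  have hc := continuousOn_sqrt_V_sub hf c s₀
  have hc' := hc.mono S.Ioo_subset_IL
  exact intervalIntegral.integral_hasDerivAt_right
    ((hc.mono (S.ordConnected_IL.uIcc_subset hs₀ (S.Ioo_subset_IL hs))).intervalIntegrable)
    (ContinuousOn.stronglyMeasurableAtFilter isOpen_Ioo hc' s hs)
    (hc'.continuousAt (Ioo_mem_nhds hs.1 hs.2))

theorem exists_signedDist_lipschitz {S : RevSurface} {f : ℝ → ℝ} (hf : S.IsW2Inf f) {c s₀ : ℝ}
    (hs₀ : s₀ ∈ S.IL) {a b : ℝ} (hab : Icc a b ⊆ S.IL) :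
    ∃ M, 0 < M ∧ ∀ s ∈ Icc a b, ∀ s' ∈ Icc a b,
      |S.signedDist f c s₀ s - S.signedDist f c s₀ s'| ≤ M * |s - s'| := by
  have hc := continuousOn_sqrt_V_sub hf c s₀
  obtain ⟨M, hM⟩ := isCompact_Icc.exists_bound_of_continuousOn (hc.mono hab)
  refine ⟨max M 1, by positivity, fun s hs s' hs' => ?_⟩
  have hi : ∀ x ∈ Icc a b, IntervalIntegrable (fun y => √(S.V f c y - S.V f c s₀)) volume s₀ x :=
    fun x hx => (hc.mono (S.ordConnected_IL.uIcc_subset hs₀ (hab hx))).intervalIntegrable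
  rw [signedDist, signedDist, intervalIntegral.integral_interval_sub_left (hi s hs) (hi s' hs')]
  refine intervalIntegral.norm_integral_le_of_norm_le_const
    (f := fun y => √(S.V f c y - S.V f c s₀)) fun x hx => ?_
  exact (hM x (ordConnected_Icc.uIcc_subset hs' hs (uIoc_subset_uIcc hx))).trans (le_max_left _ _)

/-- At a pole `f'` is Lipschitz and zero while `|R'| = 1`, so `R ≥ |s - p| / 2` nearby and the
quotient stays bounded; elsewhere it is continuous. This makes `Δf` bounded. -/
theorem exists_ds_div_R_bound {S : RevSurface} {f : ℝ → ℝ} (hf : S.IsW2Inf f) :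
    ∃ C, ∀ s ∈ Ioo 0 S.L, |S.ds f s / S.R s| ≤ C := by
  have hloc : ∀ p ∈ Icc 0 S.L, ∃ t ∈ 𝓝[Icc 0 S.L] p, ∃ C, ∀ s ∈ t ∩ Ioo 0 S.L,
      |S.ds f s / S.R s| ≤ C := by
    intro p hp
    by_cases hpole : p ∈ S.poles
    · have hR0 := S.R_eq_zero_of_mem_poles hpole
      obtain ⟨_, ⟨K, hK⟩, hzero⟩ := hf
      have hd : HasDerivWithinAt S.R (S.ds S.R p) (Icc 0 S.L) p :=
        (S.R_smooth.differentiableOn (by simp) p hp).hasDerivWithinAt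
      have h1 : |S.ds S.R p| = 1 := by
        rcases S.poles_subset hpole with h | h
        · subst h; rw [ds, (S.R_north hpole).1, abs_one]
        · obtain rfl : p = S.L := h
          rw [ds, (S.R_south hpole).1, abs_neg, abs_one]
      have h2 := (hasDerivWithinAt_iff_isLittleO.1 hd).def (show (0 : ℝ) < 1 / 2 by norm_num)
      refine ⟨_, h2, 2 * K, fun s hs => ?_⟩
      have h3 := hs.1
      have hR := S.R_pos_of_mem hs.2
      simp only [mem_ofPred_eq, hR0, sub_zero, Real.norm_eq_abs, smul_eq_mul] at h3
      have h4 : |s - p| - |S.R s| ≤ |S.R s - (s - p) * S.ds S.R p| := by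
        have := abs_sub_abs_le_abs_sub ((s - p) * S.ds S.R p) (S.R s)
        rw [abs_mul, h1, mul_one, abs_sub_comm ((s - p) * _)] at this
        exact this
      rw [abs_of_pos hR] at h4
      have h5 := hK.dist_le_mul s (Ioo_subset_Icc_self hs.2) p hp
      rw [hzero p hpole, Real.dist_eq, Real.dist_eq, sub_zero] at h5
      rw [abs_div, abs_of_pos hR, div_le_iff₀ hR]
      have h6 : |s - p| ≤ 2 * S.R s := by linarith
      calc |S.ds f s| ≤ K * |s - p| := h5
        _ ≤ K * (2 * S.R s) := mul_le_mul_of_nonneg_left h6 K.2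
        _ = 2 * K * S.R s := by ring
    · have hc : ContinuousWithinAt (fun s => |S.ds f s / S.R s|) (Icc 0 S.L) p :=
        ((hf.continuousOn_ds p hp).div (S.continuousOn_R p hp) (S.R_pos p ⟨hp, hpole⟩).ne').abs
      refine ⟨_, hc.eventually_lt continuousWithinAt_const (lt_add_one _),
        |S.ds f p / S.R p| + 1, fun s hs => le_of_lt hs.1⟩
  have := isCompact_Icc.induction_on (s := Icc 0 S.L)
    (p := fun t => ∃ C, ∀ s ∈ t ∩ Ioo 0 S.L, |S.ds f s / S.R s| ≤ C) ⟨0, by simp⟩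
    (fun t t' htt' ⟨C, hC⟩ => ⟨C, fun s hs => hC s ⟨htt' hs.1, hs.2⟩⟩)
    (fun t t' ⟨C, hC⟩ ⟨C', hC'⟩ => ⟨max C C', fun s hs => by
      rcases hs.1 with h | h
      · exact (hC s ⟨h, hs.2⟩).trans (le_max_left _ _)
      · exact (hC' s ⟨h, hs.2⟩).trans (le_max_right _ _)⟩) hloc
  obtain ⟨C, hC⟩ := this
  exact ⟨C, fun s hs => hC s ⟨Ioo_subset_Icc_self hs, hs⟩⟩

theorem exists_lower_order_bound {S : RevSurface} {f q : ℝ → ℝ} (hf : S.IsW2Inf f)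
    (hq : MemLp q ∞ (volume.restrict (Ioo 0 S.L))) :
    ∃ C, ∀ᵐ s, s ∈ Ioo 0 S.L → |S.lapRadial f s / 2 - q s| ≤ C := by
  obtain ⟨C₁, hC₁⟩ := exists_ds_div_R_bound hf
  obtain ⟨C₂, hC₂⟩ := isCompact_Icc.exists_bound_of_continuousOn S.continuousOn_ds_R
  obtain ⟨_, ⟨K, hK⟩, _⟩ := hf
  have h1 : ∀ᵐ s, s ∈ Ioo 0 S.L → ‖q s‖ₑ ≤ eLpNorm q ∞ (volume.restrict (Ioo 0 S.L)) := by
    rw [← ae_restrict_iff' measurableSet_Ioo, eLpNorm_exponent_top]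
    exact ae_le_eLpNormEssSup
  refine ⟨(K + C₂ * C₁) / 2 + (eLpNorm q ∞ (volume.restrict (Ioo 0 S.L))).toReal, ?_⟩
  filter_upwards [h1] with s h2 hs
  have h3 : |q s| ≤ (eLpNorm q ∞ (volume.restrict (Ioo 0 S.L))).toReal := by
    have := ENNReal.toReal_mono hq.2.ne (h2 hs)
    rwa [toReal_enorm] at this
  have h4 : |deriv (S.ds f) s| ≤ K :=
    norm_deriv_le_of_lipschitzOn (Icc_mem_nhds hs.1 hs.2) hK
  have h5 : |S.ds S.R s / S.R s * S.ds f s| ≤ C₂ * C₁ := by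
    rw [div_mul_eq_mul_div, mul_div_assoc, abs_mul]
    exact mul_le_mul (hC₂ s (Ioo_subset_Icc_self hs)) (hC₁ s hs) (abs_nonneg _)
      ((norm_nonneg _).trans (hC₂ s (Ioo_subset_Icc_self hs)))
  have h6 : |S.lapRadial f s| ≤ K + C₂ * C₁ := (abs_add_le _ _).trans (add_le_add h4 h5)
  refine (abs_sub _ _).trans (add_le_add ?_ h3)
  rw [abs_div, abs_two]
  linarith

/-! ### Norms of equivariant functions -/

theorem normL2_eq (S : RevSurface) {ψ : ℝ × ℝ → ℂ} {y : ℝ → ℝ} (hψ : MemLp ψ 2 S.vol)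
    (hy : ∀ᵐ s, s ∈ Ioo 0 S.L → ∀ θ, y s = ‖ψ (s, θ)‖ ^ 2) {J : Set ℝ} (hJ : MeasurableSet J) :
    S.normL2 J ψ = √(2 * Real.pi * ∫ s in Ioo 0 S.L ∩ J, S.R s * y s) := by
  have hsf := S.sfinite_radialMeasure
  have hrestr : S.vol.restrict (ring J)
      = (S.radialMeasure.restrict J).prod (volume.restrict (Ioc 0 (2 * Real.pi))) := by
    rw [S.vol_eq_prod, ring, ← Measure.prod_restrict, Measure.restrict_univ]
  have hm : MemLp ψ 2 (S.vol.restrict (ring J)) := hψ.restrict _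
  have hint : ∫ p, ‖ψ p‖ ^ 2 ∂S.vol.restrict (ring J)
      = 2 * Real.pi * ∫ s in Ioo 0 S.L ∩ J, S.R s * y s := by
    have h1 : ∀ᵐ p ∂S.vol.restrict (ring J), ‖ψ p‖ ^ 2 = y p.1 := by
      rw [hrestr]
      have h2 : ∀ᵐ s ∂S.radialMeasure.restrict J, ∀ θ, y s = ‖ψ (s, θ)‖ ^ 2 :=
        ae_restrict_of_ae (S.ae_radialMeasure_iff.2 hy)
      filter_upwards [Measure.quasiMeasurePreserving_fst.ae h2] with p hp using (hp p.2).symm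
    rw [integral_congr_ae h1, hrestr, integral_fun_fst, measureReal_restrict_apply_univ,
      Real.volume_real_Ioc_of_le (by positivity), sub_zero, smul_eq_mul]
    congr 1
    rw [radialMeasure, restrict_withDensity hJ, Measure.restrict_restrict hJ, inter_comm,
      integral_withDensity_eq_integral_toReal_smul₀
        (S.aemeasurable_R.ennreal_ofReal.mono_measure (Measure.restrict_mono inter_subset_left le_rfl))
        (Eventually.of_forall fun _ => ENNReal.ofReal_lt_top)]
    refine setIntegral_congr_fun (measurableSet_Ioo.inter hJ) fun s hs => ?_
    simp [ENNReal.toReal_ofReal (S.R_pos_of_mem hs.1).le]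
  rw [normL2, hm.eLpNorm_eq_integral_rpow_norm two_ne_zero ENNReal.ofNat_ne_top,
    ENNReal.toReal_ofReal (by positivity), Real.sqrt_eq_rpow, ← hint]
  simp

/-- The radial data of a normalized equivariant eigenfunction. -/
structure NormalizedRadial (S : RevSurface) (W : ℝ → ℝ) (ε τ : ℝ) (ψ : ℝ × ℝ → ℂ)
    (Q y z e : ℝ → ℝ) : Prop where
  energy : S.RadialEnergy ε Q y z e
  potential : ∀ᵐ s, s ∈ Ioo 0 S.L → |Q s - W s| ≤ τ
  int_mul : IntegrableOn (fun s => S.R s * y s) (Ioo 0 S.L)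
  int_div : IntegrableOn (fun s => y s / S.R s) (Ioo 0 S.L)
  bdry : ∀ s₀ ∈ S.bdry, Tendsto y (𝓝[Ioo 0 S.L] s₀) (𝓝 0)
  mass : ∫ s in Ioo 0 S.L, S.R s * y s = (2 * Real.pi)⁻¹
  norm : ∀ J, MeasurableSet J →
    S.normL2 J ψ = √(2 * Real.pi * ∫ s in Ioo 0 S.L ∩ J, S.R s * y s)

theorem exists_normalizedRadial (S : RevSurface) {f q : ℝ → ℝ} (hf : S.IsW2Inf f)
    (hq : MemLp q ∞ (volume.restrict (Ioo 0 S.L))) {c : ℝ} (hc : 0 < c) {smin : ℝ}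
    {μ : ℕ → ℝ} (hμ : Tendsto μ atTop (𝓝 (S.V f c smin)))
    {φ : ℕ → ℝ → ℂ} {ψ : ℕ → ℝ × ℝ → ℂ}
    (hψ : ∀ (k : ℕ) (s θ : ℝ), ψ k (s, θ) = Complex.exp (Complex.I * k * θ) * φ k s)
    (heig : ∀ᶠ k : ℕ in atTop, S.SolvesEigen f q (c / k) (μ k) (ψ k))
    (hnorm : ∀ᶠ k : ℕ in atTop, S.normL2 univ (ψ k) = 1) :
    ∃ τ : ℕ → ℝ, Tendsto τ atTop (𝓝 0) ∧ ∀ᶠ k : ℕ in atTop, ∃ Q y z e : ℝ → ℝ,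
      S.NormalizedRadial (fun s => S.V f c s - S.V f c smin) (c / k) (τ k) (ψ k) Q y z e := by
  obtain ⟨C, hC⟩ := exists_lower_order_bound hf hq
  -- The energy shift plus `ε_k` times the bound for `Δf / 2 - q`.
  refine ⟨fun k => |S.V f c smin - μ k| + c / k * |C|, ?_, ?_⟩
  · have h1 : Tendsto (fun k : ℕ => c / (k : ℝ)) atTop (𝓝 0) := tendsto_const_div_atTop_nhds_zero_nat c
    have h2 := ((tendsto_const_nhds (x := S.V f c smin)).sub hμ).abs
    simpa using h2.add (h1.mul_const |C|)
  filter_upwards [heig, hnorm, eventually_ge_atTop 1] with k h1 h2 hk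
  have hk0 : (0 : ℝ) < k := by exact_mod_cast hk
  have hε : 0 < c / k := div_pos hc hk0
  obtain ⟨y, z, e, hE, hy, hRy, hyR, hbd⟩ := S.exists_radialEnergy_of_solvesEigen
    (c := c) (k := k) (by omega) hε.ne' (div_mul_cancel₀ c hk0.ne') (hψ k) h1
  have hmem : MemLp (ψ k) 2 S.vol := by
    obtain ⟨⟨us, ut, uss, ust, utt, hH, _⟩, _⟩ := h1
    exact hH.mem
  have hy' : ∀ᵐ s, s ∈ Ioo 0 S.L → ∀ θ, y s = ‖ψ k (s, θ)‖ ^ 2 := by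
    filter_upwards [hy] with s h3 hs θ
    rw [h3 hs, hψ, norm_mul, norm_exp_I_mul, one_mul]
  have hN := fun J (hJ : MeasurableSet J) => S.normL2_eq hmem hy' hJ
  refine ⟨_, y, z, e, hE, ?_, hRy, hyR, hbd, ?_, hN⟩
  · filter_upwards [hC] with s h3 hs
    have h4 : S.radialPotential f q c (c / k) (μ k) s - (S.V f c s - S.V f c smin)
        = (S.V f c smin - μ k) + c / k * (S.lapRadial f s / 2 - q s) := by
      simp only [radialPotential]; ring
    rw [h4]
    refine (abs_add_le _ _).trans (add_le_add le_rfl ?_)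
    rw [abs_mul, abs_of_pos hε]
    exact mul_le_mul_of_nonneg_left ((h3 hs).trans (le_abs_self C)) hε.le
  · have h5 := hN univ MeasurableSet.univ
    rw [h2, inter_univ] at h5
    have h6 := Real.sqrt_eq_one.1 h5.symm
    exact eq_inv_of_mul_eq_one_right h6

/-- The weighted estimates hold on compact subintervals only; exhaustion by these yields the bound
on `(0, L)`. -/
theorem integral_Ioo_le_of_forall_Icc {L B : ℝ} (hL : 0 < L) {g : ℝ → ℝ}
    (hg : IntegrableOn g (Ioo 0 L))
    (h : ∀ α ∈ Ioo 0 L, ∀ β ∈ Ioo 0 L, ∫ s in Icc α β, g s ≤ B) : ∫ s in Ioo 0 L, g s ≤ B := by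
  have h0 : Tendsto (fun n : ℕ => L / ((n : ℝ) + 3)) atTop (𝓝 0) :=
    tendsto_const_nhds.div_atTop
      (tendsto_atTop_add_const_right _ _ tendsto_natCast_atTop_atTop)
  have h1 : Tendsto (fun n : ℕ => L - L / ((n : ℝ) + 3)) atTop (𝓝 L) := by
    simpa using (tendsto_const_nhds (x := L)).sub h0
  have hcov := aecover_Ioo_of_Icc (μ := volume) h0 h1
  refine le_of_tendsto (hcov.integral_tendsto_of_countably_generated hg)
    (Eventually.of_forall fun n => ?_)
  have hn : (0 : ℝ) ≤ n := n.cast_nonneg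
  have h2 : L / ((n : ℝ) + 3) < L := by
    rw [div_lt_iff₀ (by positivity)]; nlinarith
  have h3 : 0 < L / ((n : ℝ) + 3) := by positivity
  have hsub : Icc (L / ((n : ℝ) + 3)) (L - L / ((n : ℝ) + 3)) ⊆ Ioo 0 L :=
    Icc_subset_Ioo h3 (by linarith)
  rw [Measure.restrict_restrict_of_subset hsub]
  exact h _ ⟨h3, h2⟩ _ ⟨by linarith, by linarith⟩

/-! ### The Agmon upper bound -/

theorem V_sub_nonneg {S : RevSurface} {f : ℝ → ℝ} {c s₀ : ℝ}
    (huniq : ∀ s ∈ S.IL, s ≠ s₀ → S.V f c s₀ < S.V f c s) {s : ℝ} (hs : s ∈ S.IL) :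
    0 ≤ S.V f c s - S.V f c s₀ := by
  rcases eq_or_ne s s₀ with rfl | h
  · rw [sub_self]
  · exact (sub_pos.2 (huniq s hs h)).le

theorem cosh_le_exp_abs (x : ℝ) : Real.cosh x ≤ Real.exp |x| := by
  rw [Real.cosh_eq]
  have h1 := Real.exp_le_exp.2 (le_abs_self x)
  have h2 := Real.exp_le_exp.2 (neg_le_abs x)
  linarith

theorem exp_abs_le_two_mul_cosh (x : ℝ) : Real.exp |x| ≤ 2 * Real.cosh x := by
  rw [Real.cosh_eq]
  rcases abs_choice x with h | h <;> rw [h] <;> linarith [Real.exp_pos x, Real.exp_pos (-x)]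

/-- Close to a point of `I_L`, the interval `I_L` contains a compact interval. -/
theorem exists_nhds_subset_Icc (S : RevSurface) {s₀ : ℝ} (hs₀ : s₀ ∈ S.IL) {η : ℝ} (hη : 0 < η) :
    ∃ a b r, a < b ∧ 0 ≤ a ∧ b ≤ S.L ∧ 0 < r ∧ Icc a b ⊆ S.IL ∧ s₀ ∈ Icc a b ∧
      (∀ s ∈ Ioo 0 S.L, |s - s₀| < r → s ∈ Ioo a b) ∧
      ∀ s ∈ S.IL, (∀ p ∈ S.poles, η < |s - p|) → s ∈ Icc a b := by
  have hL := S.L_pos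
  -- An end that is a pole is cut off by a positive margin; an end that is a boundary circle is
  -- kept, since `s₀` may lie on it. The bounds `L / 4` and `3 L / 4` ensure `a < b`.
  have hleft : ∃ a r, 0 ≤ a ∧ a ≤ S.L / 4 ∧ 0 < r ∧ a ≤ s₀ ∧ (0 ∈ S.poles → 0 < a) ∧
      (∀ s ∈ Ioo 0 S.L, |s - s₀| < r → a < s) ∧
      ∀ s ∈ S.IL, (∀ p ∈ S.poles, η < |s - p|) → a ≤ s := by
    by_cases hp : (0 : ℝ) ∈ S.poles
    · have h0 : 0 < s₀ := lt_of_le_of_ne hs₀.1.1 fun h => hs₀.2 (h ▸ hp)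
      refine ⟨min (min η (s₀ / 2)) (S.L / 4), s₀ / 2, by positivity, min_le_right _ _,
        by positivity, ((min_le_left _ _).trans (min_le_right _ _)).trans (by linarith),
        fun _ => by positivity, fun s hs h => ?_, fun s hs h => ?_⟩
      · have := (abs_lt.1 h).1
        exact ((min_le_left _ _).trans (min_le_right _ _)).trans_lt (by linarith)
      · have := h 0 hp
        rw [sub_zero, abs_of_nonneg hs.1.1] at this
        exact ((min_le_left _ _).trans (min_le_left _ _)).trans this.le
    · exact ⟨0, 1, le_rfl, by positivity, one_pos, hs₀.1.1, fun h => absurd h hp,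
        fun s hs _ => hs.1, fun s hs _ => hs.1.1⟩
  have hright : ∃ b r, b ≤ S.L ∧ 3 * S.L / 4 ≤ b ∧ 0 < r ∧ s₀ ≤ b ∧ (S.L ∈ S.poles → b < S.L) ∧
      (∀ s ∈ Ioo 0 S.L, |s - s₀| < r → s < b) ∧
      ∀ s ∈ S.IL, (∀ p ∈ S.poles, η < |s - p|) → s ≤ b := by
    by_cases hp : S.L ∈ S.poles
    · have h0 : s₀ < S.L := lt_of_le_of_ne hs₀.1.2 fun h => hs₀.2 (h ▸ hp)
      have hm : 0 < min (min η ((S.L - s₀) / 2)) (S.L / 4) :=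
        lt_min (lt_min hη (by linarith)) (by linarith)
      have h1 : min (min η ((S.L - s₀) / 2)) (S.L / 4) ≤ S.L / 4 := min_le_right _ _
      have h2 : min (min η ((S.L - s₀) / 2)) (S.L / 4) ≤ (S.L - s₀) / 2 :=
        (min_le_left _ _).trans (min_le_right _ _)
      have h3 : min (min η ((S.L - s₀) / 2)) (S.L / 4) ≤ η :=
        (min_le_left _ _).trans (min_le_left _ _)
      refine ⟨S.L - min (min η ((S.L - s₀) / 2)) (S.L / 4), (S.L - s₀) / 2, by linarith,
        by linarith, by linarith, by linarith,
        fun _ => by linarith, fun s hs h => ?_, fun s hs h => ?_⟩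
      · have := (abs_lt.1 h).2
        linarith
      · have := h S.L hp
        rw [abs_sub_comm, abs_of_nonneg (by linarith [hs.1.2])] at this
        linarith
    · exact ⟨S.L, 1, le_rfl, by linarith, one_pos, hs₀.1.2, fun h => absurd h hp,
        fun s hs _ => hs.2, fun s hs _ => hs.1.2⟩
  obtain ⟨a, r, ha0, haL, hr, has, hap, har, haη⟩ := hleft
  obtain ⟨b, r', hbL, hLb, hr', hbs, hbp, hbr, hbη⟩ := hright
  refine ⟨a, b, min r r', by linarith, ha0, hbL, lt_min hr hr', fun s hs => ?_, ⟨has, hbs⟩,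
    fun s hs h => ⟨har s hs (h.trans_le (min_le_left _ _)), hbr s hs (h.trans_le (min_le_right _ _))⟩,
    fun s hs h => ⟨haη s hs h, hbη s hs h⟩⟩
  refine ⟨⟨ha0.trans hs.1, hs.2.trans hbL⟩, fun hp => ?_⟩
  rcases S.poles_subset hp with h | h
  · have := hap (h ▸ hp)
    have h0 : s = 0 := h
    linarith [hs.1]
  · obtain rfl : s = S.L := h
    linarith [hbp hp, hs.2]

theorem dASet_le (S : RevSurface) (f : ℝ → ℝ) (c s₀ : ℝ) {J : Set ℝ} {s : ℝ} (hs : s ∈ J) :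
    S.dASet f c s₀ J ≤ S.dA f c s₀ s :=
  csInf_le ⟨0, by rintro _ ⟨x, _, rfl⟩; exact abs_nonneg _⟩ (mem_image_of_mem _ hs)

theorem dASet_nonneg (S : RevSurface) (f : ℝ → ℝ) (c s₀ : ℝ) (J : Set ℝ) :
    0 ≤ S.dASet f c s₀ J :=
  Real.sInf_nonneg (by rintro _ ⟨x, _, rfl⟩; exact abs_nonneg _)

theorem NormalizedRadial.mul_nonneg {S : RevSurface} {W : ℝ → ℝ} {ε τ : ℝ} {ψ : ℝ × ℝ → ℂ}
    {Q y z e : ℝ → ℝ} (h : S.NormalizedRadial W ε τ ψ Q y z e) {s : ℝ} (hs : s ∈ Ioo 0 S.L) :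
    0 ≤ S.R s * y s := _root_.mul_nonneg (S.R_pos_of_mem hs).le (h.energy.y_nonneg s hs)

theorem NormalizedRadial.setIntegral_le_mass {S : RevSurface} {W : ℝ → ℝ} {ε τ : ℝ}
    {ψ : ℝ × ℝ → ℂ} {Q y z e : ℝ → ℝ} (h : S.NormalizedRadial W ε τ ψ Q y z e) (B : Set ℝ) :
    ∫ s in Ioo 0 S.L ∩ B, S.R s * y s ≤ (2 * Real.pi)⁻¹ := by
  rw [← h.mass]
  refine setIntegral_mono_set h.int_mul ?_ inter_subset_left.eventuallyLE
  rw [EventuallyLE, ae_restrict_iff' measurableSet_Ioo]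
  exact Eventually.of_forall fun s hs => h.mul_nonneg hs

theorem agmon_upper_bound {S : RevSurface} {f : ℝ → ℝ} (hf : S.IsW2Inf f) {c : ℝ} (hc : 0 < c)
    {smin : ℝ} (hsmin : smin ∈ S.IL)
    (huniq : ∀ s ∈ S.IL, s ≠ smin → S.V f c smin < S.V f c s) {ψ : ℕ → ℝ × ℝ → ℂ}
    {τ : ℕ → ℝ} (hτ : Tendsto τ atTop (𝓝 0))
    (H : ∀ᶠ k : ℕ in atTop, ∃ Q y z e : ℝ → ℝ,
      S.NormalizedRadial (fun s => S.V f c s - S.V f c smin) (c / k) (τ k) (ψ k) Q y z e)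
    {δ : ℝ} (hδ : 0 < δ) (hδ1 : δ < 1) :
    ∃ k₀ : ℕ, ∃ C > 0, ∀ k ≥ k₀, ∀ J : Set ℝ, MeasurableSet J → J.Nonempty → J ⊆ S.IL →
      S.normL2 J (ψ k)
        ≤ C * Real.exp (-(1 / (c / k)) * ((1 - δ) * S.dASet f c smin J - δ)) := by
  obtain ⟨a, b, r₁, hab, ha0, hbL, hr₁, habI, hsm, hball, _⟩ := S.exists_nhds_subset_Icc hsmin one_pos
  obtain ⟨M, hM, hlip⟩ := exists_signedDist_lipschitz hf (c := c) hsmin habI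
  -- Small enough that `|D| ≤ δ` on the ball, so the weight there is at most `exp(2 δ / ε)`.
  set r := min r₁ (δ / M) with hr
  have hr0 : 0 < r := lt_min hr₁ (by positivity)
  have hD0 : S.signedDist f c smin smin = 0 := by simp [signedDist]
  have hDB : ∀ s ∈ Ioo 0 S.L, s ∈ Metric.ball smin r → |S.signedDist f c smin s| ≤ δ := by
    intro s hs hsB
    rw [Metric.mem_ball, Real.dist_eq] at hsB
    have h1 := hlip s (Ioo_subset_Icc_self (hball s hs (hsB.trans_le (min_le_left _ _)))) smin hsm
    rw [hD0, sub_zero] at h1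
    refine h1.trans ?_
    have h2 : |s - smin| ≤ δ / M := hsB.le.trans (min_le_right _ _)
    calc M * |s - smin| ≤ M * (δ / M) := mul_le_mul_of_nonneg_left h2 hM.le
      _ = δ := mul_div_cancel₀ δ hM.ne'
  obtain ⟨κ, hκ, hκW⟩ := exists_le_V_sub hf hc huniq hr0
  set t := 1 - δ with ht
  have ht0 : 0 < t := by linarith
  have ht1 : t < 1 := by linarith
  have h1t : 0 < 1 - t ^ 2 := by nlinarith
  set κ' := (1 - t ^ 2) * κ / 2 with hκ'
  have hκ'0 : 0 < κ' := by positivity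
  have hev : ∀ᶠ k : ℕ in atTop, τ k ≤ κ' := by
    filter_upwards [hτ.eventually_lt_const hκ'0] with k hk using hk.le
  obtain ⟨k₀, hk₀⟩ := eventually_atTop.1 (H.and (hev.and (eventually_ge_atTop 1)))
  -- The squared norm picks up one factor `2` from `exp |x| ≤ 2 cosh x` and one from
  -- `weighted_mass_le`; the square root of `4` is the constant.
  refine ⟨k₀, 2, two_pos, fun k hk J hJ hJne hJI => ?_⟩
  obtain ⟨⟨Q, y, z, e, hN⟩, hτk, hk1⟩ := hk₀ k hk
  have hkpos : (0 : ℝ) < k := by exact_mod_cast hk1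
  set ε := c / (k : ℝ) with hε
  have hε0 : 0 < ε := div_pos hc hkpos
  set D := S.signedDist f c smin with hD
  set d := S.dASet f c smin J with hd
  have hbound : ∀ α ∈ Ioo 0 S.L, ∀ β ∈ Ioo 0 S.L,
      ∫ s in Icc α β, Real.cosh (2 * t / ε * D s) * (S.R s * y s)
        ≤ 2 * Real.exp (2 / ε * δ) * (2 * Real.pi)⁻¹ := by
    intro α hα β hβ
    refine (hN.energy.weighted_mass_le hε0 hN.int_mul hN.int_div hN.bdry
      (fun s hs => V_sub_nonneg huniq (S.Ioo_subset_IL hs))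
      (((continuousOn_V hf c).mono S.Ioo_subset_IL).sub continuousOn_const)
      (fun s hs => hasDerivAt_signedDist hf hsmin hs) ht0.le ht1.le hN.potential hκ'0 hτk
      Metric.isOpen_ball.measurableSet (B := Metric.ball smin r) (fun s hs hsB => ?_)
      (M := Real.exp (2 / ε * δ)) (fun s hs hsB => ?_) hα hβ).trans ?_
    · rw [Metric.mem_ball, Real.dist_eq, not_lt] at hsB
      have := hκW s (S.Ioo_subset_IL hs) hsB
      have := mul_le_mul_of_nonneg_left this h1t.le
      simp only [hκ']
      linarith
    · refine (cosh_le_exp_abs _).trans (Real.exp_le_exp.2 ?_)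
      rw [abs_mul, abs_of_nonneg (by positivity)]
      refine mul_le_mul ?_ (hDB s hs hsB) (abs_nonneg _) (by positivity)
      gcongr
      linarith
    · exact mul_le_mul_of_nonneg_left (hN.setIntegral_le_mass _) (by positivity)
  have hJint : ∫ s in Ioo 0 S.L ∩ J, S.R s * y s
      ≤ 2 * Real.exp (-(2 / ε * (t * d))) * (2 * Real.exp (2 / ε * δ) * (2 * Real.pi)⁻¹) := by
    rw [← setIntegral_indicator hJ]
    refine integral_Ioo_le_of_forall_Icc S.L_pos (hN.int_mul.indicator hJ) fun α hα β hβ => ?_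
    have hsub : Icc α β ⊆ Ioo 0 S.L := Icc_subset_Ioo hα.1 hβ.2
    refine le_trans ?_ (mul_le_mul_of_nonneg_left (hbound α hα β hβ) (by positivity))
    rw [← integral_const_mul]
    have hDc : ContinuousOn D (Icc α β) := fun s hs =>
      (hasDerivAt_signedDist hf hsmin (hsub hs)).continuousAt.continuousWithinAt
    have hcont : ContinuousOn (fun s => Real.cosh (2 * t / ε * D s) * (S.R s * y s)) (Icc α β) :=
      (Real.continuous_cosh.comp_continuousOn (continuousOn_const.mul hDc)).mul
        ((S.continuousOn_R.mono (hsub.trans Ioo_subset_Icc_self)).mul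
          (hN.energy.continuousOn_y.mono hsub))
    refine setIntegral_mono_on ((hN.int_mul.indicator hJ).mono_set hsub)
      (hcont.integrableOn_Icc.const_mul _) measurableSet_Icc fun s hs => ?_
    have hRy := hN.mul_nonneg (hsub hs)
    by_cases hsJ : s ∈ J
    · rw [indicator_of_mem hsJ, ← mul_assoc]
      refine le_mul_of_one_le_left hRy ?_
      have h1 : d ≤ |D s| := S.dASet_le f c smin hsJ
      have h2 := exp_abs_le_two_mul_cosh (2 * t / ε * D s)
      rw [abs_mul, abs_of_nonneg (show 0 ≤ 2 * t / ε by positivity)] at h2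
      have h3 : Real.exp (2 / ε * (t * d)) ≤ 2 * Real.cosh (2 * t / ε * D s) := by
        refine le_trans (Real.exp_le_exp.2 ?_) h2
        calc 2 / ε * (t * d) = 2 * t / ε * d := by ring
          _ ≤ 2 * t / ε * |D s| := by gcongr
      rw [Real.exp_neg, mul_right_comm, ← div_eq_mul_inv, le_div_iff₀ (Real.exp_pos _), one_mul]
      exact h3
    · rw [indicator_of_notMem hsJ]
      have := Real.cosh_pos (2 * t / ε * D s)
      positivity
  rw [hN.norm J hJ]
  refine Real.sqrt_le_iff.2 ⟨by positivity, ?_⟩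
  have h2π : 0 < 2 * Real.pi := by positivity
  refine (mul_le_mul_of_nonneg_left hJint h2π.le).trans (le_of_eq ?_)
  have hexp : Real.exp (-(1 / ε) * (t * d - δ)) ^ 2
      = Real.exp (-(2 / ε * (t * d))) * Real.exp (2 / ε * δ) := by
    rw [← Real.exp_add, ← Real.exp_nat_mul]
    congr 1
    push_cast
    ring
  rw [mul_pow, hexp]
  field_simp

/-- The mass of the eigenfunctions concentrates at the minimum of the effective potential. -/
theorem exists_point_with_mass {S : RevSurface} {f : ℝ → ℝ} (hf : S.IsW2Inf f) {c : ℝ} (hc : 0 < c)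
    {smin : ℝ} (hsmin : smin ∈ S.IL)
    (huniq : ∀ s ∈ S.IL, s ≠ smin → S.V f c smin < S.V f c s) {r : ℝ} (hr : 0 < r) :
    ∃ κ, 0 < κ ∧ ∀ {ε τ : ℝ} {ψ : ℝ × ℝ → ℂ} {Q y z e : ℝ → ℝ}, 0 < ε → τ ≤ κ →
      S.NormalizedRadial (fun s => S.V f c s - S.V f c smin) ε τ ψ Q y z e →
      ∃ s ∈ Ioo 0 S.L, |s - smin| < r ∧ 1 / (16 * Real.pi * r) ≤ S.R s * y s := by
  obtain ⟨κ, hκ, hκW⟩ := exists_le_V_sub hf hc huniq hr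
  refine ⟨κ / 2, by positivity, fun {ε τ ψ Q y z e} hε hτ hN => ?_⟩
  have hbound : ∀ α ∈ Ioo 0 S.L, ∀ β ∈ Ioo 0 S.L, ∫ s in Icc α β, S.R s * y s
      ≤ 2 * ∫ s in Ioo 0 S.L ∩ Metric.ball smin r, S.R s * y s := by
    intro α hα β hβ
    have := hN.energy.weighted_mass_le hε hN.int_mul hN.int_div hN.bdry
      (fun s hs => V_sub_nonneg huniq (S.Ioo_subset_IL hs))
      (((continuousOn_V hf c).mono S.Ioo_subset_IL).sub continuousOn_const)
      (fun s hs => hasDerivAt_signedDist hf hsmin hs) (t := 0) le_rfl zero_le_one hN.potential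
      (κ := κ / 2) (by positivity) hτ
      Metric.isOpen_ball.measurableSet (B := Metric.ball smin r) (fun s hs hsB => by
        rw [Metric.mem_ball, Real.dist_eq, not_lt] at hsB
        have := hκW s (S.Ioo_subset_IL hs) hsB
        linarith)
      (M := 1) (fun s hs hsB => by simp) hα hβ
    simpa using this
  have hle := integral_Ioo_le_of_forall_Icc S.L_pos hN.int_mul hbound
  rw [hN.mass] at hle
  -- At least half of the total `1 / (2 π)` lies in the ball, but a density below `1 / (16 π r)` on
  -- a set of length at most `2 r` carries at most `1 / (8 π)`.
  by_contra! hcon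
  have hmeas : MeasurableSet (Ioo 0 S.L ∩ Metric.ball smin r) :=
    measurableSet_Ioo.inter Metric.isOpen_ball.measurableSet
  have hvol : volume (Ioo 0 S.L ∩ Metric.ball smin r) ≤ ENNReal.ofReal (2 * r) := by
    refine (measure_mono inter_subset_right).trans ?_
    rw [Real.volume_ball]
  have hupper : ∫ s in Ioo 0 S.L ∩ Metric.ball smin r, S.R s * y s
      ≤ 1 / (16 * Real.pi * r) * (2 * r) := by
    have h1 := norm_setIntegral_le_of_norm_le_const (μ := volume)
      (f := fun s => S.R s * y s) (s := Ioo 0 S.L ∩ Metric.ball smin r)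
      (C := 1 / (16 * Real.pi * r)) (hvol.trans_lt ENNReal.ofReal_lt_top) (fun s hs => by
        rw [Real.norm_of_nonneg (hN.mul_nonneg hs.1)]
        exact (hcon s hs.1 (by simpa [Real.dist_eq] using hs.2)).le)
    refine (le_abs_self _).trans (h1.trans ?_)
    refine mul_le_mul_of_nonneg_left ?_ (by positivity)
    exact ENNReal.toReal_le_of_le_ofReal (by positivity) hvol
  have h3 : 1 / (16 * Real.pi * r) * (2 * r) = (8 * Real.pi)⁻¹ := by field_simp; norm_num
  rw [h3] at hupper
  have h4 : (2 * Real.pi)⁻¹ = 4 * (8 * Real.pi)⁻¹ := by field_simp; norm_num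
  have h5 : 0 < (8 * Real.pi)⁻¹ := by positivity
  linarith

/-! ### The lower bound -/

/-- The interval is placed on the side of `s` facing the midpoint, so it stays in the open interval
even when `s` is an endpoint, for instance on a boundary circle. -/
theorem exists_subinterval {a b l s : ℝ} (hl : 0 < l) (hlab : 8 * l ≤ b - a) (hs : s ∈ Icc a b) :
    ∃ i, Icc i (i + l) ⊆ Ioo a b ∧ ∀ x ∈ Icc i (i + l), |x - s| ≤ 2 * l := by
  rcases le_total s ((a + b) / 2) with h | h
  · refine ⟨s + l, fun x hx => ⟨?_, ?_⟩, fun x hx => abs_le.2 ⟨?_, ?_⟩⟩ <;>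
      linarith [hx.1, hx.2, hs.1, hs.2]
  · refine ⟨s - 2 * l, fun x hx => ⟨?_, ?_⟩, fun x hx => abs_le.2 ⟨?_, ?_⟩⟩ <;>
      linarith [hx.1, hx.2, hs.1, hs.2]

theorem agmon_lower_bound {S : RevSurface} {f : ℝ → ℝ} (hf : S.IsW2Inf f) {c : ℝ} (hc : 0 < c)
    {smin : ℝ} (hsmin : smin ∈ S.IL)
    (huniq : ∀ s ∈ S.IL, s ≠ smin → S.V f c smin < S.V f c s) {ψ : ℕ → ℝ × ℝ → ℂ}
    {τ : ℕ → ℝ} (hτ : Tendsto τ atTop (𝓝 0))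
    (H : ∀ᶠ k : ℕ in atTop, ∃ Q y z e : ℝ → ℝ,
      S.NormalizedRadial (fun s => S.V f c s - S.V f c smin) (c / k) (τ k) (ψ k) Q y z e)
    {η δ : ℝ} (hη : 0 < η) (hδ : 0 < δ) :
    ∃ k₀ : ℕ, ∃ C > 0, ∀ k ≥ k₀, ∀ s ∈ S.IL, (∀ p ∈ S.poles, η < |s - p|) →
      C * Real.exp (-(1 / (c / k)) * (S.dA f c smin s + δ))
        ≤ S.normL2 (Metric.ball s η ∩ S.IL) (ψ k) := by
  have hL := S.L_pos
  obtain ⟨a, b, r₁, hab, ha0, hbL, hr₁, habI, hsm, hball, hfar⟩ := S.exists_nhds_subset_Icc hsmin hη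
  obtain ⟨M, hM, hlip⟩ := exists_signedDist_lipschitz hf (c := c) hsmin habI
  have habL : Icc a b ⊆ Icc 0 S.L := Icc_subset_Icc ha0 hbL
  have hIoo : Ioo a b ⊆ Ioo 0 S.L := Ioo_subset_Ioo ha0 hbL
  set W : ℝ → ℝ := fun s => S.V f c s - S.V f c smin with hW
  set D := S.signedDist f c smin with hD
  have hWc : ContinuousOn W (Icc a b) := ((continuousOn_V hf c).mono habI).sub continuousOn_const
  have hW0 : ∀ s ∈ Icc a b, 0 ≤ W s := fun s hs => V_sub_nonneg huniq (habI hs)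
  have hRc : ContinuousOn S.R (Icc a b) := S.continuousOn_R.mono habL
  -- bounds for the coefficients on the compact interval
  obtain ⟨W₁, hW₁⟩ := isCompact_Icc.exists_bound_of_continuousOn hWc
  obtain ⟨R₁, hR₁⟩ := isCompact_Icc.exists_bound_of_continuousOn hRc
  obtain ⟨ρ₁, hρ₁⟩ := isCompact_Icc.exists_bound_of_continuousOn (S.continuousOn_ds_R.mono habL)
  obtain ⟨x₀, hx₀, hx₀min⟩ := isCompact_Icc.exists_isMinOn (nonempty_Icc.2 hab.le) hRc
  set r₀ := S.R x₀ with hr₀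
  have hr₀pos : 0 < r₀ := S.R_pos x₀ (habI hx₀)
  have hRr₀ : ∀ s ∈ Icc a b, r₀ ≤ S.R s := fun s hs => hx₀min hs
  have hR₁' : ∀ s ∈ Icc a b, S.R s ≤ R₁ := fun s hs => (le_abs_self _).trans (hR₁ s hs)
  have hR₁pos : 0 < R₁ := hr₀pos.trans_le (hR₁' x₀ hx₀)
  have hρ₁0 : 0 ≤ ρ₁ := (norm_nonneg _).trans (hρ₁ x₀ hx₀)
  have hW₁0 : 0 ≤ W₁ := (norm_nonneg _).trans (hW₁ x₀ hx₀)
  -- a polynomial approximation of the effective potential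
  set v := (δ / (16 * S.L)) ^ 2 with hv
  have hvpos : 0 < v := by positivity
  -- Thus the loss `4 √v |x - s₀|` in the propagation estimate is at most `δ / 4`. The other two
  -- losses are at most `δ / 8` each, thanks to the choices of `l` and `r` below.
  have hsqrtv : √v = δ / (16 * S.L) := Real.sqrt_sq (by positivity)
  -- Approximating `W + 3v/2` within `v/2` puts `A` between `W + v` and `W + 2v`, with a bounded
  -- derivative. If `|Q - W| ≤ v`, then `|Q - A| ≤ 3v`.
  obtain ⟨p, hp⟩ := exists_polynomial_near_of_continuousOn a b (fun s => W s + 3 / 2 * v)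
    (hWc.add continuousOn_const) (v / 2) (by positivity)
  set A : ℝ → ℝ := fun s => p.eval s with hA
  have hA1 : ∀ s ∈ Icc a b, v ≤ A s := fun s hs => by
    have := (abs_lt.1 (hp s hs)).1
    have := hW0 s hs
    simp only [hA]; linarith
  have hA2 : ∀ s ∈ Icc a b, A s ≤ W s + 2 * v := fun s hs => by
    have := (abs_lt.1 (hp s hs)).2
    simp only [hA]; linarith
  obtain ⟨a₁, ha₁⟩ := isCompact_Icc.exists_bound_of_continuousOn
    (s := Icc a b) (f := fun s => p.derivative.eval s) (Polynomial.continuous _).continuousOn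
  set l := min (min 1 (η / 4)) (min (δ / (16 * M)) ((b - a) / 8)) with hl
  have hlpos : 0 < l := lt_min (lt_min one_pos (by positivity))
    (lt_min (by positivity) (by linarith))
  have hl1 : l ≤ 1 := (min_le_left _ _).trans (min_le_left _ _)
  have hlη : l ≤ η / 4 := (min_le_left _ _).trans (min_le_right _ _)
  have hlM : l ≤ δ / (16 * M) := (min_le_right _ _).trans (min_le_left _ _)
  have hlab : l ≤ (b - a) / 8 := (min_le_right _ _).trans (min_le_right _ _)
  set r := min r₁ (δ / (8 * M)) with hr
  have hrpos : 0 < r := lt_min hr₁ (by positivity)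
  obtain ⟨κ, hκ, hmass⟩ := exists_point_with_mass hf hc hsmin huniq hrpos
  set n₀ := v * (1 / (16 * Real.pi * r) / R₁) with hn₀
  have hn₀pos : 0 < n₀ := by positivity
  set K := R₁ * (W₁ + v) + 3 * R₁ + ρ₁ + R₁ * (W₁ + 2 * v) with hK
  have hKpos : 0 < K := by positivity
  set I := ∫ x in 0..l, (x * (l - x)) ^ 2 with hI
  have hIpos : 0 < I := integral_bump_pos hlpos
  have hεlim : Tendsto (fun k : ℕ => c / (k : ℝ)) atTop (𝓝 0) := tendsto_const_div_atTop_nhds_zero_nat c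
  have hsm_lim : Tendsto (fun k : ℕ => c / (k : ℝ) * (2 * (ρ₁ / r₀) + a₁ / v)) atTop (𝓝 0) := by
    simpa using hεlim.mul_const (2 * (ρ₁ / r₀) + a₁ / v)
  have hev : ∀ᶠ k : ℕ in atTop, τ k ≤ κ ∧ τ k ≤ v ∧ c / (k : ℝ) ≤ 1 ∧
      c / (k : ℝ) * (2 * (ρ₁ / r₀) + a₁ / v) ≤ √v := by
    filter_upwards [hτ.eventually_lt_const hκ, hτ.eventually_lt_const hvpos,
      hεlim.eventually_lt_const one_pos, hsm_lim.eventually_lt_const (Real.sqrt_pos.2 hvpos)]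
      with k h1 h2 h3 h4 using ⟨h1.le, h2.le, h3.le, h4.le⟩
  obtain ⟨k₀, hk₀⟩ := eventually_atTop.1 (H.and (hev.and (eventually_ge_atTop 1)))
  -- Here `n₀` bounds the energy density at the starting point, `r₀ I / K` is the Caccioppoli loss,
  -- and the outer `r₀` comes from the volume density. None of these depends on `k` or `s`.
  refine ⟨k₀, √(2 * Real.pi * (r₀ * (n₀ * r₀ * I / K))), by positivity, fun k hk s hs hsp => ?_⟩
  obtain ⟨⟨Q, y, z, e, hN⟩, ⟨hτκ, hτv, hε1, hsmall⟩, hk1⟩ := hk₀ k hk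
  have hkpos : (0 : ℝ) < k := by exact_mod_cast hk1
  set ε := c / (k : ℝ) with hε
  have hε0 : 0 < ε := div_pos hc hkpos
  obtain ⟨s₀, hs₀, hs₀r, hs₀m⟩ := hmass hε0 hτκ hN
  have hs₀ab : s₀ ∈ Ioo a b := hball s₀ hs₀ (hs₀r.trans_le (min_le_left _ _))
  have hsab : s ∈ Icc a b := hfar s hs hsp
  obtain ⟨i, hiab, his⟩ := exists_subinterval hlpos (by linarith) hsab
  have hile : i ≤ i + l := by linarith
  have hN0 : n₀ ≤ energyDensity ε A y e s₀ := by
    have hy := hN.energy.y_nonneg s₀ hs₀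
    have he := hN.energy.e_nonneg s₀ hs₀
    have h1 : 1 / (16 * Real.pi * r) / R₁ ≤ y s₀ := by
      rw [div_le_iff₀ hR₁pos, mul_comm (y s₀)]
      exact hs₀m.trans (mul_le_mul_of_nonneg_right (hR₁' s₀ (Ioo_subset_Icc_self hs₀ab)) hy)
    have h2 : n₀ ≤ A s₀ * y s₀ :=
      mul_le_mul (hA1 s₀ (Ioo_subset_Icc_self hs₀ab)) h1 (by positivity)
        (hvpos.le.trans (hA1 s₀ (Ioo_subset_Icc_self hs₀ab)))
    simp only [energyDensity]
    have : 0 ≤ ε ^ 2 * e s₀ := by positivity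
    linarith
  set m := n₀ * Real.exp (-(2 / ε * (S.dA f c smin s + δ))) with hm
  have hprop : ∀ x ∈ Icc i (i + l), m ≤ energyDensity ε A y e x := by
    intro x hx
    have hxab := hiab hx
    refine le_trans ?_ (hN.energy.energyDensity_propagation hε0 hIoo
      (fun s hs => hW0 s (Ioo_subset_Icc_self hs)) (hWc.mono Ioo_subset_Icc_self)
      (fun s hs => hasDerivAt_signedDist hf hsmin (hIoo hs))
      (A' := fun s => p.derivative.eval s) (fun s _ => p.hasDerivAt s)
      (Polynomial.continuous _).continuousOn hvpos
      (fun s hs => hA1 s (Ioo_subset_Icc_self hs)) (fun s hs => hA2 s (Ioo_subset_Icc_self hs))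
      ?_ (ρ₀ := ρ₁ / r₀) (fun s hs => ?_) (fun s hs => ha₁ s (Ioo_subset_Icc_self hs)) hsmall
      hs₀ab hxab)
    · refine mul_le_mul hN0 (Real.exp_le_exp.2 (neg_le_neg ?_)) (Real.exp_pos _).le
        (hn₀pos.le.trans hN0)
      refine mul_le_mul_of_nonneg_left ?_ (by positivity)
      have h1 : |D x - D s| ≤ δ / 8 := by
        refine (hlip x (Ioo_subset_Icc_self hxab) s hsab).trans ?_
        calc M * |x - s| ≤ M * (2 * (δ / (16 * M))) :=
              mul_le_mul_of_nonneg_left ((his x hx).trans (by linarith)) hM.le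
          _ = δ / 8 := by field_simp; norm_num
      have h2 : |D s₀| ≤ δ / 8 := by
        have h3 := hlip s₀ (Ioo_subset_Icc_self hs₀ab) smin hsm
        have h4 : D smin = 0 := by simp [hD, signedDist]
        rw [h4, sub_zero] at h3
        refine h3.trans ?_
        calc M * |s₀ - smin| ≤ M * (δ / (8 * M)) :=
              mul_le_mul_of_nonneg_left (hs₀r.le.trans (min_le_right _ _)) hM.le
          _ = δ / 8 := by field_simp
      have h5 : |x - s₀| ≤ S.L := by
        have := hIoo hxab
        rw [abs_le]; constructor <;> linarith [this.1, this.2, hs₀.1, hs₀.2]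
      have h6 : 4 * √v * |x - s₀| ≤ δ / 4 := by
        rw [hsqrtv]
        calc 4 * (δ / (16 * S.L)) * |x - s₀| ≤ 4 * (δ / (16 * S.L)) * S.L :=
              mul_le_mul_of_nonneg_left h5 (by positivity)
          _ = δ / 4 := by field_simp; norm_num
      have h7 : |D x - D s₀| ≤ |D x - D s| + |D s| + |D s₀| := by
        calc |D x - D s₀| = |(D x - D s) + D s - D s₀| := by ring_nf
          _ ≤ |(D x - D s) + D s| + |D s₀| := abs_sub _ _
          _ ≤ |D x - D s| + |D s| + |D s₀| := by linarith [abs_add_le (D x - D s) (D s)]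
      have h8 : S.dA f c smin s = |D s| := rfl
      rw [h8]
      linarith
    · filter_upwards [hN.potential] with x hx hxm
      have h1 := (abs_le.1 (hx (hIoo hxm)))
      have h2 := abs_lt.1 (hp x (Ioo_subset_Icc_self hxm))
      change |Q x - p.eval x| ≤ 3 * v
      rw [abs_le]
      constructor <;> linarith [h1.1, h1.2, h2.1, h2.2]
    · have hR := S.R_pos_of_mem (hIoo hs)
      rw [abs_div, abs_of_pos hR]
      exact div_le_div₀ hρ₁0 (hρ₁ s (Ioo_subset_Icc_self hs)) hr₀pos
        (hRr₀ s (Ioo_subset_Icc_self hs))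
  have hiab' : Icc i (i + l) ⊆ Icc a b := hiab.trans Ioo_subset_Icc_self
  have hmpos : 0 < m := by positivity
  have hcac := hN.energy.mass_ge_of_energyDensity_ge hε0 hε1 hlpos hl1
    (hIoo (hiab ⟨le_rfl, hile⟩)) (hIoo (hiab ⟨hile, le_rfl⟩))
    (fun x hx => ⟨hRr₀ x (hiab' hx), hR₁' x (hiab' hx)⟩) hr₀pos.le (fun x hx => hρ₁ x (hiab' hx))
    (q₁ := W₁ + v) (by
      filter_upwards [hN.potential] with x hx hxm
      have h1 := hx (hIoo (hiab hxm))
      have h2 := hW₁ x (hiab' hxm)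
      calc |Q x| = |(Q x - W x) + W x| := by ring_nf
        _ ≤ |Q x - W x| + |W x| := abs_add_le _ _
        _ ≤ W₁ + v := by rw [Real.norm_eq_abs] at h2; linarith)
    (A₁ := W₁ + 2 * v) (fun x hx => (hA2 x (hiab' hx)).trans (by
      have := (le_abs_self _).trans (hW₁ x (hiab' hx)); linarith))
    (by positivity) hmpos.le hprop
  have hsubset : Icc i (i + l) ⊆ Ioo 0 S.L ∩ (Metric.ball s η ∩ S.IL) := fun x hx => by
    refine ⟨hIoo (hiab hx), ?_, habI (hiab' hx)⟩
    rw [Metric.mem_ball, Real.dist_eq]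
    exact (his x hx).trans_lt (by linarith)
  have hmeas : MeasurableSet (Metric.ball s η ∩ S.IL) :=
    Metric.isOpen_ball.measurableSet.inter S.measurableSet_IL
  have hmono : r₀ * ∫ x in i..(i + l), y x
      ≤ ∫ x in Ioo 0 S.L ∩ (Metric.ball s η ∩ S.IL), S.R x * y x := by
    rw [intervalIntegral.integral_of_le hile, ← integral_Icc_eq_integral_Ioc, ← integral_const_mul]
    have hRyi := hN.int_mul.mono_set (inter_subset_left (t := Metric.ball s η ∩ S.IL))
    refine (setIntegral_mono_on ?_ (hRyi.mono_set hsubset) measurableSet_Icc fun x hx => ?_).trans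
      (setIntegral_mono_set hRyi ?_ hsubset.eventuallyLE)
    · exact (continuousOn_const.mul
        (hN.energy.continuousOn_y.mono (hiab.trans hIoo))).integrableOn_Icc
    · exact mul_le_mul_of_nonneg_right (hRr₀ x (hiab' hx))
        (hN.energy.y_nonneg x (hIoo (hiab hx)))
    · rw [EventuallyLE, ae_restrict_iff' (measurableSet_Ioo.inter hmeas)]
      exact Eventually.of_forall fun x hx => hN.mul_nonneg hx.1
  rw [hN.norm _ hmeas]
  refine Real.le_sqrt_of_sq_le ?_
  have hexp : Real.exp (-(1 / ε) * (S.dA f c smin s + δ)) ^ 2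
      = Real.exp (-(2 / ε * (S.dA f c smin s + δ))) := by
    rw [← Real.exp_nat_mul]
    congr 1
    push_cast
    ring
  rw [mul_pow, Real.sq_sqrt (by positivity), hexp]
  have h1 : m * r₀ * I / K ≤ ∫ x in i..(i + l), y x := by
    rw [div_le_iff₀ hKpos, mul_comm _ K]
    exact hcac
  calc 2 * Real.pi * (r₀ * (n₀ * r₀ * I / K)) * Real.exp (-(2 / ε * (S.dA f c smin s + δ)))
      = 2 * Real.pi * (r₀ * (m * r₀ * I / K)) := by rw [hm]; ring
    _ ≤ 2 * Real.pi * (r₀ * ∫ x in i..(i + l), y x) := by gcongr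
    _ ≤ _ := mul_le_mul_of_nonneg_left hmono (by positivity)

/-! ### The optimal exponential constant -/

theorem ds_of_eqOn_zero {S : RevSurface} {f : ℝ → ℝ} (hf : ∀ s ∈ Icc 0 S.L, f s = 0)
    {s : ℝ} (hs : s ∈ Icc 0 S.L) : S.ds f s = 0 := by
  rw [ds, derivWithin_congr (f := fun _ => (0 : ℝ)) (fun x hx => hf x hx) (hf s hs),
    derivWithin_fun_const]
  rfl

theorem V_eq_of_eqOn_zero {S : RevSurface} {f : ℝ → ℝ} (hf : ∀ s ∈ Icc 0 S.L, f s = 0) (c : ℝ)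
    {s : ℝ} (hs : s ∈ Icc 0 S.L) : S.V f c s = c ^ 2 * S.V 0 1 s := by
  have h1 : S.ds f s = 0 := ds_of_eqOn_zero hf hs
  have h2 : S.ds 0 s = 0 := ds_of_eqOn_zero (fun _ _ => rfl) hs
  simp only [V, h1, h2]
  ring

/-- Without `f` the effective potential is exactly quadratic in `c`, and the distance integrates its
square root. -/
theorem dA_eq_of_eqOn_zero {S : RevSurface} {f : ℝ → ℝ} (hf : ∀ s ∈ Icc 0 S.L, f s = 0) {c : ℝ}
    (hc : 0 < c) {s₀ s : ℝ} (hs₀ : s₀ ∈ Icc 0 S.L) (hs : s ∈ Icc 0 S.L) :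
    S.dA f c s₀ s = c * S.dA 0 1 s₀ s := by
  rw [dA, dA, ← abs_of_pos hc, ← abs_mul, abs_of_pos hc, ← intervalIntegral.integral_const_mul]
  congr 1
  refine intervalIntegral.integral_congr fun y hy => ?_
  have hy' := ordConnected_Icc.uIcc_subset hs₀ hs hy
  simp only [V_eq_of_eqOn_zero hf c hy', V_eq_of_eqOn_zero hf c hs₀, ← mul_sub]
  rw [Real.sqrt_mul (sq_nonneg c), Real.sqrt_sq hc.le]

open scoped Pointwise in
theorem dASet_eq_of_eqOn_zero {S : RevSurface} {f : ℝ → ℝ} (hf : ∀ s ∈ Icc 0 S.L, f s = 0) {c : ℝ}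
    (hc : 0 < c) {s₀ : ℝ} (hs₀ : s₀ ∈ Icc 0 S.L) {J : Set ℝ} (hJ : J ⊆ Icc 0 S.L) :
    S.dASet f c s₀ J = c * S.dASet 0 1 s₀ J := by
  have : S.dA f c s₀ '' J = c • (S.dA 0 1 s₀ '' J) := by
    rw [← image_smul, image_image]
    exact image_congr fun s hs => dA_eq_of_eqOn_zero hf hc hs₀ (hJ hs)
  rw [dASet, this, Real.sInf_smul_of_nonneg hc.le, smul_eq_mul, dASet]

theorem NormalizedRadial.normL2_mono {S : RevSurface} {W : ℝ → ℝ} {ε τ : ℝ} {ψ : ℝ × ℝ → ℂ}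
    {Q y z e : ℝ → ℝ} (h : S.NormalizedRadial W ε τ ψ Q y z e) {J J' : Set ℝ}
    (hJ : MeasurableSet J) (hJ' : MeasurableSet J') (hsub : J ⊆ J') :
    S.normL2 J ψ ≤ S.normL2 J' ψ := by
  rw [h.norm J hJ, h.norm J' hJ']
  refine Real.sqrt_le_sqrt (mul_le_mul_of_nonneg_left ?_ (by positivity))
  refine setIntegral_mono_set (h.int_mul.mono_set inter_subset_left) ?_
    (inter_subset_inter_right _ hsub).eventuallyLE
  rw [EventuallyLE, ae_restrict_iff' (measurableSet_Ioo.inter hJ')]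
  exact Eventually.of_forall fun s hs => h.mul_nonneg hs.1

/-- The exponents in the observability inequality, for sequences `N` of observed norms bounded
below and above by the Agmon estimates. -/
theorem isGLB_exponents {N a : ℕ → ℝ} {R₀ d : ℝ} (hR₀ : 0 < R₀)
    (ha : Tendsto a atTop (𝓝 R₀⁻¹))
    (hlow : ∀ δ > 0, ∃ k₀ : ℕ, ∃ C > 0, ∀ k ≥ k₀, C * Real.exp (-(k * (d + δ))) ≤ N k)
    (hup : ∀ δ > 0, ∃ k₀ : ℕ, ∃ C > 0, ∀ k ≥ k₀, N k ≤ C * Real.exp (-(k * (d - δ)))) :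
    IsGLB {K : ℝ | ∃ k₀ : ℕ, ∃ C > 0, ∀ k ≥ k₀, 1 ≤ C * Real.exp (K * (k * a k)) * N k}
      (R₀ * d) := by
  refine ⟨fun K ⟨k₀, C, hC, h⟩ => ?_, fun b hb => ?_⟩
  · suffices hK : d ≤ K * R₀⁻¹ by
      rw [← div_eq_mul_inv, le_div_iff₀ hR₀] at hK
      linarith
    refine le_of_forall_pos_le_add fun δ hδ => ?_
    obtain ⟨k₁, C', hC', h'⟩ := hup δ hδ
    -- Taking logarithms and dividing by `k` removes the multiplicative constants in the limit.
    have hlim : Tendsto (fun k : ℕ => Real.log (C * C') / (k : ℝ) + K * a k) atTop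
        (𝓝 (0 + K * R₀⁻¹)) :=
      (tendsto_const_div_atTop_nhds_zero_nat _).add (ha.const_mul K)
    rw [zero_add] at hlim
    have hge : d - δ ≤ K * R₀⁻¹ := by
      refine ge_of_tendsto hlim ?_
      filter_upwards [eventually_ge_atTop k₀, eventually_ge_atTop k₁, eventually_ge_atTop 1]
        with k h1 h2 h3
      have hk : (0 : ℝ) < k := by exact_mod_cast h3
      have h4 : 1 ≤ C * C' * Real.exp (K * (k * a k) - k * (d - δ)) := by
        calc (1 : ℝ) ≤ C * Real.exp (K * (k * a k)) * N k := h k h1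
          _ ≤ C * Real.exp (K * (k * a k)) * (C' * Real.exp (-(k * (d - δ)))) :=
            mul_le_mul_of_nonneg_left (h' k h2) (by positivity)
          _ = _ := by rw [sub_eq_add_neg (K * _), Real.exp_add]; ring
      have h5 := Real.log_nonneg h4
      rw [Real.log_mul (by positivity) (Real.exp_pos _).ne', Real.log_exp] at h5
      have h6 : Real.log (C * C') / (k : ℝ) + K * a k
          = (Real.log (C * C') + K * (k * a k)) / k := by field_simp
      rw [h6, le_div_iff₀ hk]
      linarith
    linarith
  · refine le_of_forall_gt_imp_ge_of_dense fun K hK => hb ?_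
    have h1 : d < K * R₀⁻¹ := by
      rw [← div_eq_mul_inv, lt_div_iff₀ hR₀]
      linarith
    -- The margin between `d` and `K / R₀` is split at `d'`: one side pays for the loss in the lower
    -- bound, the other for the convergence of `a`.
    obtain ⟨d', hd, hd'⟩ := exists_between h1
    obtain ⟨k₀, C, hC, h⟩ := hlow (d' - d) (sub_pos.2 hd)
    obtain ⟨k₁, hk₁⟩ := eventually_atTop.1 ((ha.const_mul K).eventually_const_lt hd')
    refine ⟨max k₀ k₁, C⁻¹, inv_pos.2 hC, fun k hk => ?_⟩
    have h2 := h k ((le_max_left _ _).trans hk)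
    have h3 := hk₁ k ((le_max_right _ _).trans hk)
    have h4 : 1 ≤ Real.exp (K * (k * a k) - k * d') := by
      refine Real.one_le_exp ?_
      have := mul_le_mul_of_nonneg_left h3.le (k.cast_nonneg (α := ℝ))
      linarith
    calc (1 : ℝ) ≤ Real.exp (K * (k * a k) - k * d') := h4
      _ = C⁻¹ * Real.exp (K * (k * a k)) * (C * Real.exp (-(k * (d + (d' - d))))) := by
        rw [sub_eq_add_neg (K * _), Real.exp_add, add_sub_cancel]
        field_simp
      _ ≤ _ := mul_le_mul_of_nonneg_left h2 (by positivity)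

theorem exists_ball_subset {S : RevSurface} {O : Set ℝ} (hO : IsOpen O) {s : ℝ}
    (hs : s ∈ O ∩ S.IL) :
    ∃ η > 0, Metric.ball s η ∩ S.IL ⊆ O ∩ S.IL ∧ ∀ p ∈ S.poles, η < |s - p| := by
  have h1 : IsOpen (O ∩ S.polesᶜ) := hO.inter S.finite_poles.isClosed.isOpen_compl
  obtain ⟨η, hη, h⟩ := Metric.isOpen_iff.1 h1 s ⟨hs.1, hs.2.2⟩
  refine ⟨η / 2, by positivity, fun x hx => ⟨(h ?_).1, hx.2⟩, fun p hp => ?_⟩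
  · exact Metric.ball_subset_ball (by linarith) hx.1
  · by_contra hcon
    have hpb : p ∈ Metric.ball s η := by
      rw [Metric.mem_ball, Real.dist_eq, abs_sub_comm]
      linarith [not_lt.1 hcon]
    exact (h hpb).2 hp

end RevSurface

/-! ### Assembly of the two bounds and the optimal constant -/

theorem mainTheorem5 (S : RevSurface) (f q : ℝ → ℝ) (hf : S.IsW2Inf f)
    (hq : MemLp q ∞ (volume.restrict (Ioo 0 S.L)))
    (c : ℝ) (hc : 0 < c) (smin : ℝ) (hsmin : smin ∈ S.IL)
    (huniq : ∀ s ∈ S.IL, s ≠ smin → S.V f c smin < S.V f c s)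
    (μ : ℕ → ℝ) (hμ : Tendsto μ atTop (𝓝 (S.V f c smin)))
    (φ : ℕ → ℝ → ℂ) (ψ : ℕ → ℝ × ℝ → ℂ)
    (hψ : ∀ (k : ℕ) (s θ : ℝ), ψ k (s, θ) = Complex.exp (Complex.I * k * θ) * φ k s)
    (heig : ∀ᶠ k : ℕ in atTop, S.SolvesEigen f q (c / k) (μ k) (ψ k))
    (hnorm : ∀ᶠ k : ℕ in atTop, S.normL2 univ (ψ k) = 1) :
    -- the lower bound, uniform at distance more than `η` from the poles
    (∀ η > 0, ∀ δ > 0, ∃ k₀ : ℕ, ∃ C > 0, ∀ k ≥ k₀, ∀ s ∈ S.IL, (∀ p ∈ S.poles, η < |s - p|) →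
      C * Real.exp (-(1 / (c / k)) * (S.dA f c smin s + δ))
        ≤ S.normL2 (Metric.ball s η ∩ S.IL) (ψ k)) ∧
    -- the matching upper bound, uniform over all rotationally invariant sets
    (∀ δ : ℝ, 0 < δ → δ < 1 → ∃ k₀ : ℕ, ∃ C > 0, ∀ k ≥ k₀,
      ∀ J : Set ℝ, MeasurableSet J → J.Nonempty → J ⊆ S.IL →
        S.normL2 J (ψ k)
          ≤ C * Real.exp (-(1 / (c / k)) * ((1 - δ) * S.dASet f c smin J - δ))) ∧
    -- the optimal exponential constant of this family of Laplace eigenfunctions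
    ((∀ s ∈ Icc 0 S.L, f s = 0) → (∀ s ∈ Ioo 0 S.L, q s = 0) →
      ∀ O : Set ℝ, IsOpen O → (O ∩ S.IL).Nonempty →
        IsGLB {K : ℝ | ∃ k₀ : ℕ, ∃ C > 0, ∀ k ≥ k₀,
            S.normL2 univ (ψ k)
              ≤ C * Real.exp (K * Real.sqrt (μ k / (c / k) ^ 2)) * S.normL2 (O ∩ S.IL) (ψ k)}
          (S.R smin * S.dASet 0 1 smin (O ∩ S.IL))) := by
  obtain ⟨τ, hτ, H⟩ := S.exists_normalizedRadial hf hq hc hμ hψ heig hnorm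
  have hlower := fun η (hη : (0 : ℝ) < η) δ (hδ : (0 : ℝ) < δ) =>
    RevSurface.agmon_lower_bound hf hc hsmin huniq hτ H hη hδ
  have hupper := fun δ (hδ : (0 : ℝ) < δ) (hδ1 : δ < 1) =>
    RevSurface.agmon_upper_bound hf hc hsmin huniq hτ H hδ hδ1
  refine ⟨hlower, hupper, fun hf0 _ O hO hne => ?_⟩
  set d := S.dASet 0 1 smin (O ∩ S.IL) with hd
  have hIL : O ∩ S.IL ⊆ Icc 0 S.L := fun s hs => hs.2.1
  have hdc : S.dASet f c smin (O ∩ S.IL) = c * d :=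
    RevSurface.dASet_eq_of_eqOn_zero hf0 hc hsmin.1 hIL
  have hR₀ := S.R_pos smin hsmin
  have hmeas : MeasurableSet (O ∩ S.IL) := hO.measurableSet.inter S.measurableSet_IL
  have hd0 : 0 ≤ d := S.dASet_nonneg 0 1 smin _
  have hVmin : S.V f c smin = (c / S.R smin) ^ 2 := by
    rw [RevSurface.V_eq_of_eqOn_zero hf0 c hsmin.1, RevSurface.V,
      RevSurface.ds_of_eqOn_zero (f := 0) (fun _ _ => rfl) hsmin.1]
    ring
  -- For large `k`, `√λ_k` is `k` times this sequence, so the cost per unit of `√λ_k` is `R(smin)`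
  -- times the cost per unit of `k`.
  have ha : Tendsto (fun k => √(μ k) / c) atTop (𝓝 (S.R smin)⁻¹) := by
    have h1 := (hμ.sqrt).div_const c
    rw [hVmin, Real.sqrt_sq (div_pos hc hR₀).le] at h1
    convert h1 using 2
    field_simp
  have key := RevSurface.isGLB_exponents (N := fun k => S.normL2 (O ∩ S.IL) (ψ k)) (d := d) hR₀ ha
    (fun δ hδ => ?_) (fun δ hδ => ?_)
  · convert key using 1
    ext K
    have hset : ∀ᶠ k : ℕ in atTop, S.normL2 univ (ψ k) = 1 ∧
        Real.sqrt (μ k / (c / k) ^ 2) = k * (√(μ k) / c) := by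
      filter_upwards [hnorm, eventually_ge_atTop 1] with k h1 h2
      have hk : (0 : ℝ) < k := by exact_mod_cast h2
      refine ⟨h1, ?_⟩
      rw [Real.sqrt_div' _ (sq_nonneg _), Real.sqrt_sq (div_pos hc hk).le]
      field_simp
    obtain ⟨k₁, hk₁⟩ := eventually_atTop.1 hset
    constructor
    · rintro ⟨k₀, C, hC, h⟩
      refine ⟨max k₀ k₁, C, hC, fun k hk => ?_⟩
      obtain ⟨h1, h2⟩ := hk₁ k ((le_max_right _ _).trans hk)
      rw [← h1, ← h2]
      exact h k ((le_max_left _ _).trans hk)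
    · rintro ⟨k₀, C, hC, h⟩
      refine ⟨max k₀ k₁, C, hC, fun k hk => ?_⟩
      obtain ⟨h1, h2⟩ := hk₁ k ((le_max_right _ _).trans hk)
      rw [h1, h2]
      exact h k ((le_max_left _ _).trans hk)
  -- The infimum need not be attained, so half of `δ` is spent on a nearly optimal point and half on
  -- the lower bound there.
  · have hlt : sInf (S.dA 0 1 smin '' (O ∩ S.IL)) < d + δ / 2 := by
      change d < d + δ / 2
      linarith
    obtain ⟨_, ⟨s, hs, rfl⟩, hsd⟩ := exists_lt_of_csInf_lt (hne.image _) hlt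
    obtain ⟨η, hη, hball, hpole⟩ := RevSurface.exists_ball_subset hO hs
    obtain ⟨k₀, C, hC, h⟩ := hlower η hη (c * (δ / 2)) (by positivity)
    obtain ⟨k₁, hk₁⟩ := eventually_atTop.1 (H.and (eventually_ge_atTop 1))
    refine ⟨max k₀ k₁, C, hC, fun k hk => ?_⟩
    obtain ⟨⟨Q, y, z, e, hN⟩, hk1⟩ := hk₁ k ((le_max_right _ _).trans hk)
    have hk0 : (0 : ℝ) < k := by exact_mod_cast hk1
    have h1 := h k ((le_max_left _ _).trans hk) s hs.2 hpole
    have h2 := hN.normL2_mono (Metric.isOpen_ball.measurableSet.inter S.measurableSet_IL) hmeas hball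
    refine le_trans ?_ (h1.trans h2)
    refine mul_le_mul_of_nonneg_left (Real.exp_le_exp.2 ?_) hC.le
    rw [RevSurface.dA_eq_of_eqOn_zero hf0 hc hsmin.1 (hIL hs)]
    have h3 : -(1 / (c / k)) * (c * S.dA 0 1 smin s + c * (δ / 2))
        = -(k * (S.dA 0 1 smin s + δ / 2)) := by field_simp
    rw [h3]
    refine neg_le_neg (mul_le_mul_of_nonneg_left ?_ hk0.le)
    linarith
  -- After rescaling, the multiplicative and additive losses in the upper bound total `δ' (d + 1 /
  -- c)`.
  · obtain ⟨δ', hδ'0, hδ'⟩ : ∃ δ' : ℝ, 0 < δ' ∧ δ' < min 1 (δ / (d + 1 / c)) :=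
      exists_between (lt_min one_pos (by positivity))
    obtain ⟨k₀, C, hC, h⟩ := hupper δ' hδ'0 (hδ'.trans_le (min_le_left _ _))
    refine ⟨max k₀ 1, C, hC, fun k hk => ?_⟩
    have hk1 : 1 ≤ k := (le_max_right _ _).trans hk
    have hk0 : (0 : ℝ) < k := by exact_mod_cast hk1
    refine (h k ((le_max_left _ _).trans hk) _ hmeas hne inter_subset_right).trans ?_
    refine mul_le_mul_of_nonneg_left (Real.exp_le_exp.2 ?_) hC.le
    rw [hdc]
    have h3 : -(1 / (c / k)) * ((1 - δ') * (c * d) - δ')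
        = -(k * (d - δ' * (d + 1 / c))) := by field_simp; ring
    rw [h3]
    refine neg_le_neg (mul_le_mul_of_nonneg_left ?_ hk0.le)
    have h4 : δ' * (d + 1 / c) ≤ δ := by
      have := (hδ'.trans_le (min_le_right _ _)).le
      rwa [le_div_iff₀ (by positivity)] at this
    linarith
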